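/- **Setting.** There are $k$ arms. Sampling arm $i$ at time $t\in\{1,2,\dots\}$ yields a reward $X_{i,t}$ with law $\nu_i$ and mean $\mu_i$; all rewards are independent, and each $\nu_i$ is $1$-sub-Gaussian: $\mathbb E\,e^{s(X_{i,t}-\mu_i)}\le e^{s^2/2}$ for all $s\in\mathbb R$. Arm $i$ is null if $\mu_i\le 0$ and non-null if $\mu_i>0$; $H_0,H_1$ are the sets of null and non-null arms. $T_i(t)$ is the number of samples of arm $i$ up to time $t$, and $\hat\mu_{i,t}$ the mean of these samples ($0$ if there are none). **Algorithm.** Fix $\delta\in(0,1)$. With bets $\lambda_{i,t}=(\hat\mu_{i,t-1}/2)_+$ put $$E_{i,t}=\prod_{s\le t,\ I_s=i}\exp\big(\lambda_{i,s}X_{i,s}-\lambda_{i,s}^2/2\big),\qquad E_{i,\infty}=\limsup_{t\to\infty}E_{i,t}.$$ $R_t$ is the e-BH set at level $\delta$, i.e. the largest $S\subseteq[k]$ with $E_{i,t}\ge k/(\delta|S|)$ for all $i\in S$. At time $t$ the algorithm samples (UCB exploration) $$I_t\in\operatorname*{arg\,max}_{i\in[k]\setminus R_{t-1}}\ \hat\mu_{i,t-1}+\varphi(T_i(t-1),\delta),\qquad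 \varphi(0,\cdot)=\infty,$$ with ties broken by any rule depending on the set of maximisers, the time and a private random variable $U$, uniform on $[0,1]$ and independent of the rewards; it stops sampling once $R_{t-1}=[k]$. Here $\varphi$ is one of $$\varphi^0(n,\delta)=\sqrt{\tfrac{4\log(\log_2(2n)/\delta)}{n}},\qquad \varphi^{\rm JJ}(n,\delta)=\sqrt{\tfrac{2\log(1/\delta)+6\log\log(1/\delta)+3\log\log(en/2)}{n}},$$ $$\varphi^{\rm IS}(n,\delta)=\sqrt{\tfrac{2.89\log\log(2.041n)+2.065\log(4.983/\delta)}{n}}.$$ Let $\mathcal F_t$ be the $\sigma$-algebra generated by $U$ and by the sampled arms and observed rewards up to time $t$. For a random set $R$, $\mathrm{FDR}(R)=\mathbb E\big[|H_0\cap R|/(|R|\vee1)\big]$ and $\mathrm{TPR}(R)=\mathbb E\big[|H_1\cap R|/|H_1|\big]$. **Gaps.** $\Delta=\min_{j\in H_1}\mu_j$; $\Delta_i=\mu_i$ for $i\in H_1$ and $\Delta_i=\Delta-\mu_i$ for $i\in H_0$. Put $h_i=\max(\Delta_i^{-2},e)$ and $h=\max(\Delta^{-2},e)$. **Theorem.**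 (1) For every $\delta\in(0,1)$ and every stopping time $\tau$ of $(\mathcal F_t)$ with values in $\{0,1,2,\dots\}\cup\{\infty\}$, $\mathrm{FDR}(R_\tau)\le\delta$. (2) For every $\delta_0\in(0,1)$ there is a constant $c>0$, depending on $\delta_0$ only, such that for all $k$, all such bandits with $H_1\neq\emptyset$, all $\delta\in(0,\delta_0]$ (with $\delta\le 0.1$ if $\varphi=\varphi^{\rm JJ}$) there is a (deterministic) time $T$ with $\mathrm{TPR}(R_t)\ge1-\delta$ for all $t\ge T$ and $$T\ \le\ c\cdot\min\Big\{\sum_{i\in H_0}h_i\log\frac{\log h_i}{\delta}+\sum_{i\in H_1}h_i\Big(\log h_i\,\log\frac1\delta+\log k\Big),\quad |H_0|\,h\log\frac{\log h}{\delta}+|H_1|\,h\log h\,\log\frac1\delta\Big\}.$$ -/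

import Mathlib

open MeasureTheory ProbabilityTheory Filter
open scoped ENNReal

noncomputable section

namespace BanditFDR

/-! ### e-self-consistency and the e-BH procedure -/

/-- A set `S` of hypotheses is e-self-consistent at level `α` for the e-values `e` if
`min_{i ∈ S} e i ≥ k / (α |S|)`. -/
def IsESelfConsistent {k : ℕ} (α : ℝ) (e : Fin k → ℝ≥0∞) (S : Finset (Fin k)) : Prop :=
  ∀ i ∈ S, ENNReal.ofReal ((k : ℝ) / (α * (S.card : ℝ))) ≤ e i

open Classical in
/-- The e-BH procedure: the largest e-self-consistent set, obtained as the union of all of them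
(see `eBH_isESelfConsistent` and `subset_eBH`). -/
def eBH {k : ℕ} (α : ℝ) (e : Fin k → ℝ≥0∞) : Finset (Fin k) :=
  Finset.univ.filter fun i => ∃ S : Finset (Fin k), IsESelfConsistent α e S ∧ i ∈ S

theorem subset_eBH {k : ℕ} {α : ℝ} {e : Fin k → ℝ≥0∞} {S : Finset (Fin k)}
    (hS : IsESelfConsistent α e S) : S ⊆ eBH α e := by
  classical
  intro i hi
  simp only [eBH, Finset.mem_filter, Finset.mem_univ, true_and]
  exact ⟨S, hS, hi⟩

theorem eBH_isESelfConsistent {k : ℕ} {α : ℝ} (hα : 0 < α) (e : Fin k → ℝ≥0∞) :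
    IsESelfConsistent α e (eBH α e) := by
  classical
  intro i hi
  have hi' := hi
  simp only [eBH, Finset.mem_filter, Finset.mem_univ, true_and] at hi'
  obtain ⟨S, hS, hiS⟩ := hi'
  refine le_trans (ENNReal.ofReal_le_ofReal ?_) (hS i hiS)
  have hcard : (S.card : ℝ) ≤ ((eBH α e).card : ℝ) := by
    exact_mod_cast Finset.card_le_card (subset_eBH hS)
  have hpos : (0 : ℝ) < (S.card : ℝ) := by
    exact_mod_cast Finset.card_pos.mpr ⟨i, hiS⟩
  gcongr

/-! ### Statistics of one run

Times are `1, 2, 3, …`.  `A t` is the arm sampled at time `t` (`none` if no arm is sampled) and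
`x i t` is the reward that arm `i` yields if it is sampled at time `t`. -/

/-- The times `t_i(1) < t_i(2) < … < t_i(T_i(t))` up to `t` at which arm `i` is sampled. -/
def pullTimes {k : ℕ} (A : ℕ → Option (Fin k)) (i : Fin k) (t : ℕ) : Finset ℕ :=
  (Finset.Icc 1 t).filter fun s => A s = some i

/-- `T_i(t)`, the number of samples from arm `i` up to time `t`. -/
def numPulls {k : ℕ} (A : ℕ → Option (Fin k)) (i : Fin k) (t : ℕ) : ℕ :=
  (pullTimes A i t).card

/-- The sample mean of arm `i` at time `t`; it is `0` as long as the arm has not been sampled. -/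
def sampleMean {k : ℕ} (A : ℕ → Option (Fin k)) (x : Fin k → ℕ → ℝ) (i : Fin k) (t : ℕ) : ℝ :=
  (∑ s ∈ pullTimes A i t, x i s) / (numPulls A i t : ℝ)

/-- The bet `λ_{i,t} = (sample mean of arm i at time t - 1, divided by 2)_+`, for `t ≥ 1`. -/
def bet {k : ℕ} (A : ℕ → Option (Fin k)) (x : Fin k → ℕ → ℝ) (i : Fin k) (t : ℕ) : ℝ :=
  max (sampleMean A x i (t - 1) / 2) 0

/-- The predictably-mixed Hoeffding process for the null hypothesis "the mean of arm `i` is at most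
`μ₀ = 0`": the product over the samples of arm `i` of `exp (λ (X - μ₀) - λ² / 2)`. -/
def pmh {k : ℕ} (A : ℕ → Option (Fin k)) (x : Fin k → ℕ → ℝ) (i : Fin k) (t : ℕ) : ℝ :=
  ∏ s ∈ pullTimes A i t, Real.exp (bet A x i s * (x i s - 0) - bet A x i s ^ 2 / 2)

/-- The predictably-mixed Hoeffding e-process at a possibly infinite time; at time `∞` it is the
limit superior. -/
def eValue {k : ℕ} (A : ℕ → Option (Fin k)) (x : Fin k → ℕ → ℝ) (i : Fin k) :
    WithTop ℕ → ℝ≥0∞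
  | (t : ℕ) => ENNReal.ofReal (pmh A x i t)
  | ⊤ => limsup (fun t : ℕ => ENNReal.ofReal (pmh A x i t)) atTop

/-- The rejection set at time `t`: e-BH at level `δ` applied to the e-processes. -/
def rejSet {k : ℕ} (δ : ℝ) (A : ℕ → Option (Fin k)) (x : Fin k → ℕ → ℝ) (t : WithTop ℕ) :
    Finset (Fin k) :=
  eBH δ fun i => eValue A x i t

/-! ### UCB exploration -/

/-- The three time-uniform confidence boundaries. -/
inductive Boundary
  | zero
  | jj
  | is

/-- The width `φ(n, δ)` of the boundary after `n ≥ 1` samples. -/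
def Boundary.width : Boundary → ℕ → ℝ → ℝ
  | .zero, n, δ => Real.sqrt (4 * Real.log (Real.logb 2 (2 * (n : ℝ)) / δ) / (n : ℝ))
  | .jj, n, δ => Real.sqrt ((2 * Real.log (1 / δ) + 6 * Real.log (Real.log (1 / δ))
      + 3 * Real.log (Real.log (Real.exp 1 * (n : ℝ) / 2))) / (n : ℝ))
  | .is, n, δ => Real.sqrt ((2.89 * Real.log (Real.log (2.041 * (n : ℝ)))
      + 2.065 * Real.log (4.983 / δ)) / (n : ℝ))

/-- The levels for which the boundary is used. -/
def Boundary.Admissible : Boundary → ℝ → Prop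
  | .jj, δ => 0 < δ ∧ δ ≤ 0.1
  | .zero, δ => 0 < δ ∧ δ < 1
  | .is, δ => 0 < δ ∧ δ < 1

/-- The upper confidence bound of arm `i` at time `t`: sample mean plus width, and `∞` for an arm
that has not been sampled. -/
def ucbIndex {k : ℕ} (φ : Boundary) (δ : ℝ) (A : ℕ → Option (Fin k)) (x : Fin k → ℕ → ℝ)
    (i : Fin k) (t : ℕ) : EReal :=
  if numPulls A i t = 0 then ⊤
  else ((sampleMean A x i t + φ.width (numPulls A i t) δ : ℝ) : EReal)

open Classical in
/-- The arms that maximise the upper confidence bound at time `t` among those not rejected at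
time `t`; it is empty if and only if all arms are rejected. -/
def ucbMaximizers {k : ℕ} (φ : Boundary) (δ : ℝ) (A : ℕ → Option (Fin k)) (x : Fin k → ℕ → ℝ)
    (t : ℕ) : Finset (Fin k) :=
  (rejSet δ A x t)ᶜ.filter fun i =>
    ∀ j ∈ (rejSet δ A x t)ᶜ, ucbIndex φ δ A x j t ≤ ucbIndex φ δ A x i t

/-- The UCB exploration component: the arm `I_t` sampled at time `t ≥ 1` is a maximiser of the upper
confidence bound at time `t - 1` among the arms not rejected at time `t - 1`; the rule `tie` selects
one of the maximisers.  No arm is sampled once all arms are rejected.  Only the arms sampled before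
time `t` enter the computation of `I_t`. -/
def ucbArm {k : ℕ} (φ : Boundary) (δ : ℝ) (tie : ℕ → Finset (Fin k) → Fin k)
    (x : Fin k → ℕ → ℝ) : ℕ → Option (Fin k)
  | 0 => none
  | t + 1 =>
    let past : ℕ → Option (Fin k) := fun s =>
      if _h : s < t + 1 then ucbArm φ δ tie x s else none
    let M := ucbMaximizers φ δ past x t
    if M.Nonempty then some (tie (t + 1) M) else none

theorem pullTimes_congr {k : ℕ} {A B : ℕ → Option (Fin k)} {t : ℕ} (h : ∀ s ≤ t, A s = B s)
    (i : Fin k) {r : ℕ} (hr : r ≤ t) : pullTimes A i r = pullTimes B i r := by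
  unfold pullTimes
  refine Finset.filter_congr fun s hs => ?_
  rw [h s ((Finset.mem_Icc.mp hs).2.trans hr)]

theorem ucbMaximizers_congr {k : ℕ} (φ : Boundary) (δ : ℝ) {A B : ℕ → Option (Fin k)}
    (x : Fin k → ℕ → ℝ) {t : ℕ} (h : ∀ s ≤ t, A s = B s) :
    ucbMaximizers φ δ A x t = ucbMaximizers φ δ B x t := by
  have hp : ∀ i, ∀ r ≤ t, pullTimes A i r = pullTimes B i r :=
    fun i r hr => pullTimes_congr h i hr
  have hm : ∀ i, ∀ r ≤ t, sampleMean A x i r = sampleMean B x i r := fun i r hr => by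
    simp only [sampleMean, numPulls, hp i r hr]
  have hE : ∀ i, pmh A x i t = pmh B x i t := fun i => by
    unfold pmh
    rw [hp i t le_rfl]
    refine Finset.prod_congr rfl fun s hs => ?_
    have hs' : s - 1 ≤ t :=
      (Nat.sub_le s 1).trans (Finset.mem_Icc.mp (Finset.mem_filter.mp hs).1).2
    simp only [bet, hm i _ hs']
  have hR : rejSet δ A x t = rejSet δ B x t := by
    unfold rejSet
    congr 1
    funext i
    exact congrArg ENNReal.ofReal (hE i)
  have hU : ∀ i, ucbIndex φ δ A x i t = ucbIndex φ δ B x i t := fun i => by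
    have hn : numPulls A i t = numPulls B i t := by unfold numPulls; rw [hp i t le_rfl]
    unfold ucbIndex
    rw [hn, hm i t le_rfl]
  simp only [ucbMaximizers, hR, hU]

/-- The arms sampled by UCB exploration satisfy the defining equation
`I_{t+1} = argmax_{i ∉ R_t} (upper confidence bound of arm i at time t)`. -/
theorem ucbArm_succ {k : ℕ} (φ : Boundary) (δ : ℝ) (tie : ℕ → Finset (Fin k) → Fin k)
    (x : Fin k → ℕ → ℝ) (t : ℕ) :
    ucbArm φ δ tie x (t + 1) =
      if (ucbMaximizers φ δ (ucbArm φ δ tie x) x t).Nonempty then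
        some (tie (t + 1) (ucbMaximizers φ δ (ucbArm φ δ tie x) x t))
      else none := by
  have h : ucbMaximizers φ δ (fun s => if _h : s < t + 1 then ucbArm φ δ tie x s else none) x t
      = ucbMaximizers φ δ (ucbArm φ δ tie x) x t :=
    ucbMaximizers_congr φ δ x fun s hs => by simp [Nat.lt_succ_of_le hs]
  rw [ucbArm]
  simp only [h]

/-- A tie-breaking rule, which may depend on the time and on the private randomness `u`. -/
structure IsTieBreak {k : ℕ} (tie : ℝ → ℕ → Finset (Fin k) → Fin k) : Prop where
  mem : ∀ (u : ℝ) (t : ℕ) (S : Finset (Fin k)), S.Nonempty → tie u t S ∈ S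
  measurable : ∀ (t : ℕ) (S : Finset (Fin k)), Measurable fun u => tie u t S

/-! ### The bandit -/

/-- The sub-Gaussian bandit: the rewards `X i t` of arm `i` have law `ν i`, `ν i` is
`1`-sub-Gaussian around its mean, all rewards are independent, and the private randomness `U` is
uniform on `[0, 1]` and independent of the rewards. -/
structure IsSubGaussianBandit {k : ℕ} {Ω : Type*} [MeasurableSpace Ω] (P : Measure Ω)
    (ν : Fin k → Measure ℝ) (X : Fin k → ℕ → Ω → ℝ) (U : Ω → ℝ) : Prop where
  isProbabilityMeasure : IsProbabilityMeasure P
  measurable_reward : ∀ i t, Measurable (X i t)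
  measurable_private : Measurable U
  law_reward : ∀ i t, P.map (X i t) = ν i
  law_private : P.map U = volume.restrict (Set.Icc (0 : ℝ) 1)
  subGaussian : ∀ i, HasSubgaussianMGF (fun y => y - ∫ z, z ∂(ν i)) 1 (ν i)
  indep_rewards : iIndepFun (fun p : Fin k × ℕ => X p.1 p.2) P
  indep_private : IndepFun U (fun ω (p : Fin k × ℕ) => X p.1 p.2 ω) P

/-- The arm sampled at time `t` by the algorithm, as a random variable. -/
def sampledArm {k : ℕ} {Ω : Type*} (φ : Boundary) (δ : ℝ) (tie : ℝ → ℕ → Finset (Fin k) → Fin k)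
    (X : Fin k → ℕ → Ω → ℝ) (U : Ω → ℝ) (t : ℕ) (ω : Ω) : Option (Fin k) :=
  ucbArm φ δ (tie (U ω)) (fun i s => X i s ω) t

/-- The reward observed at time `t` (set to `0` if no arm is sampled). -/
def observedReward {k : ℕ} {Ω : Type*} (φ : Boundary) (δ : ℝ)
    (tie : ℝ → ℕ → Finset (Fin k) → Fin k) (X : Fin k → ℕ → Ω → ℝ) (U : Ω → ℝ) (t : ℕ) (ω : Ω) :
    ℝ :=
  (sampledArm φ δ tie X U t ω).elim 0 fun i => X i t ω

/-- The rejection set of the algorithm at the (possibly infinite) time `t`. -/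
def rejected {k : ℕ} {Ω : Type*} (φ : Boundary) (δ : ℝ) (tie : ℝ → ℕ → Finset (Fin k) → Fin k)
    (X : Fin k → ℕ → Ω → ℝ) (U : Ω → ℝ) (t : WithTop ℕ) (ω : Ω) : Finset (Fin k) :=
  rejSet δ (fun s => sampledArm φ δ tie X U s ω) (fun i s => X i s ω) t

/-- The canonical filtration: `F_t` is generated by the private randomness and by the arms sampled
and the rewards observed at the times `1, …, t`. -/
@[reducible] def canonicalSigma {k : ℕ} {Ω : Type*} (φ : Boundary) (δ : ℝ)
    (tie : ℝ → ℕ → Finset (Fin k) → Fin k) (X : Fin k → ℕ → Ω → ℝ) (U : Ω → ℝ) (t : ℕ) :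
    MeasurableSpace Ω :=
  MeasurableSpace.comap U inferInstance ⊔
    ⨆ s ∈ Finset.Icc 1 t,
      (MeasurableSpace.comap (sampledArm φ δ tie X U s) ⊤ ⊔
        MeasurableSpace.comap (observedReward φ δ tie X U s) inferInstance)

/-- Stopping times of the canonical filtration; the value `∞` is allowed. -/
def IsStopping {k : ℕ} {Ω : Type*} (φ : Boundary) (δ : ℝ)
    (tie : ℝ → ℕ → Finset (Fin k) → Fin k) (X : Fin k → ℕ → Ω → ℝ) (U : Ω → ℝ)
    (τ : Ω → WithTop ℕ) : Prop :=
  ∀ t : ℕ, MeasurableSet[canonicalSigma φ δ tie X U t] {ω | τ ω = (t : WithTop ℕ)}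

/-! ### Nulls, non-nulls, error metrics and gaps -/

/-- The mean of each arm. -/
def armMean {k : ℕ} (ν : Fin k → Measure ℝ) (i : Fin k) : ℝ := ∫ y, y ∂(ν i)

open Classical in
/-- The null arms, with mean at most `μ₀ = 0`. -/
def nulls {k : ℕ} (μ : Fin k → ℝ) : Finset (Fin k) := Finset.univ.filter fun i => μ i ≤ 0

open Classical in
/-- The non-null arms, with mean above `μ₀ = 0`. -/
def nonNulls {k : ℕ} (μ : Fin k → ℝ) : Finset (Fin k) := Finset.univ.filter fun i => 0 < μ i

/-- The false discovery rate `E [|H₀ ∩ R| / (|R| ∨ 1)]` of a random rejection set. -/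
def FDR {k : ℕ} {Ω : Type*} [MeasurableSpace Ω] (P : Measure Ω) (μ : Fin k → ℝ)
    (R : Ω → Finset (Fin k)) : ℝ :=
  ∫ ω, ((nulls μ ∩ R ω).card : ℝ) / max ((R ω).card : ℝ) 1 ∂P

/-- The true positive rate `E [|H₁ ∩ R| / |H₁|]` of a random rejection set. -/
def TPR {k : ℕ} {Ω : Type*} [MeasurableSpace Ω] (P : Measure Ω) (μ : Fin k → ℝ)
    (R : Ω → Finset (Fin k)) : ℝ :=
  ∫ ω, ((nonNulls μ ∩ R ω).card : ℝ) / ((nonNulls μ).card : ℝ) ∂P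

/-- `Δ`, the smallest mean of a non-null arm. -/
def minGap {k : ℕ} (μ : Fin k → ℝ) : ℝ := ⨅ i : {i : Fin k // 0 < μ i}, μ i

/-- `Δ_i`: the mean of arm `i` if it is non-null, and the smallest non-null mean minus the mean of
arm `i` if it is null. -/
def gap {k : ℕ} (μ : Fin k → ℝ) (i : Fin k) : ℝ := if 0 < μ i then μ i else minGap μ - μ i

/-- `d⁻²`, truncated from below at `e`, so that its iterated logarithms make sense. -/
def invSq (d : ℝ) : ℝ := max ((d ^ 2)⁻¹) (Real.exp 1)

/-- The bound with individual gaps. -/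
def armwiseBound {k : ℕ} (μ : Fin k → ℝ) (δ : ℝ) : ℝ :=
  ∑ i ∈ nulls μ, invSq (gap μ i) * Real.log (Real.log (invSq (gap μ i)) / δ) +
  ∑ i ∈ nonNulls μ, invSq (gap μ i) *
    (Real.log (invSq (gap μ i)) * Real.log (1 / δ) + Real.log (k : ℝ))

/-- The bound with the minimal gap. -/
def uniformBound {k : ℕ} (μ : Fin k → ℝ) (δ : ℝ) : ℝ :=
  ((nulls μ).card : ℝ) * invSq (minGap μ) * Real.log (Real.log (invSq (minGap μ)) / δ) +
  ((nonNulls μ).card : ℝ) * invSq (minGap μ) * Real.log (invSq (minGap μ)) * Real.log (1 / δ)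

end BanditFDR

end

/-!
Both parts rest on nonnegative supermartingales along the adaptive sampling. Whether an arm is
sampled at time `t + 1` is determined by the private randomness and by the rewards up to time `t`,
and its reward at time `t + 1` is independent of these. Hence any function of the samples of one arm
that does not increase in expectation when one more sample is read yields a supermartingale
(`IsSubGaussianBandit.isNonnegSupermartingale`).

**False discovery rate.** The e-process of a null arm is such a supermartingale. A stopped
nonnegative supermartingale converges almost surely, so Fatou's lemma bounds the expected e-value
of a null arm by `1` at every stopping time, `∞` included
(`IsNonnegSupermartingale.lintegral_stopped_le`). By self-consistency of e-BH the proportion of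
nulls among the rejections is at most `δ / k` times the sum of the null e-values
(`eBH_nullProportion_le`).

**Sample complexity.** Rejected arms are no longer sampled, so rejections are never revoked. It
suffices to show, for one non-null arm `i`, that it is not rejected at a late time `t` with
probability at most `δ` (`IsSubGaussianBandit.measure_notMem_rejected_le`). Outside two exceptional
events, `t`, the sum of the numbers of samples of the arms, is bounded deterministically
(`IsUCBRun.time_le`).

* The first exceptional event is that the upper confidence bound of arm `i` ever falls below its
  mean. Its probability is at most `(1 - ε) δ` (`IsSubGaussianBandit.measure_violation_le`), where
  `ε` depends on `δ₀` only. The reason is that the boundaries are covered by mixtures of exponential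
  supermartingales of total mass below `δ` (`MixtureCover`): one exponential supermartingale for
  each epoch of sample sizes, an epoch being a range between two terms of a geometric progression
  (`MixtureCover.of_epoch`, `MixtureCover.of_tail`). For the boundary `φ⁰` at levels close to `1`
  the first sample is treated separately by Cantelli's inequality.
* The second is that the weighted mean, with weights `h`, of the square roots of the running maxima
  of certain noise supermartingales, one for each arm, exceeds `2 / (ε δ)`. Its probability is at
  most `ε δ`, as each square root has expectation at most `2`
  (`IsNonnegSupermartingale.lintegral_sqrt_sup_le`). Otherwise, by concavity of the logarithm, the
  noise contributes at most `2 (∑ h) log (2 / (ε δ))`, without any logarithm of `k`.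

A null arm `j` is sampled only if its upper confidence bound is at least the mean of arm `i`, so
that the width or the noise makes up half of its gap (`IsUCBRun.numPulls_null_le`). The log-e-value
of a non-null arm of mean `m` after `n` samples is at least `(n - 1) m² / 8` up to noise and
`log n` (`numPulls_mul_sq_le`); the error of the bets is controlled by the self-normalised
supermartingale `exp (S² / (4 n) + q / 12) / √(n + 1)`, where `S` is the centred sum and `q` the sum
of the squared errors of the sample means. Before its rejection an arm has a log-e-value of at most
`log (k / δ)`, which gives the bound with individual gaps. For the bound with the minimal gap, less
evidence is needed when several arms are concerned: among any `r` arms, one has before its rejection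
a log-e-value of at most `log (k / (δ r))` (`exists_pmh_lt`). The log-e-values of all non-null arms
together are therefore at most `|H₁| log (1 / δ) + k` (`sum_logPmh_le`), and the term `k` is
absorbed, since each arm contributes a constant to the bound anyway.
-/

noncomputable section

namespace BanditFDR

/-! ### Nonnegative supermartingales with extended real values -/

/-- A nonnegative supermartingale, encoded through set integrals: `Z` is adapted, and the integral
of `Z` over an event known at time `t` does not increase from time `t` to time `t + 1`. -/
structure IsNonnegSupermartingale {Ω : Type*} {mΩ : MeasurableSpace Ω} (P : Measure Ω)
    (ℱ : Filtration ℕ mΩ) (Z : ℕ → Ω → ℝ≥0∞) : Prop where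
  adapted : ∀ t, Measurable[ℱ t] (Z t)
  setLIntegral_succ_le : ∀ t A, MeasurableSet[ℱ t] A →
    ∫⁻ ω in A, Z (t + 1) ω ∂P ≤ ∫⁻ ω in A, Z t ω ∂P

namespace IsNonnegSupermartingale

variable {Ω : Type*} {mΩ : MeasurableSpace Ω} {P : Measure Ω} {ℱ : Filtration ℕ mΩ}
  {Z : ℕ → Ω → ℝ≥0∞}

theorem measurable (h : IsNonnegSupermartingale P ℱ Z) (t : ℕ) : Measurable (Z t) :=
  (h.adapted t).mono (ℱ.le t) le_rfl

theorem lintegral_le (h : IsNonnegSupermartingale P ℱ Z) (t : ℕ) :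
    ∫⁻ ω, Z t ω ∂P ≤ ∫⁻ ω, Z 0 ω ∂P := by
  induction t with
  | zero => exact le_rfl
  | succ t ih =>
    refine le_trans ?_ ih
    simpa using h.setLIntegral_succ_le t Set.univ MeasurableSet.univ

/-- Ville's maximal inequality up to a finite time. -/
theorem mul_measure_exists_le_le (h : IsNonnegSupermartingale P ℱ Z) (c : ℝ≥0∞) (N : ℕ) :
    c * P {ω | ∃ t ≤ N, c ≤ Z t ω} ≤ ∫⁻ ω, Z 0 ω ∂P := by
  have hB : ∀ N, MeasurableSet[ℱ N] {ω | ∃ t ≤ N, c ≤ Z t ω} := by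
    intro N
    have : {ω | ∃ t ≤ N, c ≤ Z t ω} = ⋃ t ∈ Finset.range (N + 1), {ω | c ≤ Z t ω} := by
      ext ω
      simp
    rw [this]
    refine Finset.measurableSet_biUnion _ fun t ht => ?_
    have ht' : t ≤ N := Nat.lt_succ_iff.mp (Finset.mem_range.mp ht)
    exact ((h.adapted t).mono (ℱ.mono ht') le_rfl) measurableSet_Ici
  -- the mass not yet stopped is carried along by `Z N`
  have key : ∀ N, c * P {ω | ∃ t ≤ N, c ≤ Z t ω} + ∫⁻ ω in {ω | ∃ t ≤ N, c ≤ Z t ω}ᶜ, Z N ω ∂P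
      ≤ ∫⁻ ω, Z 0 ω ∂P := by
    intro N
    induction N with
    | zero =>
      have hm := ℱ.le 0 _ (hB 0)
      refine le_trans ?_ (lintegral_add_compl (fun ω => Z 0 ω) hm).le
      refine add_le_add ?_ le_rfl
      rw [← setLIntegral_const]
      refine setLIntegral_mono (h.measurable 0) fun ω hω => ?_
      obtain ⟨t, ht, hc⟩ := hω
      obtain rfl : t = 0 := by omega
      exact hc
    | succ N ih =>
      refine le_trans ?_ ih
      set B := {ω | ∃ t ≤ N, c ≤ Z t ω} with hBdef
      set B' := {ω | ∃ t ≤ N + 1, c ≤ Z t ω} with hBdef'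
      have hmB := ℱ.le N _ (hB N)
      have hmB' := ℱ.le (N + 1) _ (hB (N + 1))
      have hsub : B ⊆ B' := fun ω ⟨t, ht, hc⟩ => ⟨t, by omega, hc⟩
      have hstep := h.setLIntegral_succ_le N Bᶜ (hB N).compl
      have hsplit : ∫⁻ ω in Bᶜ, Z (N + 1) ω ∂P
          = ∫⁻ ω in B' \ B, Z (N + 1) ω ∂P + ∫⁻ ω in B'ᶜ, Z (N + 1) ω ∂P := by
        rw [← lintegral_union hmB'.compl]
        · congr 2
          ext ω
          simp only [Set.mem_compl_iff, Set.mem_union, Set.mem_sdiff]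
          have := @hsub ω
          tauto
        · exact Set.disjoint_left.mpr fun ω hω hω' => hω' hω.1
      have hc : c * P (B' \ B) ≤ ∫⁻ ω in B' \ B, Z (N + 1) ω ∂P := by
        rw [← setLIntegral_const]
        refine setLIntegral_mono (h.measurable _) fun ω hω => ?_
        obtain ⟨⟨t, ht, hc⟩, hn⟩ := hω
        rcases Nat.lt_or_ge t (N + 1) with h1 | h1
        · exact absurd ⟨t, by omega, hc⟩ hn
        · obtain rfl : t = N + 1 := by omega
          exact hc
      have hP : P B' = P B + P (B' \ B) := by
        rw [← measure_union Set.disjoint_sdiff_right (hmB'.diff hmB), Set.union_sdiff_cancel hsub]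
      calc c * P B' + ∫⁻ ω in B'ᶜ, Z (N + 1) ω ∂P
          = c * P B + (c * P (B' \ B) + ∫⁻ ω in B'ᶜ, Z (N + 1) ω ∂P) := by
            rw [hP, mul_add, add_assoc]
        _ ≤ c * P B + (∫⁻ ω in B' \ B, Z (N + 1) ω ∂P + ∫⁻ ω in B'ᶜ, Z (N + 1) ω ∂P) := by
            gcongr
        _ = c * P B + ∫⁻ ω in Bᶜ, Z (N + 1) ω ∂P := by rw [hsplit]
        _ ≤ _ := by gcongr
  exact le_trans le_self_add (key N)

/-- Ville's maximal inequality at threshold one. -/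
theorem measure_exists_one_le_le (h : IsNonnegSupermartingale P ℱ Z) :
    P {ω | ∃ t, 1 ≤ Z t ω} ≤ ∫⁻ ω, Z 0 ω ∂P := by
  have hmono : Monotone fun N => {ω | ∃ t ≤ N, 1 ≤ Z t ω} := by
    intro N M hNM ω ⟨t, ht, hc⟩
    exact ⟨t, ht.trans hNM, hc⟩
  have hU : {ω | ∃ t, 1 ≤ Z t ω} = ⋃ N, {ω | ∃ t ≤ N, 1 ≤ Z t ω} := by
    ext ω
    simp only [Set.mem_ofPred_eq, Set.mem_iUnion]
    exact ⟨fun ⟨t, ht⟩ => ⟨t, t, le_rfl, ht⟩, fun ⟨_, t, _, ht⟩ => ⟨t, ht⟩⟩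
  rw [hU]
  refine le_of_tendsto' (tendsto_measure_iUnion_atTop hmono) fun N => ?_
  simpa using h.mul_measure_exists_le_le 1 N

/-- By the maximal inequality the running maximum has tail `1 / x`; its square root is therefore
integrable, with a universal bound. -/
theorem lintegral_sqrt_sup_le [IsProbabilityMeasure P] {Y : ℕ → Ω → ℝ}
    (hY : ∀ t, Measurable (Y t)) (h0 : ∀ t ω, 0 ≤ Y t ω)
    (h : IsNonnegSupermartingale P ℱ fun t ω => ENNReal.ofReal (Y t ω))
    (h1 : ∀ ω, Y 0 ω ≤ 1) (N : ℕ) :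
    ∫⁻ ω, ENNReal.ofReal
      (Real.sqrt ((Finset.range (N + 1)).sup' Finset.nonempty_range_add_one fun t => Y t ω)) ∂P
      ≤ 2 := by
  set G : Ω → ℝ := fun ω =>
    (Finset.range (N + 1)).sup' Finset.nonempty_range_add_one fun t => Y t ω with hG
  have hG0 : ∀ ω, 0 ≤ G ω := fun ω =>
    (h0 0 ω).trans (Finset.le_sup' (fun t => Y t ω) (by simp))
  have hGm : Measurable G := by
    have := Finset.measurable_sup' (s := Finset.range (N + 1)) Finset.nonempty_range_add_one
      (f := Y) fun t _ => hY t
    convert this using 1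
    ext ω
    simp [hG, Finset.sup'_apply]
  have hZ0 : ∫⁻ ω, ENNReal.ofReal (Y 0 ω) ∂P ≤ 1 := by
    calc _ ≤ ∫⁻ _, 1 ∂P := lintegral_mono fun ω => by
          rw [← ENNReal.ofReal_one]; exact ENNReal.ofReal_le_ofReal (h1 ω)
      _ = 1 := by simp
  have htail : ∀ x : ℝ, 0 < x → P {ω | x < G ω} ≤ ENNReal.ofReal (1 / x) := by
    intro x hx
    have h2 := h.mul_measure_exists_le_le (ENNReal.ofReal x) N
    have h3 : P {ω | x < G ω} ≤ P {ω | ∃ t ≤ N, ENNReal.ofReal x ≤ ENNReal.ofReal (Y t ω)} := by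
      refine measure_mono fun ω hω => ?_
      obtain ⟨t, ht, hlt⟩ := (Finset.lt_sup'_iff _).mp (show x < G ω from hω)
      exact ⟨t, Nat.lt_succ_iff.mp (Finset.mem_range.mp ht), ENNReal.ofReal_le_ofReal hlt.le⟩
    rw [one_div, ENNReal.ofReal_inv_of_pos hx]
    rw [ENNReal.le_inv_iff_mul_le, mul_comm]
    exact (mul_le_mul_right h3 _).trans (h2.trans hZ0)
  have hlc := lintegral_rpow_eq_lintegral_meas_lt_mul P (f := G) (ae_of_all _ hG0)
    hGm.aemeasurable (p := 1 / 2) (by norm_num)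
  simp_rw [Real.sqrt_eq_rpow]
  rw [hlc]
  have hsplit : Set.Ioi (0 : ℝ) = Set.Ioc 0 1 ∪ Set.Ioi 1 := by
    rw [Set.Ioc_union_Ioi_eq_Ioi zero_le_one]
  have hA : ∫⁻ t in Set.Ioc (0 : ℝ) 1, P {a | t < G a} * ENNReal.ofReal (t ^ ((1 / 2 : ℝ) - 1))
      ≤ 2 := by
    have hint : IntegrableOn (fun t : ℝ => t ^ ((1 / 2 : ℝ) - 1)) (Set.Ioc 0 1) := by
      rw [← intervalIntegrable_iff_integrableOn_Ioc_of_le zero_le_one]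
      exact intervalIntegral.intervalIntegrable_rpow' (by norm_num)
    calc _ ≤ ∫⁻ t in Set.Ioc (0 : ℝ) 1, ENNReal.ofReal (t ^ ((1 / 2 : ℝ) - 1)) := by
          refine setLIntegral_mono' measurableSet_Ioc fun t _ => ?_
          calc _ ≤ 1 * ENNReal.ofReal (t ^ ((1 / 2 : ℝ) - 1)) := by
                gcongr; exact prob_le_one
            _ = _ := one_mul _
      _ = ENNReal.ofReal (∫ t in Set.Ioc (0 : ℝ) 1, t ^ ((1 / 2 : ℝ) - 1)) := by
          rw [ofReal_integral_eq_lintegral_ofReal hint]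
          exact (ae_restrict_iff' measurableSet_Ioc).mpr
            (ae_of_all _ fun t ht => Real.rpow_nonneg ht.1.le _)
      _ ≤ 2 := by
          rw [← intervalIntegral.integral_of_le zero_le_one, integral_rpow (by norm_num)]
          norm_num
  have hC : ∫⁻ t in Set.Ioi (1 : ℝ), P {a | t < G a} * ENNReal.ofReal (t ^ ((1 / 2 : ℝ) - 1))
      ≤ 2 := by
    have hint : IntegrableOn (fun t : ℝ => t ^ (-(3 / 2) : ℝ)) (Set.Ioi 1) :=
      integrableOn_Ioi_rpow_of_lt (by norm_num) one_pos
    calc _ ≤ ∫⁻ t in Set.Ioi (1 : ℝ), ENNReal.ofReal (t ^ (-(3 / 2) : ℝ)) := by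
          refine setLIntegral_mono' measurableSet_Ioi fun t ht => ?_
          have ht0 : (0 : ℝ) < t := lt_trans one_pos ht
          calc _ ≤ ENNReal.ofReal (1 / t) * ENNReal.ofReal (t ^ ((1 / 2 : ℝ) - 1)) := by
                gcongr; exact htail t ht0
            _ = _ := by
                rw [← ENNReal.ofReal_mul (by positivity), one_div, ← Real.rpow_neg_one,
                  ← Real.rpow_add ht0]
                norm_num
      _ = ENNReal.ofReal (∫ t in Set.Ioi (1 : ℝ), t ^ (-(3 / 2) : ℝ)) := by
          rw [ofReal_integral_eq_lintegral_ofReal hint]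
          exact (ae_restrict_iff' measurableSet_Ioi).mpr
            (ae_of_all _ fun t ht => Real.rpow_nonneg (lt_trans one_pos ht).le _)
      _ ≤ 2 := by
          rw [integral_Ioi_rpow_of_lt (by norm_num) one_pos]
          norm_num
  calc _ ≤ ENNReal.ofReal (1 / 2) * (2 + 2) := by
        gcongr
        rw [hsplit]
        exact (lintegral_union_le _ _ _).trans (add_le_add hA hC)
    _ = 2 := by
        rw [show (2 + 2 : ℝ≥0∞) = ENNReal.ofReal 4 by norm_num, ← ENNReal.ofReal_mul (by norm_num)]
        norm_num

/-- The optional stopping inequality at a possibly infinite stopping time, for the limit superior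
at infinity: the stopped process converges almost surely, so Fatou's lemma applies. -/
theorem lintegral_stopped_le [IsProbabilityMeasure P] {Y : ℕ → Ω → ℝ} (h0 : ∀ t ω, 0 ≤ Y t ω)
    (hYm : ∀ t, Measurable[ℱ t] (Y t))
    (h : IsNonnegSupermartingale P ℱ fun t ω => ENNReal.ofReal (Y t ω))
    (h1 : ∀ ω, Y 0 ω ≤ 1) {τ : Ω → WithTop ℕ}
    (hτ : ∀ t : ℕ, MeasurableSet[ℱ t] {ω | τ ω = (t : WithTop ℕ)}) :
    ∫⁻ ω, limsup (fun t : ℕ => ENNReal.ofReal (Y (min (t : WithTop ℕ) (τ ω)).untopA ω)) atTop ∂P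
      ≤ 1 := by
  set W : ℕ → Ω → ℝ := fun t ω => Y (min (t : WithTop ℕ) (τ ω)).untopA ω with hW
  have hle : ∀ t : ℕ, MeasurableSet[ℱ t] {ω | τ ω ≤ (t : WithTop ℕ)} := by
    intro t
    have : {ω | τ ω ≤ (t : WithTop ℕ)}
        = ⋃ s ∈ Finset.range (t + 1), {ω | τ ω = (s : WithTop ℕ)} := by
      ext ω
      simp only [Set.mem_ofPred_eq, Finset.mem_range, Set.mem_iUnion, exists_prop]
      constructor
      · intro hω
        lift τ ω to ℕ using ne_top_of_le_ne_top (WithTop.coe_ne_top) hω with s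
        exact ⟨s, Nat.lt_succ_of_le (WithTop.coe_le_coe.mp hω), rfl⟩
      · rintro ⟨s, hs, hω⟩
        rw [hω]
        exact WithTop.coe_le_coe.mpr (Nat.lt_succ_iff.mp hs)
    rw [this]
    exact Finset.measurableSet_biUnion _ fun s hs =>
      ℱ.mono (Nat.lt_succ_iff.mp (Finset.mem_range.mp hs)) _ (hτ s)
  have hW0 : ∀ t ω, 0 ≤ W t ω := fun t ω => h0 _ ω
  have hWsucc : ∀ (t : ℕ) ω,
      W (t + 1) ω = if τ ω ≤ (t : WithTop ℕ) then W t ω else Y (t + 1) ω := by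
    intro t ω
    simp only [hW]
    split_ifs with hω
    · rw [min_eq_right hω, min_eq_right (hω.trans
        (show (t : WithTop ℕ) ≤ ((t + 1 : ℕ) : WithTop ℕ) from
          WithTop.coe_le_coe.mpr (Nat.le_succ t)))]
    · rw [min_eq_left]
      · rfl
      · push Not at hω
        cases hτω : τ ω with
        | top => exact le_top
        | coe s =>
          rw [hτω] at hω
          exact WithTop.coe_le_coe.mpr (Nat.succ_le_of_lt (WithTop.coe_lt_coe.mp hω))
  have hWeq : ∀ (t : ℕ) ω, ¬ τ ω ≤ (t : WithTop ℕ) → W t ω = Y t ω := by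
    intro t ω hω
    simp only [hW]
    rw [min_eq_left (not_le.mp hω).le]
    rfl
  have hWm : ∀ t, Measurable[ℱ t] (W t) := by
    intro t
    induction t with
    | zero =>
      have : W 0 = Y 0 := by
        ext ω
        simp only [hW]
        rw [min_eq_left (by simp)]
        rfl
      rw [this]
      exact hYm 0
    | succ t ih =>
      have : W (t + 1) = fun ω => if τ ω ≤ (t : WithTop ℕ) then W t ω else Y (t + 1) ω :=
        funext fun ω => hWsucc t ω
      rw [this]
      exact Measurable.ite (ℱ.mono (Nat.le_succ t) _ (hle t))
        (ih.mono (ℱ.mono (Nat.le_succ t)) le_rfl) (hYm (t + 1))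
  have hstep : ∀ t A, MeasurableSet[ℱ t] A → ∫⁻ ω in A, ENNReal.ofReal (W (t + 1) ω) ∂P
      ≤ ∫⁻ ω in A, ENNReal.ofReal (W t ω) ∂P := by
    intro t A hA
    set D := {ω | τ ω ≤ (t : WithTop ℕ)} with hD
    have hDm := ℱ.le t _ (hle t)
    rw [← lintegral_inter_add_sdiff (fun ω => ENNReal.ofReal (W (t + 1) ω)) A hDm,
      ← lintegral_inter_add_sdiff (fun ω => ENNReal.ofReal (W t ω)) A hDm]
    have hAm := ℱ.le t _ hA
    refine add_le_add (le_of_eq ?_) ?_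
    · refine setLIntegral_congr_fun (hAm.inter hDm) fun ω hω => ?_
      show ENNReal.ofReal (W (t + 1) ω) = ENNReal.ofReal (W t ω)
      rw [hWsucc, if_pos (show τ ω ≤ (t : WithTop ℕ) from hω.2)]
    · calc ∫⁻ ω in A \ D, ENNReal.ofReal (W (t + 1) ω) ∂P
          = ∫⁻ ω in A \ D, ENNReal.ofReal (Y (t + 1) ω) ∂P := by
            refine setLIntegral_congr_fun (hAm.diff hDm) fun ω hω => ?_
            show ENNReal.ofReal (W (t + 1) ω) = ENNReal.ofReal (Y (t + 1) ω)
            rw [hWsucc, if_neg (show ¬ τ ω ≤ (t : WithTop ℕ) from hω.2)]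
        _ ≤ ∫⁻ ω in A \ D, ENNReal.ofReal (Y t ω) ∂P :=
            h.setLIntegral_succ_le t _ (MeasurableSet.diff hA (hle t))
        _ = ∫⁻ ω in A \ D, ENNReal.ofReal (W t ω) ∂P := by
            refine setLIntegral_congr_fun (hAm.diff hDm) fun ω hω => ?_
            show ENNReal.ofReal (Y t ω) = ENNReal.ofReal (W t ω)
            rw [hWeq t ω hω.2]
  have hSW : IsNonnegSupermartingale P ℱ fun t ω => ENNReal.ofReal (W t ω) :=
    ⟨fun t => (hWm t).ennreal_ofReal, hstep⟩
  have hW1 : ∀ t, ∫⁻ ω, ENNReal.ofReal (W t ω) ∂P ≤ 1 := by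
    intro t
    refine (hSW.lintegral_le t).trans ?_
    calc ∫⁻ ω, ENNReal.ofReal (W 0 ω) ∂P ≤ ∫⁻ _, 1 ∂P := by
          refine lintegral_mono fun ω => ?_
          rw [← ENNReal.ofReal_one]
          refine ENNReal.ofReal_le_ofReal (le_trans (le_of_eq ?_) (h1 ω))
          simp only [hW]
          rw [min_eq_left (by simp)]
          rfl
      _ = 1 := by simp
  have hWmeas : ∀ t, Measurable (W t) := fun t => (hWm t).mono (ℱ.le t) le_rfl
  have hint : ∀ t, Integrable (W t) P := by
    intro t
    refine ⟨(hWmeas t).aestronglyMeasurable, ?_⟩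
    rw [hasFiniteIntegral_iff_ofReal (ae_of_all _ (hW0 t))]
    exact (hW1 t).trans_lt ENNReal.one_lt_top
  have hsub : Submartingale (fun t ω => -W t ω) ℱ P := by
    refine submartingale_of_setIntegral_le_succ
      (fun t => (hWm t).neg.stronglyMeasurable) (fun t => (hint t).neg) fun t A hA => ?_
    rw [integral_neg, integral_neg, neg_le_neg_iff,
      integral_eq_lintegral_of_nonneg_ae (ae_of_all _ (hW0 _))
        (hWmeas _).aestronglyMeasurable,
      integral_eq_lintegral_of_nonneg_ae (ae_of_all _ (hW0 _))
        (hWmeas _).aestronglyMeasurable]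
    refine ENNReal.toReal_mono ?_ (hstep t A hA)
    exact ((setLIntegral_le_lintegral _ _).trans (hW1 t)).trans_lt ENNReal.one_lt_top |>.ne
  have hconv := hsub.exists_ae_tendsto_of_bdd (R := 1) fun t => by
    have : eLpNorm (fun ω => -W t ω) 1 P = ∫⁻ ω, ENNReal.ofReal (W t ω) ∂P := by
      rw [eLpNorm_one_eq_lintegral_enorm]
      refine lintegral_congr fun ω => ?_
      rw [enorm_neg, Real.enorm_eq_ofReal (hW0 t ω)]
    rw [this]
    simpa using hW1 t
  calc ∫⁻ ω, limsup (fun t : ℕ => ENNReal.ofReal (W t ω)) atTop ∂P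
      = ∫⁻ ω, liminf (fun t : ℕ => ENNReal.ofReal (W t ω)) atTop ∂P := by
        refine lintegral_congr_ae ?_
        filter_upwards [hconv] with ω ⟨l, hω⟩
        have h2 : Tendsto (fun t => ENNReal.ofReal (W t ω)) atTop
            (nhds (ENNReal.ofReal (-l))) := by
          have := (ENNReal.continuous_ofReal.tendsto _).comp hω.neg
          simpa [Function.comp_def] using this
        rw [h2.limsup_eq, h2.liminf_eq]
    _ ≤ liminf (fun t : ℕ => ∫⁻ ω, ENNReal.ofReal (W t ω) ∂P) atTop :=
        lintegral_liminf_le fun t => (hWmeas t).ennreal_ofReal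
    _ ≤ 1 := by
        refine (liminf_le_liminf (v := fun _ => (1 : ℝ≥0∞)) (Eventually.of_forall hW1)).trans ?_
        simp

end IsNonnegSupermartingale

/-- The limit superior of a stopped process is measurable, for stopping times that may be
infinite. -/
theorem measurable_limsup_stopped {Ω : Type*} [MeasurableSpace Ω] {Y : ℕ → Ω → ℝ}
    (hY : ∀ t, Measurable (Y t)) {τ : Ω → WithTop ℕ}
    (hτ : ∀ t : ℕ, MeasurableSet {ω | τ ω = (t : WithTop ℕ)}) :
    Measurable fun ω => limsup (fun t : ℕ =>
      ENNReal.ofReal (Y (min (t : WithTop ℕ) (τ ω)).untopA ω)) atTop := by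
  have hτ' : ∀ c, MeasurableSet {ω | τ ω = c} := by
    intro c
    cases c with
    | coe t => exact hτ t
    | top =>
      have : {ω | τ ω = ⊤} = (⋃ t : ℕ, {ω | τ ω = (t : WithTop ℕ)})ᶜ := by
        ext ω
        cases h : τ ω <;> simp [h]
      rw [this]
      exact (MeasurableSet.iUnion hτ).compl
  refine Measurable.limsup fun t => Measurable.ennreal_ofReal ?_
  have hg : Measurable fun ω => (min (t : WithTop ℕ) (τ ω)).untopA := by
    refine measurable_to_countable' fun n => ?_
    have : (fun ω => (min (t : WithTop ℕ) (τ ω)).untopA) ⁻¹' {n}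
        = ⋃ c ∈ {c : WithTop ℕ | (min (t : WithTop ℕ) c).untopA = n}, {ω | τ ω = c} := by
      ext ω
      simp
    rw [this]
    exact MeasurableSet.biUnion (Set.to_countable _) fun c _ => hτ' c
  exact (measurable_from_prod_countable_right (f := fun p : ℕ × Ω => Y p.1 p.2) hY).comp
    (hg.prodMk measurable_id)

/-! ### Measurability of the algorithm -/

section Measurability

variable {k : ℕ} {Ω : Type*} [MeasurableSpace Ω]

theorem measurableSet_finset_eq {R : Ω → Finset (Fin k)}
    (hR : ∀ i, MeasurableSet {ω | i ∈ R ω}) (S : Finset (Fin k)) : MeasurableSet {ω | R ω = S} := by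
  have : {ω | R ω = S} = ⋂ i, {ω | i ∈ R ω ↔ i ∈ S} := by
    ext ω
    simp [Finset.ext_iff]
  rw [this]
  refine MeasurableSet.iInter fun i => ?_
  by_cases hi : i ∈ S
  · simpa [hi] using hR i
  · convert (hR i).compl using 1
    ext ω
    simp [hi]

variable {A : ℕ → Ω → Option (Fin k)} {X : Fin k → ℕ → Ω → ℝ} {t : ℕ}

theorem measurable_sum_pullTimes (hA : ∀ s ≤ t, ∀ o, MeasurableSet {ω | A s ω = o})
    {f : ℕ → Ω → ℝ} (hf : ∀ s ≤ t, Measurable (f s)) (i : Fin k) {r : ℕ} (hr : r ≤ t) :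
    Measurable fun ω => ∑ s ∈ pullTimes (fun s => A s ω) i r, f s ω := by
  have : (fun ω => ∑ s ∈ pullTimes (fun s => A s ω) i r, f s ω)
      = fun ω => ∑ s ∈ Finset.Icc 1 r, if A s ω = some i then f s ω else 0 := by
    ext ω
    rw [pullTimes, Finset.sum_filter]
  rw [this]
  refine Finset.measurable_sum _ fun s hs => ?_
  have hs' : s ≤ t := (Finset.mem_Icc.mp hs).2.trans hr
  exact Measurable.ite (hA s hs' _) (hf s hs') measurable_const

theorem measurable_numPulls (hA : ∀ s ≤ t, ∀ o, MeasurableSet {ω | A s ω = o}) (i : Fin k) {r : ℕ}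
    (hr : r ≤ t) : Measurable fun ω => numPulls (fun s => A s ω) i r := by
  have : (fun ω => numPulls (fun s => A s ω) i r)
      = fun ω => ∑ s ∈ Finset.Icc 1 r, if A s ω = some i then 1 else 0 := by
    ext ω
    rw [numPulls, pullTimes, Finset.card_filter]
  rw [this]
  refine Finset.measurable_sum _ fun s hs => ?_
  exact Measurable.ite (hA s ((Finset.mem_Icc.mp hs).2.trans hr) _) measurable_const
    measurable_const

theorem measurable_sampleMean (hA : ∀ s ≤ t, ∀ o, MeasurableSet {ω | A s ω = o})
    (hX : ∀ i, ∀ s ≤ t, Measurable (X i s)) (i : Fin k) {r : ℕ} (hr : r ≤ t) :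
    Measurable fun ω => sampleMean (fun s => A s ω) (fun i s => X i s ω) i r :=
  (measurable_sum_pullTimes hA (hX i) i hr).div
    (measurable_from_nat.comp (measurable_numPulls hA i hr))

theorem measurable_pmh (hA : ∀ s ≤ t, ∀ o, MeasurableSet {ω | A s ω = o})
    (hX : ∀ i, ∀ s ≤ t, Measurable (X i s)) (i : Fin k) {r : ℕ} (hr : r ≤ t) :
    Measurable fun ω => pmh (fun s => A s ω) (fun i s => X i s ω) i r := by
  simp only [pmh, ← Real.exp_sum]
  refine (measurable_sum_pullTimes (f := fun s ω =>
    bet (fun s => A s ω) (fun i s => X i s ω) i s * (X i s ω - 0)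
      - bet (fun s => A s ω) (fun i s => X i s ω) i s ^ 2 / 2) hA (fun s hs => ?_) i hr).exp
  have hb : Measurable fun ω => bet (fun s => A s ω) (fun i s => X i s ω) i s :=
    ((measurable_sampleMean hA hX i ((Nat.sub_le s 1).trans hs)).div_const 2).max measurable_const
  exact (hb.mul ((hX i s hs).sub measurable_const)).sub ((hb.pow_const 2).div_const 2)

theorem measurableSet_mem_eBH (δ : ℝ) {e : Fin k → Ω → ℝ≥0∞} (he : ∀ i, Measurable (e i))
    (i : Fin k) : MeasurableSet {ω | i ∈ eBH δ fun j => e j ω} := by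
  have : {ω | i ∈ eBH δ fun j => e j ω}
      = ⋃ S : Finset (Fin k), {ω | IsESelfConsistent δ (fun j => e j ω) S ∧ i ∈ S} := by
    ext ω
    simp [eBH]
  rw [this]
  refine MeasurableSet.iUnion fun S => ?_
  have hsplit : {ω | IsESelfConsistent δ (fun j => e j ω) S ∧ i ∈ S}
      = {ω | IsESelfConsistent δ (fun j => e j ω) S} ∩ {_ω | i ∈ S} := rfl
  rw [hsplit]
  refine MeasurableSet.inter ?_ (MeasurableSet.const _)
  have : {ω | IsESelfConsistent δ (fun j => e j ω) S}
      = ⋂ j ∈ S, {ω | ENNReal.ofReal ((k : ℝ) / (δ * (S.card : ℝ))) ≤ e j ω} := by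
    ext ω
    simp [IsESelfConsistent]
  rw [this]
  exact Finset.measurableSet_biInter _ fun j _ => he j measurableSet_Ici

theorem measurableSet_mem_rejSet (δ : ℝ) (hA : ∀ s ≤ t, ∀ o, MeasurableSet {ω | A s ω = o})
    (hX : ∀ i, ∀ s ≤ t, Measurable (X i s)) (i : Fin k) :
    MeasurableSet {ω | i ∈ rejSet δ (fun s => A s ω) (fun i s => X i s ω) t} :=
  measurableSet_mem_eBH δ
    (e := fun j ω => ENNReal.ofReal (pmh (fun s => A s ω) (fun i s => X i s ω) j t))
    (fun j => (measurable_pmh hA hX j le_rfl).ennreal_ofReal) i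

theorem measurableSet_mem_ucbMaximizers (φ : Boundary) (δ : ℝ)
    (hA : ∀ s ≤ t, ∀ o, MeasurableSet {ω | A s ω = o})
    (hX : ∀ i, ∀ s ≤ t, Measurable (X i s)) (i : Fin k) :
    MeasurableSet {ω | i ∈ ucbMaximizers φ δ (fun s => A s ω) (fun i s => X i s ω) t} := by
  have hidx : ∀ j, Measurable fun ω => ucbIndex φ δ (fun s => A s ω) (fun i s => X i s ω) j t := by
    intro j
    have hn := measurable_numPulls hA j le_rfl
    refine Measurable.ite (hn (measurableSet_singleton 0)) measurable_const ?_
    refine measurable_coe_real_ereal.comp ((measurable_sampleMean hA hX j le_rfl).add ?_)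
    exact (measurable_from_nat (f := fun n => φ.width n δ)).comp hn
  have hR := measurableSet_mem_rejSet δ hA hX
  have : {ω | i ∈ ucbMaximizers φ δ (fun s => A s ω) (fun i s => X i s ω) t}
      = {ω | i ∈ rejSet δ (fun s => A s ω) (fun i s => X i s ω) t}ᶜ
        ∩ ⋂ j, ({ω | j ∈ rejSet δ (fun s => A s ω) (fun i s => X i s ω) t}
          ∪ {ω | ucbIndex φ δ (fun s => A s ω) (fun i s => X i s ω) j t
            ≤ ucbIndex φ δ (fun s => A s ω) (fun i s => X i s ω) i t}) := by
    ext ω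
    simp only [ucbMaximizers, Set.mem_ofPred_eq, Finset.mem_filter, Finset.mem_compl,
      Set.mem_inter_iff, Set.mem_compl_iff, Set.mem_iInter, Set.mem_union, or_iff_not_imp_left]
  rw [this]
  exact (hR i).compl.inter (MeasurableSet.iInter fun j =>
    (hR j).union (measurableSet_le (hidx j) (hidx i)))

/-- The arm sampled at time `t + 1` is a measurable function of the private randomness and of the
rewards up to time `t`. -/
theorem measurableSet_sampledArm_eq (φ : Boundary) (δ : ℝ)
    {tie : ℝ → ℕ → Finset (Fin k) → Fin k} (htie : IsTieBreak tie) {U : Ω → ℝ} (hU : Measurable U)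
    (t : ℕ) (hX : ∀ i, ∀ s ≤ t, Measurable (X i s)) :
    ∀ s ≤ t + 1, ∀ o, MeasurableSet {ω | sampledArm φ δ tie X U s ω = o} := by
  intro s
  induction s using Nat.strong_induction_on with
  | _ s ih =>
    intro hs o
    cases s with
    | zero =>
      have : {ω | sampledArm φ δ tie X U 0 ω = o} = {ω | (none : Option (Fin k)) = o} := by
        ext ω
        simp [sampledArm, ucbArm]
      rw [this]
      exact MeasurableSet.const _
    | succ r =>
      set M : Ω → Finset (Fin k) := fun ω =>
        ucbMaximizers φ δ (fun s => sampledArm φ δ tie X U s ω) (fun i s => X i s ω) r with hM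
      have hMm : ∀ S, MeasurableSet {ω | M ω = S} := measurableSet_finset_eq fun i =>
        measurableSet_mem_ucbMaximizers φ δ
          (fun q hq => ih q (by omega) (by omega)) (fun i q hq => hX i q (by omega)) i
      have : {ω | sampledArm φ δ tie X U (r + 1) ω = o}
          = ⋃ S : Finset (Fin k), {ω | M ω = S}
            ∩ {ω | (if S.Nonempty then some (tie (U ω) (r + 1) S) else none) = o} := by
        ext ω
        simp only [Set.mem_ofPred_eq, Set.mem_iUnion, Set.mem_inter_iff, exists_eq_left']
        rw [sampledArm, ucbArm_succ]
        rfl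
      rw [this]
      refine MeasurableSet.iUnion fun S => (hMm S).inter ?_
      by_cases hS : S.Nonempty
      · simp only [hS, if_true]
        cases o with
        | none => simp
        | some j =>
          simp only [Option.some.injEq]
          exact ((htie.measurable (r + 1) S).comp hU) (measurableSet_singleton j)
      · simp only [hS, if_false]
        exact MeasurableSet.const _

end Measurability

/-! ### The filtration generated by the rewards of all arms -/

/-- The private randomness (index `none`) and the rewards (index `some (i, t)`) as one family. -/
def coord {k : ℕ} {Ω : Type*} (X : Fin k → ℕ → Ω → ℝ) (U : Ω → ℝ) : Option (Fin k × ℕ) → Ω → ℝ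
  | none => U
  | some p => X p.1 p.2

/-- The coordinates known at time `t`. -/
def known (k t : ℕ) : Set (Option (Fin k × ℕ)) := {j | ∀ p, j = some p → p.2 ≤ t}

/-- The filtration generated by the private randomness and by the rewards of all arms, sampled or
not.  It is finer than the canonical filtration of the algorithm. -/
def fullFiltration {k : ℕ} {Ω : Type*} [mΩ : MeasurableSpace Ω] {X : Fin k → ℕ → Ω → ℝ}
    {U : Ω → ℝ} (hX : ∀ i t, Measurable (X i t)) (hU : Measurable U) : Filtration ℕ mΩ where
  seq t := ⨆ j ∈ known k t, MeasurableSpace.comap (coord X U j) inferInstance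
  mono' := fun s t hst => biSup_mono fun j hj p hp => (hj p hp).trans hst
  le' := fun t => iSup₂_le fun j _ => by
    cases j with
    | none => exact hU.comap_le
    | some p => exact (hX p.1 p.2).comap_le

section Independence

variable {k : ℕ} {Ω : Type*} [mΩ : MeasurableSpace Ω] {P : Measure Ω} {ν : Fin k → Measure ℝ}
  {X : Fin k → ℕ → Ω → ℝ} {U : Ω → ℝ}

theorem measurable_coord_fullFiltration (hX : ∀ i t, Measurable (X i t)) (hU : Measurable U)
    {t : ℕ} {j : Option (Fin k × ℕ)} (hj : j ∈ known k t) :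
    Measurable[fullFiltration hX hU t] (coord X U j) :=
  measurable_iff_comap_le.mpr
    (le_iSup₂_of_le (f := fun j (_ : j ∈ known k t) =>
      MeasurableSpace.comap (coord X U j) inferInstance) j hj le_rfl)

theorem measurable_private_fullFiltration (hX : ∀ i t, Measurable (X i t)) (hU : Measurable U)
    (t : ℕ) : Measurable[fullFiltration hX hU t] U :=
  measurable_coord_fullFiltration hX hU (j := none) fun p hp => by simp at hp

theorem measurable_reward_fullFiltration (hX : ∀ i t, Measurable (X i t)) (hU : Measurable U)
    {t s : ℕ} (hs : s ≤ t) (i : Fin k) : Measurable[fullFiltration hX hU t] (X i s) :=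
  measurable_coord_fullFiltration hX hU (j := some (i, s)) fun p hp => by
    obtain rfl := Option.some.inj hp
    exact hs

/-- The private randomness and all rewards together are independent: the two independence
assumptions on the bandit are merged into one. -/
theorem IsSubGaussianBandit.iIndepFun_coord (hB : IsSubGaussianBandit P ν X U) :
    iIndepFun (coord X U) P := by
  classical
  have := hB.isProbabilityMeasure
  rw [iIndepFun_iff_measure_inter_preimage_eq_mul]
  intro S sets hsets
  -- the rewards among the coordinates in `S`
  set S' : Finset (Fin k × ℕ) := Finset.eraseNone S with hS'
  set B : Set (Fin k × ℕ → ℝ) := ⋂ p ∈ S', {x | x p ∈ sets (some p)} with hB'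
  have hBm : MeasurableSet B := Finset.measurableSet_biInter _ fun p hp =>
    measurable_pi_apply p (hsets (some p) (Finset.mem_eraseNone.mp hp))
  have hX : P ((fun ω (p : Fin k × ℕ) => X p.1 p.2 ω) ⁻¹' B)
      = ∏ p ∈ S', P (coord X U (some p) ⁻¹' sets (some p)) := by
    have h := (iIndepFun_iff_measure_inter_preimage_eq_mul.mp hB.indep_rewards) S'
      (sets := fun p => sets (some p)) fun p hp => hsets (some p) (Finset.mem_eraseNone.mp hp)
    rw [hB', Set.preimage_iInter₂]
    exact h
  have hsome : ∀ T : Finset (Option (Fin k × ℕ)), none ∉ T → Finset.eraseNone T = S' →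
      ((⋂ j ∈ T, coord X U j ⁻¹' sets j) = (fun ω (p : Fin k × ℕ) => X p.1 p.2 ω) ⁻¹' B) ∧
      ∏ j ∈ T, P (coord X U j ⁻¹' sets j)
        = ∏ p ∈ S', P (coord X U (some p) ⁻¹' sets (some p)) := by
    intro T hT hTS
    have hTmap : T = S'.map Function.Embedding.some := by
      ext j
      cases j with
      | none => simp [hT]
      | some p => simp [← hTS]
    constructor
    · rw [hTmap, hB', Set.preimage_iInter₂]
      ext ω
      simp only [Finset.mem_map, Function.Embedding.some_apply, Set.mem_iInter]
      exact ⟨fun h p hp => h _ ⟨p, hp, rfl⟩, fun h _ ⟨p, hp, hj⟩ => hj ▸ h p hp⟩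
    · rw [hTmap, Finset.prod_map]
      rfl
  by_cases hn : none ∈ S
  · obtain ⟨h1, h2⟩ := hsome (S.erase none) (by simp) (by ext p; simp [hS'])
    have hi : (⋂ j ∈ S, coord X U j ⁻¹' sets j)
        = U ⁻¹' sets none ∩ (fun ω (p : Fin k × ℕ) => X p.1 p.2 ω) ⁻¹' B := by
      rw [← h1]
      conv_lhs => rw [← Finset.insert_erase hn]
      rw [Finset.set_biInter_insert]
      rfl
    rw [hi, hB.indep_private.measure_inter_preimage_eq_mul _ _ (hsets none hn) hBm, hX, ← h2,
      ← Finset.mul_prod_erase S _ hn]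
    rfl
  · obtain ⟨h1, h2⟩ := hsome S hn rfl
    rw [h1, h2, hX]

/-- A reward at time `t + 1` is independent of what is known at time `t`. -/
theorem IsSubGaussianBandit.indep_fullFiltration (hB : IsSubGaussianBandit P ν X U) (t : ℕ)
    (i : Fin k) :
    Indep (fullFiltration hB.measurable_reward hB.measurable_private t)
      (MeasurableSpace.comap (X i (t + 1)) inferInstance) P := by
  have hle : ∀ j, MeasurableSpace.comap (coord X U j) inferInstance ≤ mΩ := by
    intro j
    cases j with
    | none => exact hB.measurable_private.comap_le
    | some p => exact (hB.measurable_reward p.1 p.2).comap_le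
  have h := indep_iSup_of_disjoint hle hB.iIndepFun_coord.iIndep
    (S := known k t) (T := {some (i, t + 1)}) (by
      rw [Set.disjoint_singleton_right]
      intro h
      have := h (i, t + 1) rfl
      simp at this)
  rw [iSup_singleton] at h
  exact h

/-- Stopping times of the algorithm are stopping times of the filtration generated by all rewards,
in which the supermartingale property is read off from independence. -/
theorem canonicalSigma_le_fullFiltration (φ : Boundary) (δ : ℝ)
    {tie : ℝ → ℕ → Finset (Fin k) → Fin k} (htie : IsTieBreak tie)
    (hX : ∀ i t, Measurable (X i t)) (hU : Measurable U) (t : ℕ) :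
    canonicalSigma φ δ tie X U t ≤ fullFiltration hX hU t := by
  refine sup_le (measurable_private_fullFiltration hX hU t).comap_le (iSup₂_le fun s hs => ?_)
  have hst : s ≤ t := (Finset.mem_Icc.mp hs).2
  have hA : ∀ o, MeasurableSet[fullFiltration hX hU t] {ω | sampledArm φ δ tie X U s ω = o} :=
    @measurableSet_sampledArm_eq k Ω (fullFiltration hX hU t) X φ δ tie htie U
      (measurable_private_fullFiltration hX hU t) t
      (fun i r hr => measurable_reward_fullFiltration hX hU hr i) s (by omega)
  refine sup_le ?_ ?_
  · rintro _ ⟨S, -, rfl⟩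
    have : sampledArm φ δ tie X U s ⁻¹' S = ⋃ o ∈ S, {ω | sampledArm φ δ tie X U s ω = o} := by
      ext ω
      simp
    rw [this]
    exact MeasurableSet.biUnion (Set.to_countable S) fun o _ => hA o
  · refine measurable_iff_comap_le.mp ?_
    have : observedReward φ δ tie X U s
        = fun ω => ∑ i, if sampledArm φ δ tie X U s ω = some i then X i s ω else 0 := by
      ext ω
      rw [observedReward]
      cases sampledArm φ δ tie X U s ω with
      | none => simp
      | some j => simp
    rw [this]
    exact @Finset.measurable_sum _ _ _ _ _ _ (fullFiltration hX hU t) _ _ fun i _ =>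
      Measurable.ite (hA _) (measurable_reward_fullFiltration hX hU hst i) measurable_const

end Independence

/-! ### Processes driven by the samples of one arm -/

/-- The state at time `t` of a machine that starts in the state `s₀` and reads the successive
samples of arm `i` by means of the transition function `upd`. -/
def armState {k : ℕ} {σ : Type*} (A : ℕ → Option (Fin k)) (y : ℕ → ℝ) (i : Fin k)
    (upd : σ → ℝ → σ) (s₀ : σ) : ℕ → σ
  | 0 => s₀
  | t + 1 => if A (t + 1) = some i then upd (armState A y i upd s₀ t) (y (t + 1))
      else armState A y i upd s₀ t

/-- A conditional expectation bound without conditional expectations: the past enters through the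
state `s` and the event `A`, both independent of `Y`, so `Y` can be integrated out first. -/
theorem setLIntegral_comp_le_of_indep {Ω σ : Type*} {m mΩ : MeasurableSpace Ω}
    [MeasurableSpace σ] {P : Measure Ω} [IsProbabilityMeasure P] (hm : m ≤ mΩ) {Y : Ω → ℝ}
    (hY : Measurable Y) (hind : Indep m (MeasurableSpace.comap Y inferInstance) P) {s : Ω → σ}
    (hs : Measurable[m] s) {F : σ → ℝ → ℝ≥0∞} (hF : Measurable (Function.uncurry F))
    {ψ : σ → ℝ≥0∞} (hψ : Measurable ψ) (hle : ∀ s, ∫⁻ y, F s y ∂(P.map Y) ≤ ψ s) {A : Set Ω}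
    (hA : MeasurableSet[m] A) :
    ∫⁻ ω in A, F (s ω) (Y ω) ∂P ≤ ∫⁻ ω in A, ψ (s ω) ∂P := by
  set g : Ω → ℝ≥0∞ × σ := fun ω => (A.indicator (fun _ => 1) ω, s ω) with hg
  have hAi : Measurable[m] (A.indicator fun _ => (1 : ℝ≥0∞)) := measurable_const.indicator hA
  have hgm : Measurable[m] g := hAi.prodMk hs
  have hgm' : Measurable g := hgm.mono hm le_rfl
  have hgY : IndepFun g Y P := by
    rw [IndepFun_iff_Indep]
    exact indep_of_indep_of_le_left hind hgm.comap_le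
  have hmap := (indepFun_iff_map_prod_eq_prod_map_map hgm'.aemeasurable hY.aemeasurable).mp hgY
  have : IsProbabilityMeasure (P.map Y) := Measure.isProbabilityMeasure_map hY.aemeasurable
  have hF' : Measurable fun p : (ℝ≥0∞ × σ) × ℝ => p.1.1 * F p.1.2 p.2 :=
    measurable_fst.fst.mul (hF.comp (measurable_fst.snd.prodMk measurable_snd))
  have h1 : ∀ (f : Ω → ℝ≥0∞), ∫⁻ ω in A, f ω ∂P
      = ∫⁻ ω, (A.indicator (fun _ => (1 : ℝ≥0∞)) ω) * f ω ∂P := by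
    intro f
    rw [← lintegral_indicator (hm _ hA)]
    refine lintegral_congr fun ω => ?_
    by_cases hω : ω ∈ A <;> simp [hω]
  rw [h1, h1]
  calc ∫⁻ ω, (A.indicator (fun _ => (1 : ℝ≥0∞)) ω) * F (s ω) (Y ω) ∂P
      = ∫⁻ p, p.1.1 * F p.1.2 p.2 ∂(P.map fun ω => (g ω, Y ω)) := by
        rw [lintegral_map hF' (hgm'.prodMk hY)]
    _ = ∫⁻ a, ∫⁻ y, a.1 * F a.2 y ∂(P.map Y) ∂(P.map g) := by
        rw [hmap, lintegral_prod _ hF'.aemeasurable]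
    _ ≤ ∫⁻ a, a.1 * ψ a.2 ∂(P.map g) := by
        refine lintegral_mono fun a => ?_
        rw [lintegral_const_mul _ (hF.of_uncurry_left)]
        gcongr
        exact hle a.2
    _ = _ := by
        exact lintegral_map (f := fun a : ℝ≥0∞ × σ => a.1 * ψ a.2)
          (measurable_fst.mul (hψ.comp measurable_snd)) hgm'

section ArmProcess

variable {k : ℕ} {Ω : Type*} [mΩ : MeasurableSpace Ω] {P : Measure Ω} {ν : Fin k → Measure ℝ}
  {X : Fin k → ℕ → Ω → ℝ} {U : Ω → ℝ} {φ : Boundary} {δ : ℝ}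
  {tie : ℝ → ℕ → Finset (Fin k) → Fin k} {σ : Type*} [MeasurableSpace σ]

theorem IsSubGaussianBandit.measurableSet_arm (hB : IsSubGaussianBandit P ν X U)
    (htie : IsTieBreak tie) (t : ℕ) (o : Option (Fin k)) :
    MeasurableSet[fullFiltration hB.measurable_reward hB.measurable_private t]
      {ω | sampledArm φ δ tie X U (t + 1) ω = o} :=
  @measurableSet_sampledArm_eq k Ω (fullFiltration hB.measurable_reward hB.measurable_private t)
    X φ δ tie htie U (measurable_private_fullFiltration _ _ t) t
    (fun i _ hr => measurable_reward_fullFiltration _ _ hr i) (t + 1) le_rfl o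

theorem IsSubGaussianBandit.measurable_armState (hB : IsSubGaussianBandit P ν X U)
    (htie : IsTieBreak tie) (i : Fin k) {upd : σ → ℝ → σ}
    (hupd : Measurable (Function.uncurry upd)) (s₀ : σ) (t : ℕ) :
    Measurable[fullFiltration hB.measurable_reward hB.measurable_private t] fun ω =>
      armState (fun s => sampledArm φ δ tie X U s ω) (fun s => X i s ω) i upd s₀ t := by
  induction t with
  | zero => exact measurable_const
  | succ t ih =>
    have hle := (fullFiltration hB.measurable_reward hB.measurable_private).mono (Nat.le_succ t)
    have ih' := ih.mono hle le_rfl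
    refine Measurable.ite (hle _ (hB.measurableSet_arm htie t (some i))) ?_ ih'
    have hXm := measurable_reward_fullFiltration hB.measurable_reward hB.measurable_private
      (le_refl (t + 1)) i
    exact hupd.comp (ih'.prodMk hXm)

/-- If the potential `ψ` does not increase in expectation when one more sample of arm `i` is read,
then it is a supermartingale along the adaptive sampling of the algorithm: whether arm `i` is
sampled at time `t + 1` is known at time `t`, and its reward is independent of the past. -/
theorem IsSubGaussianBandit.isNonnegSupermartingale (hB : IsSubGaussianBandit P ν X U)
    (htie : IsTieBreak tie) (i : Fin k) {upd : σ → ℝ → σ}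
    (hupd : Measurable (Function.uncurry upd)) (s₀ : σ) {ψ : σ → ℝ≥0∞} (hψ : Measurable ψ)
    (hstep : ∀ s, ∫⁻ y, ψ (upd s y) ∂(ν i) ≤ ψ s) :
    IsNonnegSupermartingale P (fullFiltration hB.measurable_reward hB.measurable_private)
      fun t ω => ψ (armState (fun s => sampledArm φ δ tie X U s ω) (fun s => X i s ω) i
        upd s₀ t) := by
  have := hB.isProbabilityMeasure
  set ℱ := fullFiltration hB.measurable_reward hB.measurable_private with hℱ
  refine ⟨fun t => hψ.comp (hB.measurable_armState htie i hupd s₀ t), fun t A hA => ?_⟩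
  set D := {ω | sampledArm φ δ tie X U (t + 1) ω = some i} with hD
  have hDm : MeasurableSet[ℱ t] D := hB.measurableSet_arm htie t (some i)
  have hAm := ℱ.le t _ hA
  have hDm' := ℱ.le t _ hDm
  rw [← lintegral_inter_add_sdiff _ A hDm', ← lintegral_inter_add_sdiff _ A hDm']
  refine add_le_add ?_ (le_of_eq ?_)
  · calc _ = ∫⁻ ω in A ∩ D, ψ (upd (armState (fun s => sampledArm φ δ tie X U s ω)
              (fun s => X i s ω) i upd s₀ t) (X i (t + 1) ω)) ∂P := by
          refine setLIntegral_congr_fun (hAm.inter hDm') fun ω hω => ?_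
          have hω2 : sampledArm φ δ tie X U (t + 1) ω = some i := hω.2
          simp only [armState, hω2, if_true]
      _ ≤ _ := by
          refine setLIntegral_comp_le_of_indep (ℱ.le t) (hB.measurable_reward i (t + 1))
            (hB.indep_fullFiltration t i)
            (hB.measurable_armState (φ := φ) (δ := δ) htie i hupd s₀ t)
            (F := fun s y => ψ (upd s y)) (hψ.comp hupd) hψ (fun s => ?_)
            (MeasurableSet.inter hA hDm)
          rw [hB.law_reward i (t + 1)]
          exact hstep s
  · refine setLIntegral_congr_fun (hAm.diff hDm') fun ω hω => ?_
    have hω2 : ¬ sampledArm φ δ tie X U (t + 1) ω = some i := hω.2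
    simp only [armState, hω2, if_false]

end ArmProcess

/-! ### Recursions for the statistics of one arm -/

section Recursion

variable {k : ℕ} {A : ℕ → Option (Fin k)} {x : Fin k → ℕ → ℝ} {i : Fin k} {t : ℕ}

theorem pullTimes_zero : pullTimes A i 0 = ∅ := by simp [pullTimes]

theorem pullTimes_succ_of_eq (h : A (t + 1) = some i) :
    pullTimes A i (t + 1) = insert (t + 1) (pullTimes A i t) := by
  ext s
  simp only [pullTimes, Finset.mem_filter, Finset.mem_Icc, Finset.mem_insert]
  constructor
  · rintro ⟨⟨h1, h2⟩, h3⟩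
    rcases Nat.lt_or_ge s (t + 1) with h4 | h4
    · exact Or.inr ⟨⟨h1, by omega⟩, h3⟩
    · exact Or.inl (by omega)
  · rintro (rfl | ⟨⟨h1, h2⟩, h3⟩)
    · exact ⟨⟨by omega, le_rfl⟩, h⟩
    · exact ⟨⟨h1, by omega⟩, h3⟩

theorem pullTimes_succ_of_ne (h : A (t + 1) ≠ some i) :
    pullTimes A i (t + 1) = pullTimes A i t := by
  ext s
  simp only [pullTimes, Finset.mem_filter, Finset.mem_Icc]
  constructor
  · rintro ⟨⟨h1, h2⟩, h3⟩
    refine ⟨⟨h1, ?_⟩, h3⟩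
    rcases Nat.lt_or_ge s (t + 1) with h4 | h4
    · omega
    · obtain rfl : s = t + 1 := by omega
      exact absurd h3 h
  · rintro ⟨⟨h1, h2⟩, h3⟩
    exact ⟨⟨h1, by omega⟩, h3⟩

theorem succ_notMem_pullTimes : t + 1 ∉ pullTimes A i t := by
  simp [pullTimes]

theorem sum_pullTimes_succ_of_eq (f : ℕ → ℝ) (h : A (t + 1) = some i) :
    ∑ s ∈ pullTimes A i (t + 1), f s = ∑ s ∈ pullTimes A i t, f s + f (t + 1) := by
  rw [pullTimes_succ_of_eq h, Finset.sum_insert succ_notMem_pullTimes, add_comm]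

theorem numPulls_succ_of_eq (h : A (t + 1) = some i) :
    numPulls A i (t + 1) = numPulls A i t + 1 := by
  rw [numPulls, pullTimes_succ_of_eq h, Finset.card_insert_of_notMem succ_notMem_pullTimes,
    numPulls]

theorem numPulls_succ_of_ne (h : A (t + 1) ≠ some i) :
    numPulls A i (t + 1) = numPulls A i t := by
  rw [numPulls, pullTimes_succ_of_ne h, numPulls]

/-- The logarithm of the e-process. -/
def logPmh (A : ℕ → Option (Fin k)) (x : Fin k → ℕ → ℝ) (i : Fin k) (t : ℕ) : ℝ :=
  ∑ s ∈ pullTimes A i t, (bet A x i s * x i s - bet A x i s ^ 2 / 2)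

theorem exp_logPmh : Real.exp (logPmh A x i t) = pmh A x i t := by
  rw [logPmh, Real.exp_sum, pmh]
  simp

end Recursion

/-! ### One sub-Gaussian sample -/

section OneSample

variable {ν : Measure ℝ} {m : ℝ}

theorem lintegral_exp_le_of_hasSubgaussianMGF (h : HasSubgaussianMGF (fun y => y - m) 1 ν) (θ : ℝ) :
    ∫⁻ y, ENNReal.ofReal (Real.exp (θ * (y - m))) ∂ν ≤ ENNReal.ofReal (Real.exp (θ ^ 2 / 2)) := by
  rw [← ofReal_integral_eq_lintegral_ofReal (h.integrable_exp_mul θ)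
    (ae_of_all _ fun y => (Real.exp_pos _).le)]
  refine ENNReal.ofReal_le_ofReal ?_
  simpa [mgf] using h.mgf_le θ

theorem lintegral_exp_affine_le (h : HasSubgaussianMGF (fun y => y - m) 1 ν) (a θ : ℝ) :
    ∫⁻ y, ENNReal.ofReal (Real.exp (a + θ * (y - m))) ∂ν
      ≤ ENNReal.ofReal (Real.exp (a + θ ^ 2 / 2)) := by
  simp only [Real.exp_add, ENNReal.ofReal_mul (Real.exp_pos _).le]
  rw [lintegral_const_mul _ (by fun_prop)]
  gcongr
  exact lintegral_exp_le_of_hasSubgaussianMGF h θ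

theorem lintegral_exp_mul_gaussianReal (v : NNReal) (t : ℝ) :
    ∫⁻ g, ENNReal.ofReal (Real.exp (t * g)) ∂(gaussianReal 0 v)
      = ENNReal.ofReal (Real.exp (v * t ^ 2 / 2)) := by
  rw [← ofReal_integral_eq_lintegral_ofReal (integrable_exp_mul_gaussianReal t)
    (ae_of_all _ fun y => (Real.exp_pos _).le)]
  have := mgf_gaussianReal (p := gaussianReal 0 v) (X := id) Measure.map_id t
  simp only [mgf, id, zero_mul, zero_add] at this
  rw [this]

/-- The Gaussian integral of the exponential of a quadratic: completing the square changes the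
variance to `1 / (1 - 2 a)`. -/
theorem lintegral_exp_quadratic_gaussianReal {a : ℝ} (ha : a < 1 / 2) (t : ℝ) :
    ∫⁻ g, ENNReal.ofReal (Real.exp (t * g + a * g ^ 2)) ∂(gaussianReal 0 1)
      = ENNReal.ofReal ((Real.sqrt (1 - 2 * a))⁻¹ * Real.exp (t ^ 2 / (2 * (1 - 2 * a)))) := by
  have hb : 0 < 1 - 2 * a := by linarith
  set v : NNReal := ⟨(1 - 2 * a)⁻¹, (inv_pos.mpr hb).le⟩ with hv
  have hv0 : v ≠ 0 := by
    intro h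
    have := congrArg NNReal.toReal h
    exact (inv_pos.mpr hb).ne' this
  have hvr : (v : ℝ) = (1 - 2 * a)⁻¹ := rfl
  have h1 : ∀ g : ℝ, gaussianPDF 0 1 g * ENNReal.ofReal (Real.exp (t * g + a * g ^ 2))
      = ENNReal.ofReal (Real.sqrt (1 - 2 * a))⁻¹
        * (gaussianPDF 0 v g * ENNReal.ofReal (Real.exp (t * g))) := by
    intro g
    rw [gaussianPDF, gaussianPDF, ← ENNReal.ofReal_mul (gaussianPDFReal_nonneg _ _ _),
      ← ENNReal.ofReal_mul (gaussianPDFReal_nonneg _ _ _), ← ENNReal.ofReal_mul (by positivity)]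
    congr 1
    rw [gaussianPDFReal, gaussianPDFReal, hvr]
    have hs : Real.sqrt (2 * Real.pi * (1 - 2 * a)⁻¹)
        = Real.sqrt (2 * Real.pi) * (Real.sqrt (1 - 2 * a))⁻¹ := by
      rw [Real.sqrt_mul (by positivity), Real.sqrt_inv]
    have hsq : Real.sqrt (1 - 2 * a) ≠ 0 := (Real.sqrt_pos.mpr hb).ne'
    rw [hs, mul_inv, inv_inv]
    simp only [NNReal.coe_one, mul_one, sub_zero]
    have he : Real.exp (-g ^ 2 / 2) * Real.exp (t * g + a * g ^ 2)
        = Real.exp (-g ^ 2 / (2 * (1 - 2 * a)⁻¹)) * Real.exp (t * g) := by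
      rw [← Real.exp_add, ← Real.exp_add]
      congr 1
      field_simp
      ring
    calc _ = (Real.sqrt (2 * Real.pi))⁻¹
          * (Real.exp (-g ^ 2 / 2) * Real.exp (t * g + a * g ^ 2)) := by ring
      _ = _ := by
        rw [he]
        field_simp
  rw [gaussianReal_of_var_ne_zero _ one_ne_zero,
    lintegral_withDensity_eq_lintegral_mul _ (measurable_gaussianPDF _ _) (by fun_prop)]
  simp only [Pi.mul_apply]
  simp_rw [h1]
  rw [lintegral_const_mul (f := fun g => gaussianPDF 0 v g * ENNReal.ofReal (Real.exp (t * g))) _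
    ((measurable_gaussianPDF _ _).mul (by fun_prop))]
  have h2 := lintegral_exp_mul_gaussianReal v t
  rw [gaussianReal_of_var_ne_zero _ hv0,
    lintegral_withDensity_eq_lintegral_mul _ (measurable_gaussianPDF _ _) (by fun_prop)] at h2
  simp only [Pi.mul_apply] at h2
  rw [h2, ← ENNReal.ofReal_mul (by positivity), hvr]
  congr 3
  field_simp

/-- The square-exponential moment of a shifted sub-Gaussian variable, by linearising
`exp (a w ^ 2)` as the Gaussian average of `exp (√(2 a) g w)`. -/
theorem lintegral_exp_sq_le (h : HasSubgaussianMGF (fun y => y - m) 1 ν) [SFinite ν] {a : ℝ}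
    (ha0 : 0 ≤ a) (ha : a < 1 / 2) (c : ℝ) :
    ∫⁻ y, ENNReal.ofReal (Real.exp (a * (c + (y - m)) ^ 2)) ∂ν
      ≤ ENNReal.ofReal ((Real.sqrt (1 - 2 * a))⁻¹ * Real.exp (a * c ^ 2 / (1 - 2 * a))) := by
  have hs : Real.sqrt (2 * a) ^ 2 = 2 * a := Real.sq_sqrt (by positivity)
  have hb : 0 < 1 - 2 * a := by linarith
  have h1 : ∀ w : ℝ, ENNReal.ofReal (Real.exp (a * w ^ 2))
      = ∫⁻ g, ENNReal.ofReal (Real.exp (Real.sqrt (2 * a) * w * g)) ∂(gaussianReal 0 1) := by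
    intro w
    rw [lintegral_exp_mul_gaussianReal]
    congr 2
    rw [mul_pow, hs]
    simp
    ring
  simp_rw [h1]
  rw [lintegral_lintegral_swap (by fun_prop)]
  calc _ ≤ ∫⁻ g, ENNReal.ofReal (Real.exp (Real.sqrt (2 * a) * c * g + a * g ^ 2))
        ∂(gaussianReal 0 1) := by
        refine lintegral_mono fun g => ?_
        have := lintegral_exp_affine_le h (Real.sqrt (2 * a) * c * g) (Real.sqrt (2 * a) * g)
        refine le_trans (le_of_eq ?_) (this.trans (le_of_eq ?_))
        · refine lintegral_congr fun y => ?_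
          congr 2
          ring
        · congr 3
          rw [mul_pow, hs]
          ring
    _ = _ := by
        rw [lintegral_exp_quadratic_gaussianReal ha]
        congr 3
        rw [mul_pow, hs]
        field_simp

theorem one_add_sq_div_two_le_cosh (x : ℝ) : 1 + x ^ 2 / 2 ≤ Real.cosh x := by
  have h := Real.cosh_two_mul (x / 2)
  have h1 : (x / 2) ^ 2 ≤ Real.sinh (x / 2) ^ 2 := by
    rcases le_total 0 x with hx | hx
    · exact pow_le_pow_left₀ (by linarith) (Real.self_le_sinh_iff.mpr (by linarith)) 2
    · have := pow_le_pow_left₀ (by linarith) (Real.self_le_sinh_iff.mpr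
        (show 0 ≤ -(x / 2) by linarith)) 2
      rwa [Real.sinh_neg, neg_sq, neg_sq] at this
  have h2 := Real.cosh_sq (x / 2)
  rw [show 2 * (x / 2) = x by ring] at h
  linarith [h, h1, h2]

/-- A `1`-sub-Gaussian variable has variance at most `1`. -/
theorem integral_sq_le_one (h : HasSubgaussianMGF (fun y => y - m) 1 ν) [IsProbabilityMeasure ν] :
    ∫ y, (y - m) ^ 2 ∂ν ≤ 1 := by
  have hint : Integrable (fun y => (y - m) ^ 2) ν := (h.memLp 2).integrable_sq
  -- compare `E cosh (t Y)` with its value for a Gaussian and let `t` tend to `0`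
  have hcosh : ∀ t : ℝ, 0 < t →
      (∫ y, (y - m) ^ 2 ∂ν) ≤ (Real.exp (t ^ 2 / 2) - 1) / (t ^ 2 / 2) := by
    intro t ht
    have h1 : ∫ y, (1 + t ^ 2 / 2 * (y - m) ^ 2) ∂ν
        ≤ ∫ y, (Real.exp (t * (y - m)) + Real.exp (-t * (y - m))) / 2 ∂ν := by
      refine integral_mono ((integrable_const _).add (hint.const_mul _))
        (((h.integrable_exp_mul t).add (h.integrable_exp_mul (-t))).div_const 2) fun y => ?_
      have := one_add_sq_div_two_le_cosh (t * (y - m))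
      rw [Real.cosh_eq] at this
      simp only [neg_mul]
      nlinarith [this]
    rw [integral_add (integrable_const _) (hint.const_mul _), integral_const_mul,
      integral_div, integral_add (h.integrable_exp_mul t) (h.integrable_exp_mul (-t))] at h1
    have h2 := h.mgf_le t
    have h3 := h.mgf_le (-t)
    simp only [mgf, NNReal.coe_one, one_mul, neg_sq] at h2 h3
    rw [le_div_iff₀ (by positivity)]
    simp only [integral_const, probReal_univ, smul_eq_mul, mul_one] at h1
    linarith
  have hlim : Tendsto (fun t : ℝ => (Real.exp (t ^ 2 / 2) - 1) / (t ^ 2 / 2))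
      (nhdsWithin 0 (Set.Ioi 0)) (nhds 1) := by
    have hd : HasDerivAt Real.exp 1 0 := by simpa using Real.hasDerivAt_exp 0
    have h1 := hd.tendsto_slope_zero_right
    simp only [zero_add, Real.exp_zero, smul_eq_mul] at h1
    have h2 : Tendsto (fun t : ℝ => t ^ 2 / 2) (nhdsWithin 0 (Set.Ioi 0))
        (nhdsWithin 0 (Set.Ioi 0)) := by
      refine tendsto_nhdsWithin_of_tendsto_nhds_of_eventually_within _ ?_ ?_
      · have : Continuous fun t : ℝ => t ^ 2 / 2 := by fun_prop
        simpa using (this.tendsto 0).mono_left nhdsWithin_le_nhds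
      · filter_upwards [self_mem_nhdsWithin] with t ht
        have : (0 : ℝ) < t := ht
        simp only [Set.mem_Ioi]
        positivity
    have := h1.comp h2
    refine this.congr fun t => ?_
    simp only [Function.comp]
    rw [inv_mul_eq_div]
  exact ge_of_tendsto hlim (by
    filter_upwards [self_mem_nhdsWithin] with t ht using hcosh t ht)

/-- Cantelli's inequality for a centred `1`-sub-Gaussian variable. -/
theorem measure_lt_le_of_hasSubgaussianMGF (h : HasSubgaussianMGF (fun y => y - m) 1 ν)
    [IsProbabilityMeasure ν] (hm : ∫ y, y ∂ν = m) {x : ℝ} (hx : 0 < x) :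
    ν {y | x < m - y} ≤ ENNReal.ofReal (1 / (1 + x ^ 2)) := by
  have hint : Integrable (fun y => (y - m) ^ 2) ν := (h.memLp 2).integrable_sq
  have hint1 : Integrable (fun y => y - m) ν := h.integrable
  have hint2 : Integrable (fun y : ℝ => y) ν := by
    refine (hint1.add (integrable_const m)).congr (ae_of_all _ fun y => ?_)
    simp
  have hzero : ∫ y, (y - m) ∂ν = 0 := by
    rw [integral_sub hint2 (integrable_const m), hm]
    simp
  -- Markov's inequality for the square of `m - y + 1 / x`
  have hI : Integrable (fun y => (m - y + 1 / x) ^ 2) ν := by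
    have : (fun y => (m - y + 1 / x) ^ 2)
        = fun y => (y - m) ^ 2 + (-(2 / x)) * (y - m) + (1 / x) ^ 2 := by
      ext y
      ring
    rw [this]
    exact (hint.add (hint1.const_mul _)).add (integrable_const _)
  have hE : ∫ y, (m - y + 1 / x) ^ 2 ∂ν ≤ 1 + (1 / x) ^ 2 := by
    have : (fun y => (m - y + 1 / x) ^ 2)
        = fun y => (y - m) ^ 2 + (-(2 / x)) * (y - m) + (1 / x) ^ 2 := by
      ext y
      ring
    rw [this, integral_add (f := fun y => (y - m) ^ 2 + (-(2 / x)) * (y - m))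
      (hint.add (hint1.const_mul _)) (integrable_const _), integral_add hint (hint1.const_mul _),
      integral_const_mul, hzero, mul_zero, add_zero, integral_const, probReal_univ, one_smul]
    exact add_le_add (integral_sq_le_one h) le_rfl
  have hmk := mul_meas_ge_le_integral_of_nonneg (μ := ν) (ae_of_all _ fun y => sq_nonneg _) hI
    ((x + 1 / x) ^ 2)
  have hsub : ν {y | x < m - y} ≤ ν {y | (x + 1 / x) ^ 2 ≤ (m - y + 1 / x) ^ 2} := by
    refine measure_mono fun y hy => ?_
    have hy' : x < m - y := hy
    have : 0 < 1 / x := by positivity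
    show (x + 1 / x) ^ 2 ≤ (m - y + 1 / x) ^ 2
    exact pow_le_pow_left₀ (by positivity) (by linarith) 2
  refine hsub.trans ?_
  rw [← ENNReal.ofReal_toReal (measure_ne_top ν _)]
  refine ENNReal.ofReal_le_ofReal ?_
  rw [le_div_iff₀ (by positivity)]
  have h3 := hmk.trans hE
  have hpos : 0 < (x + 1 / x) ^ 2 := by positivity
  have h4 : (x + 1 / x) ^ 2 * x ^ 2 = (1 + x ^ 2) ^ 2 := by
    field_simp
    ring
  have h5 : (1 + (1 / x) ^ 2) * x ^ 2 = 1 + x ^ 2 := by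
    field_simp
    ring
  have hx2 : 0 < x ^ 2 := by positivity
  have h6 := mul_le_mul_of_nonneg_right h3 hx2.le
  rw [h5, mul_right_comm, h4] at h6
  have h7 : 0 < 1 + x ^ 2 := by positivity
  have h8 : (1 + x ^ 2) * ((1 + x ^ 2) * ν.real {y | (x + 1 / x) ^ 2 ≤ (m - y + 1 / x) ^ 2})
      ≤ (1 + x ^ 2) * 1 := by
    rw [mul_one, ← mul_assoc, ← sq]
    exact h6
  have h9 := le_of_mul_le_mul_left h8 h7
  rw [mul_comm]
  exact h9

end OneSample

/-! ### Growth of the e-processes -/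

/-- State of one arm: number `n` of samples, sum `S` of the samples, log-e-value `l`, and two
auxiliary sums for an arm of mean `m`: `r`, the logarithm of a Hoeffding supermartingale for the
noise in `l`, and `q`, the sum of the squared errors of the sample means on which the bets are
based. -/
abbrev GrowthState := ℕ × ℝ × ℝ × ℝ × ℝ

/-- Transition of the state of an arm of mean `m` when the sample `y` is read. -/
def growthUpd (m : ℝ) (s : GrowthState) (y : ℝ) : GrowthState :=
  (s.1 + 1, if s.1 = 0 then y else s.2.1 + y,
    s.2.2.1 + (max (s.2.1 / s.1 / 2) 0 * y - max (s.2.1 / s.1 / 2) 0 ^ 2 / 2),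
    s.2.2.2.1 + (-(max (s.2.1 / s.1 / 2) 0 * (y - m)) / 2 - max (s.2.1 / s.1 / 2) 0 ^ 2 / 8),
    s.2.2.2.2 + if s.1 = 0 then 0 else (s.2.1 / s.1 - m) ^ 2)

theorem measurable_growthUpd (m : ℝ) : Measurable (Function.uncurry (growthUpd m)) := by
  have h0 : MeasurableSet {p : GrowthState × ℝ | p.1.1 = 0} :=
    (measurable_fst.fst) (measurableSet_singleton 0)
  have hn : Measurable fun p : GrowthState × ℝ => (p.1.1 : ℝ) :=
    measurable_from_nat.comp measurable_fst.fst
  have hb : Measurable fun p : GrowthState × ℝ => max (p.1.2.1 / (p.1.1 : ℝ) / 2) 0 := by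
    fun_prop
  refine Measurable.prodMk (by fun_prop) (Measurable.prodMk
    (Measurable.ite h0 (by fun_prop) (by fun_prop)) (Measurable.prodMk (by fun_prop)
    (Measurable.prodMk (by fun_prop) (Measurable.add (by fun_prop)
      (Measurable.ite h0 (by fun_prop) (by fun_prop))))))

/-- The potential that controls both error sums: the average of a Hoeffding supermartingale and of
a self-normalised one. -/
def growthPotential (m : ℝ) (s : GrowthState) : ℝ :=
  (Real.exp s.2.2.2.1 + Real.exp ((s.2.1 - s.1 * m) ^ 2 / (4 * s.1) + s.2.2.2.2 / 12)
    / Real.sqrt (s.1 + 1)) / 2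

theorem growthPotential_pos (m : ℝ) (s : GrowthState) : 0 < growthPotential m s := by
  have : 0 < Real.sqrt ((s.1 : ℝ) + 1) := Real.sqrt_pos.mpr (by positivity)
  unfold growthPotential
  positivity

theorem measurable_growthPotential (m : ℝ) : Measurable (growthPotential m) := by
  have hn : Measurable fun p : GrowthState => (p.1 : ℝ) := measurable_from_nat.comp measurable_fst
  unfold growthPotential
  fun_prop

section

variable {ν : Measure ℝ} {m : ℝ}

/-- For a null arm, the e-value does not increase in expectation. -/
theorem lintegral_exp_growthUpd_le (h : HasSubgaussianMGF (fun y => y - m) 1 ν) (hm : m ≤ 0)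
    (s : GrowthState) :
    ∫⁻ y, ENNReal.ofReal (Real.exp (growthUpd m s y).2.2.1) ∂ν
      ≤ ENNReal.ofReal (Real.exp s.2.2.1) := by
  set b : ℝ := max (s.2.1 / s.1 / 2) 0 with hb
  have hb0 : 0 ≤ b := le_max_right _ _
  refine le_trans (le_of_eq (lintegral_congr fun y => ?_))
    ((lintegral_exp_affine_le h (s.2.2.1 + b * m - b ^ 2 / 2) b).trans
      (ENNReal.ofReal_le_ofReal (Real.exp_le_exp.mpr ?_)))
  · simp only [growthUpd, ← hb]
    congr 2
    ring
  · nlinarith [mul_nonneg hb0 (neg_nonneg.mpr hm)]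

/-- The self-normalised part of the potential decreases in expectation: reading a sample costs the
square-exponential moment of the noise, and the decrease of `S ^ 2 / (4 n)` between `n` and `n + 1`
pays for the squared error of the mean. -/
theorem lintegral_selfNormalised_le (h : HasSubgaussianMGF (fun y => y - m) 1 ν) [SFinite ν]
    (s : GrowthState) :
    ∫⁻ y, ENNReal.ofReal (Real.exp (((growthUpd m s y).2.1 - (growthUpd m s y).1 * m) ^ 2
        / (4 * (growthUpd m s y).1) + (growthUpd m s y).2.2.2.2 / 12)
        / Real.sqrt ((growthUpd m s y).1 + 1)) ∂ν
      ≤ ENNReal.ofReal (Real.exp ((s.2.1 - s.1 * m) ^ 2 / (4 * s.1) + s.2.2.2.2 / 12)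
        / Real.sqrt (s.1 + 1)) := by
  obtain ⟨n, S, l, r, q⟩ := s
  simp only [growthUpd]
  set c : ℝ := if n = 0 then 0 else S - n * m with hc
  set e : ℝ := if n = 0 then 0 else (S / n - m) ^ 2 with he
  have hn0 : (0 : ℝ) ≤ n := Nat.cast_nonneg n
  have hS : ∀ y : ℝ, (if n = 0 then y else S + y) - ((n + 1 : ℕ) : ℝ) * m = c + (y - m) := by
    intro y
    rw [hc]
    split_ifs with h0
    · simp [h0]
    · push_cast
      ring
  set a : ℝ := 1 / (4 * ((n : ℝ) + 1)) with ha
  have ha0 : 0 ≤ a := by positivity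
  have ha2 : a < 1 / 2 := by
    rw [ha, div_lt_div_iff₀ (by positivity) (by norm_num)]
    linarith
  have hb : 1 - 2 * a = (2 * n + 1) / (2 * (n + 1)) := by
    rw [ha]
    field_simp
    ring
  have hsq := lintegral_exp_sq_le h ha0 ha2 c
  have hsqrt : Real.sqrt (((n + 1 : ℕ) : ℝ) + 1) = Real.sqrt (n + 2) := by
    push_cast
    congr 1
    ring
  have hpos2 : 0 < Real.sqrt ((n : ℝ) + 2) := Real.sqrt_pos.mpr (by positivity)
  have hpos1 : 0 < Real.sqrt ((n : ℝ) + 1) := Real.sqrt_pos.mpr (by positivity)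
  have hposb : 0 < Real.sqrt (1 - 2 * a) := Real.sqrt_pos.mpr (by linarith)
  have hrw : ∀ y : ℝ, ENNReal.ofReal (Real.exp (((if n = 0 then y else S + y)
        - ((n + 1 : ℕ) : ℝ) * m) ^ 2 / (4 * ((n + 1 : ℕ) : ℝ)) + (q + e) / 12)
        / Real.sqrt (((n + 1 : ℕ) : ℝ) + 1))
      = ENNReal.ofReal (Real.exp ((q + e) / 12) / Real.sqrt (n + 2))
        * ENNReal.ofReal (Real.exp (a * (c + (y - m)) ^ 2)) := by
    intro y
    rw [hS, hsqrt, ← ENNReal.ofReal_mul (by positivity), Real.exp_add]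
    congr 1
    rw [show (c + (y - m)) ^ 2 / (4 * ((n + 1 : ℕ) : ℝ)) = a * (c + (y - m)) ^ 2 by
      rw [ha]; push_cast; ring]
    ring
  simp_rw [hrw]
  rw [lintegral_const_mul _ (by fun_prop)]
  refine (mul_le_mul_right hsq _).trans ?_
  rw [← ENNReal.ofReal_mul (by positivity)]
  refine ENNReal.ofReal_le_ofReal ?_
  -- the exponents and the normalisations are compared separately
  have hexp : (q + e) / 12 + a * c ^ 2 / (1 - 2 * a) ≤ (S - n * m) ^ 2 / (4 * n) + q / 12 := by
    rcases Nat.eq_zero_or_pos n with h0 | h0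
    · simp [hc, he, h0]
    · have hne : n ≠ 0 := h0.ne'
      have h1 : (1 : ℝ) ≤ n := by exact_mod_cast h0
      rw [hb, hc, he, if_neg hne, if_neg hne, ha]
      have e1 : 1 / (4 * ((n : ℝ) + 1)) * (S - n * m) ^ 2 / ((2 * n + 1) / (2 * (n + 1)))
          = (S - n * m) ^ 2 / (2 * (2 * n + 1)) := by
        field_simp
        ring
      have e2 : (S / n - m) ^ 2 = (S - n * m) ^ 2 / n ^ 2 := by
        field_simp
      rw [e1, e2]
      have e3 : (1 : ℝ) / (12 * n ^ 2) + 1 / (2 * (2 * n + 1)) ≤ 1 / (4 * n) := by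
        rw [div_add_div _ _ (by positivity) (by positivity),
          div_le_div_iff₀ (by positivity) (by positivity)]
        nlinarith [mul_nonneg (sq_nonneg (n : ℝ)) (sub_nonneg.mpr h1), sq_nonneg (n : ℝ)]
      have e4 := mul_le_mul_of_nonneg_left e3 (sq_nonneg (S - n * m))
      have e5 : (S - n * m) ^ 2 * (1 / (12 * (n : ℝ) ^ 2) + 1 / (2 * (2 * n + 1)))
          = (S - n * m) ^ 2 / n ^ 2 / 12 + (S - n * m) ^ 2 / (2 * (2 * n + 1)) := by
        field_simp
      have e6 : (S - n * m) ^ 2 * (1 / (4 * (n : ℝ))) = (S - n * m) ^ 2 / (4 * n) := by ring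
      linarith
  have hnorm : 1 / Real.sqrt (n + 2) * (Real.sqrt (1 - 2 * a))⁻¹ ≤ 1 / Real.sqrt (n + 1) := by
    rw [one_div, ← mul_inv, one_div]
    refine inv_anti₀ hpos1 ?_
    rw [← Real.sqrt_mul (by positivity)]
    refine Real.sqrt_le_sqrt ?_
    rw [hb, mul_div_assoc', le_div_iff₀ (by positivity)]
    nlinarith
  calc _ = (1 / Real.sqrt (n + 2) * (Real.sqrt (1 - 2 * a))⁻¹)
        * Real.exp ((q + e) / 12 + a * c ^ 2 / (1 - 2 * a)) := by
        rw [Real.exp_add]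
        ring
    _ ≤ 1 / Real.sqrt (n + 1) * Real.exp ((S - n * m) ^ 2 / (4 * n) + q / 12) := by
        gcongr
    _ = _ := by ring

theorem lintegral_growthPotential_le (h : HasSubgaussianMGF (fun y => y - m) 1 ν) [SFinite ν]
    (s : GrowthState) :
    ∫⁻ y, ENNReal.ofReal (growthPotential m (growthUpd m s y)) ∂ν
      ≤ ENNReal.ofReal (growthPotential m s) := by
  have hsplit : ∀ s, ENNReal.ofReal (growthPotential m s)
      = ENNReal.ofReal (1 / 2) * (ENNReal.ofReal (Real.exp s.2.2.2.1)
        + ENNReal.ofReal (Real.exp ((s.2.1 - s.1 * m) ^ 2 / (4 * s.1) + s.2.2.2.2 / 12)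
          / Real.sqrt (s.1 + 1))) := by
    intro s
    rw [← ENNReal.ofReal_add (Real.exp_pos _).le (by positivity),
      ← ENNReal.ofReal_mul (by norm_num), growthPotential]
    congr 1
    ring
  have hU : Measurable fun y => growthUpd m s y := (measurable_growthUpd m).of_uncurry_left
  have h1 : Measurable fun s : GrowthState => ENNReal.ofReal (Real.exp s.2.2.2.1) := by fun_prop
  simp_rw [hsplit]
  rw [lintegral_const_mul' _ _ ENNReal.ofReal_ne_top]
  have hadd := lintegral_add_left (μ := ν) (h1.comp hU) ((fun s : GrowthState => ENNReal.ofReal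
      (Real.exp ((s.2.1 - s.1 * m) ^ 2 / (4 * s.1) + s.2.2.2.2 / 12) / Real.sqrt (s.1 + 1)))
      ∘ fun y => growthUpd m s y)
  simp only [Function.comp] at hadd
  rw [hadd]
  gcongr
  · set b : ℝ := max (s.2.1 / s.1 / 2) 0 with hb
    refine le_trans (le_of_eq (lintegral_congr fun y => ?_))
      ((lintegral_exp_affine_le h (s.2.2.2.1 - b ^ 2 / 8) (-b / 2)).trans
        (ENNReal.ofReal_le_ofReal (Real.exp_le_exp.mpr (le_of_eq ?_))))
    · simp only [growthUpd, ← hb]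
      congr 2
      ring
    · ring
  · exact lintegral_selfNormalised_le h s

end

/-- The increment of the log-e-value at a sample `y`, with bet `b = (a / 2)₊` based on the sample
mean `a`, is at least `m ^ 2 / 8` up to the error of `a` and the noise of `y`. -/
theorem growth_increment {m : ℝ} (hm : 0 ≤ m) (a y : ℝ) :
    m ^ 2 / 8 - 3 / 8 * (a - m) ^ 2
        - 2 * (-(max (a / 2) 0 * (y - m)) / 2 - max (a / 2) 0 ^ 2 / 8)
      ≤ max (a / 2) 0 * y - max (a / 2) 0 ^ 2 / 2 := by
  rcases le_total 0 (a / 2) with h | h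
  · rw [max_eq_left h]
    nlinarith [sq_nonneg a, sq_nonneg (a - m), sq_nonneg (a - 2 * m)]
  · rw [max_eq_right h]
    nlinarith [mul_nonneg hm (show 0 ≤ -a by linarith), sq_nonneg a, sq_nonneg m]

section ArmState

variable {k : ℕ} {A : ℕ → Option (Fin k)} {x : Fin k → ℕ → ℝ} {i : Fin k} {m : ℝ}

/-- The growth state of arm `i` at time `t`. -/
def growthState (A : ℕ → Option (Fin k)) (x : Fin k → ℕ → ℝ) (i : Fin k) (m : ℝ) (t : ℕ) :
    GrowthState :=
  armState A (x i) i (growthUpd m) (0, 0, 0, 0, 0) t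

theorem growthState_stats (t : ℕ) :
    (growthState A x i m t).1 = numPulls A i t ∧
    (growthState A x i m t).2.1 = ∑ s ∈ pullTimes A i t, x i s ∧
    (growthState A x i m t).2.2.1 = logPmh A x i t := by
  induction t with
  | zero => simp [growthState, armState, numPulls, logPmh, pullTimes_zero]
  | succ t ih =>
    obtain ⟨h1, h2, h3⟩ := ih
    by_cases hA : A (t + 1) = some i
    · have hs : growthState A x i m (t + 1)
          = growthUpd m (growthState A x i m t) (x i (t + 1)) := by
        rw [growthState, armState, if_pos hA, growthState]
      have hbet : bet A x i (t + 1)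
          = max ((growthState A x i m t).2.1 / (growthState A x i m t).1 / 2) 0 := by
        rw [bet, sampleMean, h1, h2]
        rfl
      rw [hs, numPulls_succ_of_eq hA, sum_pullTimes_succ_of_eq _ hA, logPmh,
        sum_pullTimes_succ_of_eq _ hA, ← logPmh, hbet, ← h1, ← h2, ← h3]
      refine ⟨rfl, ?_, rfl⟩
      simp only [growthUpd]
      split_ifs with h0
      · rw [h2]
        have : pullTimes A i t = ∅ := by
          rw [← Finset.card_eq_zero]
          exact h1.symm.trans h0
        simp [this]
      · rfl
    · have hs : growthState A x i m (t + 1) = growthState A x i m t := by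
        rw [growthState, armState, if_neg hA, growthState]
      rw [hs, numPulls_succ_of_ne hA, pullTimes_succ_of_ne hA, logPmh, pullTimes_succ_of_ne hA]
      exact ⟨h1, h2, h3⟩

/-- The increments of the log-e-value added up. The bet at the first sample is `0`, so that sample
contributes nothing: hence the `- 1`. -/
theorem growthState_invariant (hm : 0 ≤ m) (t : ℕ) :
    ((growthState A x i m t).1 = 0 → growthState A x i m t = (0, 0, 0, 0, 0)) ∧
    0 ≤ (growthState A x i m t).2.2.2.2 ∧
    ((growthState A x i m t).1 - 1) * m ^ 2 / 8
        - 3 / 8 * (growthState A x i m t).2.2.2.2 - 2 * (growthState A x i m t).2.2.2.1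
      ≤ (growthState A x i m t).2.2.1 := by
  induction t with
  | zero =>
    simp [growthState, armState]
    nlinarith [sq_nonneg m]
  | succ t ih =>
    obtain ⟨h1, h2, h3⟩ := ih
    by_cases hA : A (t + 1) = some i
    · have hs : growthState A x i m (t + 1)
          = growthUpd m (growthState A x i m t) (x i (t + 1)) := by
        rw [growthState, armState, if_pos hA, growthState]
      rw [hs]
      set g := growthState A x i m t with hg
      refine ⟨fun h => by simp [growthUpd] at h, ?_, ?_⟩
      · simp only [growthUpd]
        split_ifs <;> positivity
      · by_cases h0 : g.1 = 0
        · rw [h1 h0]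
          simp [growthUpd]
        · have := growth_increment hm (g.2.1 / g.1) (x i (t + 1))
          simp only [growthUpd, if_neg h0]
          push_cast
          linarith
    · have hs : growthState A x i m (t + 1) = growthState A x i m t := by
        rw [growthState, armState, if_neg hA, growthState]
      rw [hs]
      exact ⟨h1, h2, h3⟩

/-- Deterministic growth of the e-process: up to logarithmic terms and the logarithm of a
supermartingale, the log-e-value of an arm of mean `m` after `n` samples is at least
`(n - 1) m ^ 2 / 8`. -/
theorem numPulls_mul_sq_le (hm : 0 ≤ m) (t : ℕ) :
    ((numPulls A i t : ℝ) - 1) * m ^ 2 / 8 ≤ logPmh A x i t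
      + 13 / 2 * Real.log (2 * growthPotential m (growthState A x i m t))
      + 9 / 4 * Real.log (numPulls A i t + 1) := by
  obtain ⟨h1, h2, h3⟩ := growthState_stats (A := A) (x := x) (i := i) (m := m) t
  obtain ⟨-, h5, h6⟩ := growthState_invariant (A := A) (x := x) (i := i) hm t
  set g := growthState A x i m t with hg
  have hM : 0 < growthPotential m g := growthPotential_pos m g
  have hsq : 0 < Real.sqrt ((g.1 : ℝ) + 1) := Real.sqrt_pos.mpr (by positivity)
  have hr : g.2.2.2.1 ≤ Real.log (2 * growthPotential m g) := by
    rw [Real.le_log_iff_exp_le (by positivity), growthPotential]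
    have : 0 < Real.exp ((g.2.1 - g.1 * m) ^ 2 / (4 * g.1) + g.2.2.2.2 / 12)
      / Real.sqrt (g.1 + 1) := by positivity
    linarith
  have hq : g.2.2.2.2 / 12 - 1 / 2 * Real.log (g.1 + 1)
      ≤ Real.log (2 * growthPotential m g) := by
    have h7 : Real.exp ((g.2.1 - g.1 * m) ^ 2 / (4 * g.1) + g.2.2.2.2 / 12)
        / Real.sqrt (g.1 + 1) ≤ 2 * growthPotential m g := by
      rw [growthPotential]
      have := Real.exp_pos g.2.2.2.1
      linarith
    have h8 := Real.log_le_log (by positivity) h7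
    rw [Real.log_div (Real.exp_pos _).ne' hsq.ne', Real.log_exp,
      Real.log_sqrt (by positivity)] at h8
    have : 0 ≤ (g.2.1 - g.1 * m) ^ 2 / (4 * (g.1 : ℝ)) := by positivity
    linarith
  rw [← h1, ← h3]
  linarith

end ArmState

/-! ### Control of the false discovery rate -/

/-- Each rejected null arm has an e-value of at least `k / (δ |R|)`, so the proportion of nulls
among the rejections is dominated by `δ / k` times the sum of the null e-values. -/
theorem eBH_nullProportion_le {k : ℕ} {δ : ℝ} (hδ : 0 < δ) (e : Fin k → ℝ≥0∞)
    (H : Finset (Fin k)) :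
    ENNReal.ofReal (((H ∩ eBH δ e).card : ℝ) / max ((eBH δ e).card : ℝ) 1)
      ≤ ∑ i ∈ H, ENNReal.ofReal (δ / k) * e i := by
  classical
  set R := eBH δ e with hR
  have hsc := eBH_isESelfConsistent hδ e
  have hterm : ∀ i ∈ H ∩ R, ENNReal.ofReal (1 / max (R.card : ℝ) 1)
      ≤ ENNReal.ofReal (δ / k) * e i := by
    intro i hi
    have hiR := (Finset.mem_inter.mp hi).2
    have hk : (0 : ℝ) < k := by exact_mod_cast Fin.pos i
    have hcard : (1 : ℝ) ≤ R.card := by exact_mod_cast Finset.card_pos.mpr ⟨i, hiR⟩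
    calc ENNReal.ofReal (1 / max (R.card : ℝ) 1)
        = ENNReal.ofReal (δ / k) * ENNReal.ofReal ((k : ℝ) / (δ * (R.card : ℝ))) := by
          rw [← ENNReal.ofReal_mul (by positivity), max_eq_left hcard]
          congr 1
          field_simp
      _ ≤ _ := by
          gcongr
          exact hsc i hiR
  calc _ = ∑ i ∈ H ∩ R, ENNReal.ofReal (1 / max (R.card : ℝ) 1) := by
        rw [Finset.sum_const, nsmul_eq_mul, ← ENNReal.ofReal_natCast, ← ENNReal.ofReal_mul
          (by positivity), mul_one_div]
    _ ≤ ∑ i ∈ H ∩ R, ENNReal.ofReal (δ / k) * e i := Finset.sum_le_sum hterm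
    _ ≤ _ := Finset.sum_le_sum_of_subset Finset.inter_subset_left

section

variable {k : ℕ} {Ω : Type*} [mΩ : MeasurableSpace Ω] {P : Measure Ω} {ν : Fin k → Measure ℝ}
  {X : Fin k → ℕ → Ω → ℝ} {U : Ω → ℝ} {φ : Boundary} {δ : ℝ}
  {tie : ℝ → ℕ → Finset (Fin k) → Fin k}

theorem exp_growthState {A : ℕ → Option (Fin k)} {x : Fin k → ℕ → ℝ} (i : Fin k) (m : ℝ) (t : ℕ) :
    Real.exp (growthState A x i m t).2.2.1 = pmh A x i t := by
  rw [(growthState_stats t).2.2, exp_logPmh]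

/-- The e-process of a null arm is a supermartingale. -/
theorem IsSubGaussianBandit.isNonnegSupermartingale_pmh (hB : IsSubGaussianBandit P ν X U)
    (htie : IsTieBreak tie) {i : Fin k} (hi : armMean ν i ≤ 0) :
    IsNonnegSupermartingale P (fullFiltration hB.measurable_reward hB.measurable_private)
      fun t ω => ENNReal.ofReal (pmh (fun s => sampledArm φ δ tie X U s ω)
        (fun i s => X i s ω) i t) := by
  have h := hB.isNonnegSupermartingale (φ := φ) (δ := δ) htie i
    (measurable_growthUpd (armMean ν i)) (0, 0, 0, 0, 0)
    (ψ := fun s => ENNReal.ofReal (Real.exp s.2.2.1)) (by fun_prop)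
    (lintegral_exp_growthUpd_le (hB.subGaussian i) hi)
  have heq : (fun (t : ℕ) (ω : Ω) => ENNReal.ofReal (pmh (fun s => sampledArm φ δ tie X U s ω)
        (fun i s => X i s ω) i t)) = fun t ω => ENNReal.ofReal (Real.exp
        (armState (fun s => sampledArm φ δ tie X U s ω) (fun s => X i s ω) i
          (growthUpd (armMean ν i)) (0, 0, 0, 0, 0) t).2.2.1) := by
    funext t ω
    rw [← exp_growthState i (armMean ν i) t]
    rfl
  rw [heq]
  exact h

/-- The convention that the e-value at time `∞` is a limit superior makes the e-value at any time
the limit superior of the stopped e-process. -/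
theorem eValue_eq_limsup_stopped {A : ℕ → Option (Fin k)} {x : Fin k → ℕ → ℝ} (i : Fin k)
    (τ : WithTop ℕ) : eValue A x i τ = limsup (fun t : ℕ =>
      ENNReal.ofReal (pmh A x i (min (t : WithTop ℕ) τ).untopA)) atTop := by
  cases τ with
  | top =>
    simp only [min_top_right]
    rfl
  | coe n =>
    have : (fun t : ℕ => ENNReal.ofReal (pmh A x i (min (t : WithTop ℕ) (WithTop.some n)).untopA))
        =ᶠ[atTop] fun _ => ENNReal.ofReal (pmh A x i n) := by
      filter_upwards [eventually_ge_atTop n] with t ht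
      have hmin : min (t : WithTop ℕ) (WithTop.some n) = WithTop.some n :=
        min_eq_right (WithTop.coe_le_coe.mpr ht)
      rw [hmin]
      rfl
    rw [limsup_congr this, limsup_const]
    rfl

/-- The expected e-value of a null arm is at most `1` at any stopping time, so the bound of the
null proportion by e-values has expectation at most `(δ / k) |H₀|`. -/
theorem IsSubGaussianBandit.FDR_le (hB : IsSubGaussianBandit P ν X U) (htie : IsTieBreak tie)
    (hδ : 0 < δ) {τ : Ω → WithTop ℕ} (hτ : IsStopping φ δ tie X U τ) :
    FDR P (armMean ν) (fun ω => rejected φ δ tie X U (τ ω) ω) ≤ δ := by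
  classical
  have := hB.isProbabilityMeasure
  set R : Ω → Finset (Fin k) := fun ω => rejected φ δ tie X U (τ ω) ω with hR
  set H := nulls (armMean ν) with hH
  set E : Fin k → Ω → ℝ≥0∞ := fun i ω =>
    eValue (fun s => sampledArm φ δ tie X U s ω) (fun i s => X i s ω) i (τ ω) with hE
  set ℱ := fullFiltration hB.measurable_reward hB.measurable_private with hℱ
  have hτ' : ∀ t : ℕ, MeasurableSet[ℱ t] {ω | τ ω = (t : WithTop ℕ)} := fun t =>
    canonicalSigma_le_fullFiltration φ δ htie _ _ t _ (hτ t)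
  have hm : ∀ i t, Measurable[ℱ t]
      fun ω => pmh (fun s => sampledArm φ δ tie X U s ω) (fun i s => X i s ω) i t := by
    intro i t
    exact @measurable_pmh k Ω (ℱ t) _ X t
      (fun s hs o => @measurableSet_sampledArm_eq k Ω (ℱ t) X φ δ tie htie U
        (measurable_private_fullFiltration _ _ t) t
        (fun i r hr => measurable_reward_fullFiltration _ _ hr i) s (by omega) o)
      (fun i r hr => measurable_reward_fullFiltration _ _ hr i) i t le_rfl
  have hEm : ∀ i, Measurable (E i) := by
    intro i
    simpa only [hE, eValue_eq_limsup_stopped] using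
      measurable_limsup_stopped (fun t => (hm i t).mono (ℱ.le t) le_rfl)
        fun t => ℱ.le t _ (hτ' t)
  have hE1 : ∀ i ∈ H, ∫⁻ ω, E i ω ∂P ≤ 1 := by
    intro i hi
    have hi0 : armMean ν i ≤ 0 := by simpa [hH, nulls] using hi
    have hsm := hB.isNonnegSupermartingale_pmh (φ := φ) (δ := δ) htie hi0
    have := hsm.lintegral_stopped_le (fun t ω => by rw [← exp_logPmh]; exact (Real.exp_pos _).le)
      (hm i) (fun ω => by simp [pmh, pullTimes_zero]) hτ'
    simpa only [hE, eValue_eq_limsup_stopped] using this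
  have hbound : ∫⁻ ω, ENNReal.ofReal (((H ∩ R ω).card : ℝ) / max ((R ω).card : ℝ) 1) ∂P
      ≤ ENNReal.ofReal δ := by
    calc _ ≤ ∫⁻ ω, ∑ i ∈ H, ENNReal.ofReal (δ / k) * E i ω ∂P :=
          lintegral_mono fun ω => eBH_nullProportion_le hδ (fun i => E i ω) H
      _ = ∑ i ∈ H, ENNReal.ofReal (δ / k) * ∫⁻ ω, E i ω ∂P := by
          rw [lintegral_finsetSum' _ fun i _ => ((hEm i).const_mul _).aemeasurable]
          exact Finset.sum_congr rfl fun i _ => lintegral_const_mul _ (hEm i)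
      _ ≤ ∑ i ∈ H, ENNReal.ofReal (δ / k) * 1 := by
          refine Finset.sum_le_sum fun i hi => ?_
          gcongr
          exact hE1 i hi
      _ ≤ ENNReal.ofReal δ := by
          rw [Finset.sum_const, nsmul_eq_mul, mul_one, ← ENNReal.ofReal_natCast,
            ← ENNReal.ofReal_mul (by positivity)]
          refine ENNReal.ofReal_le_ofReal ?_
          have h1 : (H.card : ℝ) ≤ k := by
            exact_mod_cast (Finset.card_le_univ H).trans (by simp)
          rcases Nat.eq_zero_or_pos k with hk | hk
          · subst hk
            simpa using hδ.le
          · have hk' : (0 : ℝ) < k := by exact_mod_cast hk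
            rw [mul_div_assoc', div_le_iff₀ hk']
            nlinarith
  have hRm : Measurable[_, ⊤] R :=
    @measurable_to_countable' _ _ ⊤ _ _ _ fun S =>
      measurableSet_finset_eq (fun i => measurableSet_mem_eBH δ hEm i) S
  have hfm : Measurable fun ω => ((H ∩ R ω).card : ℝ) / max ((R ω).card : ℝ) 1 :=
    (measurable_from_top (f := fun S : Finset (Fin k) =>
      ((H ∩ S).card : ℝ) / max (S.card : ℝ) 1)).comp hRm
  unfold FDR
  rw [integral_eq_lintegral_of_nonneg_ae (ae_of_all _ fun ω => by positivity)
    hfm.aestronglyMeasurable]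
  exact ENNReal.toReal_le_of_le_ofReal hδ.le hbound

end

/-! ### Boundary crossing by mixtures of exponential supermartingales -/

/-- The boundary `b` is covered on the set `I` of sample sizes at cost `B`: some mixture `F`, of
total mass at most `B`, of the exponential supermartingales `exp (θ S - n θ ^ 2 / 2)`, `θ ≥ 0`, is
at least `1` when the walk `S` is at height `b n` at a time `n ∈ I`. -/
def MixtureCover (b : ℕ → ℝ) (I : Set ℕ) (B : ℝ) : Prop :=
  ∃ F : Measure ℝ, F (Set.Iio 0) = 0 ∧ F Set.univ ≤ ENNReal.ofReal B ∧
    ∀ n ∈ I, 1 ≤ ∫⁻ θ, ENNReal.ofReal (Real.exp (θ * b n - n * θ ^ 2 / 2)) ∂F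

namespace MixtureCover

variable {b b' : ℕ → ℝ} {I J : Set ℕ} {B C : ℝ}

theorem mono (h : MixtureCover b I B) (hJ : J ⊆ I) (hb : ∀ n ∈ J, b n ≤ b' n) (hC : B ≤ C) :
    MixtureCover b' J C := by
  obtain ⟨F, h0, h1, h2⟩ := h
  refine ⟨F, h0, h1.trans (ENNReal.ofReal_le_ofReal hC), fun n hn => (h2 n (hJ hn)).trans ?_⟩
  refine lintegral_mono_ae ?_
  have : ∀ᵐ θ ∂F, θ ∉ Set.Iio (0 : ℝ) := measure_eq_zero_iff_ae_notMem.mp h0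
  filter_upwards [this] with θ hθ
  have hθ : 0 ≤ θ := not_lt.mp hθ
  gcongr
  exact hb n hn

theorem union (h : MixtureCover b I B) (h' : MixtureCover b J C) (hB : 0 ≤ B) (hC : 0 ≤ C) :
    MixtureCover b (I ∪ J) (B + C) := by
  obtain ⟨F, h0, h1, h2⟩ := h
  obtain ⟨G, g0, g1, g2⟩ := h'
  refine ⟨F + G, by simp [h0, g0], ?_, ?_⟩
  · rw [Measure.add_apply, ENNReal.ofReal_add hB hC]
    exact add_le_add h1 g1
  · rintro n (hn | hn) <;> rw [lintegral_add_measure]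
    · exact (h2 n hn).trans le_self_add
    · exact (g2 n hn).trans le_add_self

theorem empty : MixtureCover b ∅ 0 := ⟨0, by simp, by simp, by simp⟩

/-- The cover of a range of sample sizes by one exponential supermartingale. -/
theorem of_line {θ c : ℝ} (hθ : 0 ≤ θ) (h : ∀ n ∈ I, c ≤ θ * b n - n * θ ^ 2 / 2) :
    MixtureCover b I (Real.exp (-c)) := by
  refine ⟨ENNReal.ofReal (Real.exp (-c)) • Measure.dirac θ, ?_, ?_, fun n hn => ?_⟩
  · have : θ ∉ Set.Iio (0 : ℝ) := not_lt.mpr hθ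
    simp [this]
  · simp
  · rw [lintegral_smul_measure, lintegral_dirac, smul_eq_mul, ← ENNReal.ofReal_mul
      (Real.exp_pos _).le, ← Real.exp_add, ← ENNReal.ofReal_one]
    refine ENNReal.ofReal_le_ofReal ?_
    rw [← Real.exp_zero]
    exact Real.exp_le_exp.mpr (by linarith [h n hn])

/-- Countably many covers add up. -/
theorem iUnion {I : ℕ → Set ℕ} {B : ℕ → ℝ} (h : ∀ j, MixtureCover b (I j) (B j))
    (hB : ∀ j, 0 ≤ B j) (hC : ∀ n, ∑ j ∈ Finset.range n, B j ≤ C) :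
    MixtureCover b (⋃ j, I j) C := by
  choose F h0 h1 h2 using h
  refine ⟨Measure.sum F, ?_, ?_, fun n hn => ?_⟩
  · rw [Measure.sum_apply _ measurableSet_Iio]
    simp [h0]
  · rw [Measure.sum_apply _ MeasurableSet.univ]
    refine (ENNReal.tsum_le_tsum h1).trans (ENNReal.tsum_le_of_sum_range_le fun n => ?_)
    rw [← ENNReal.ofReal_sum_of_nonneg fun j _ => hB j]
    exact ENNReal.ofReal_le_ofReal (hC n)
  · obtain ⟨j, hj⟩ := Set.mem_iUnion.mp hn
    rw [lintegral_sum_measure]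
    exact (h2 j n hj).trans (ENNReal.le_tsum j)

end MixtureCover

section

variable {ν : Measure ℝ} {m : ℝ}

theorem measurable_mixture (F : Measure ℝ) [SFinite F] :
    Measurable fun s : ℕ × ℝ =>
      ∫⁻ θ, ENNReal.ofReal (Real.exp (θ * s.2 - s.1 * θ ^ 2 / 2)) ∂F := by
  have hn : Measurable fun p : (ℕ × ℝ) × ℝ => (p.1.1 : ℝ) :=
    measurable_from_nat.comp measurable_fst.fst
  exact Measurable.lintegral_prod_right'
    (f := fun p : (ℕ × ℝ) × ℝ => ENNReal.ofReal (Real.exp (p.2 * p.1.2 - p.1.1 * p.2 ^ 2 / 2)))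
    (by fun_prop)

theorem lintegral_mixture_le (h : HasSubgaussianMGF (fun y => y - m) 1 ν) [SFinite ν]
    (F : Measure ℝ) [SFinite F] (n : ℕ) (S : ℝ) :
    ∫⁻ y, ∫⁻ θ,
        ENNReal.ofReal (Real.exp (θ * (S + (m - y)) - ((n + 1 : ℕ) : ℝ) * θ ^ 2 / 2)) ∂F ∂ν
      ≤ ∫⁻ θ, ENNReal.ofReal (Real.exp (θ * S - n * θ ^ 2 / 2)) ∂F := by
  rw [lintegral_lintegral_swap (by fun_prop)]
  refine lintegral_mono fun θ => ?_
  refine le_trans (le_of_eq (lintegral_congr fun y => ?_))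
    ((lintegral_exp_affine_le h (θ * S - ((n + 1 : ℕ) : ℝ) * θ ^ 2 / 2) (-θ)).trans
      (ENNReal.ofReal_le_ofReal (Real.exp_le_exp.mpr (le_of_eq ?_))))
  · congr 2
    ring
  · push_cast
    ring

end

section

variable {k : ℕ} {A : ℕ → Option (Fin k)} {x : Fin k → ℕ → ℝ} {i : Fin k} {m : ℝ}

/-- The centred walk of arm `i`: the sum of `m - x` over its samples. -/
def deficit (A : ℕ → Option (Fin k)) (x : Fin k → ℕ → ℝ) (i : Fin k) (m : ℝ) (t : ℕ) : ℝ :=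
  ∑ s ∈ pullTimes A i t, (m - x i s)

theorem armState_deficit (t : ℕ) :
    armState A (x i) i (fun (s : ℕ × ℝ) y => (s.1 + 1, s.2 + (m - y))) (0, 0) t
      = (numPulls A i t, deficit A x i m t) := by
  induction t with
  | zero => simp [armState, numPulls, deficit, pullTimes_zero]
  | succ t ih =>
    by_cases hA : A (t + 1) = some i
    · rw [armState, if_pos hA, ih, numPulls_succ_of_eq hA, deficit, deficit,
        sum_pullTimes_succ_of_eq _ hA]
    · rw [armState, if_neg hA, ih, numPulls_succ_of_ne hA, deficit, deficit,
        pullTimes_succ_of_ne hA]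

/-- Transition of the machine that records the number of samples, the first term of the centred walk
and the sum of its other terms. -/
def splitUpd (m : ℝ) (s : ℕ × ℝ × ℝ) (y : ℝ) : ℕ × ℝ × ℝ :=
  if s.1 = 0 then (1, m - y, 0) else (s.1 + 1, s.2.1, s.2.2 + (m - y))

theorem measurable_splitUpd (m : ℝ) : Measurable (Function.uncurry (splitUpd m)) := by
  have h0 : MeasurableSet {p : (ℕ × ℝ × ℝ) × ℝ | p.1.1 = 0} :=
    (measurable_fst.fst) (measurableSet_singleton 0)
  exact Measurable.ite h0 (by fun_prop) (by fun_prop)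

/-- Up to the first sample the recorded sum of the other terms is empty. -/
theorem armState_splitUpd (t : ℕ) :
    (armState A (x i) i (splitUpd m) (0, 0, 0) t).1 = numPulls A i t ∧
    (armState A (x i) i (splitUpd m) (0, 0, 0) t).2.1
      + (armState A (x i) i (splitUpd m) (0, 0, 0) t).2.2 = deficit A x i m t ∧
    (numPulls A i t ≤ 1 → (armState A (x i) i (splitUpd m) (0, 0, 0) t).2.2 = 0) := by
  induction t with
  | zero => simp [armState, numPulls, deficit, pullTimes_zero]
  | succ t ih =>
    obtain ⟨h1, h2, h3⟩ := ih
    by_cases hA : A (t + 1) = some i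
    · rw [armState, if_pos hA, numPulls_succ_of_eq hA, deficit, sum_pullTimes_succ_of_eq _ hA,
        ← deficit, ← h2, ← h1, splitUpd]
      split_ifs with h0
      · have hd : deficit A x i m t = 0 := by
          have : pullTimes A i t = ∅ := by
            rw [← Finset.card_eq_zero]
            exact h1.symm.trans h0
          simp [deficit, this]
        rw [← h2] at hd
        simp [h0, hd]
      · refine ⟨rfl, by ring, fun h => absurd h (by omega)⟩
    · rw [armState, if_neg hA, numPulls_succ_of_ne hA, deficit, pullTimes_succ_of_ne hA]
      exact ⟨h1, h2, h3⟩

end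

section

variable {k : ℕ} {Ω : Type*} [mΩ : MeasurableSpace Ω] {P : Measure Ω} {ν : Fin k → Measure ℝ}
  {X : Fin k → ℕ → Ω → ℝ} {U : Ω → ℝ} {φ : Boundary} {δ : ℝ}
  {tie : ℝ → ℕ → Finset (Fin k) → Fin k}

theorem IsSubGaussianBandit.isProbabilityMeasure_law (hB : IsSubGaussianBandit P ν X U)
    (i : Fin k) : IsProbabilityMeasure (ν i) := by
  have := hB.isProbabilityMeasure
  rw [← hB.law_reward i 0]
  exact Measure.isProbabilityMeasure_map (hB.measurable_reward i 0).aemeasurable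

/-- A covered boundary is crossed with probability at most the cost of the cover. -/
theorem IsSubGaussianBandit.measure_crossing_le (hB : IsSubGaussianBandit P ν X U)
    (htie : IsTieBreak tie) (i : Fin k) {b : ℕ → ℝ} {I : Set ℕ} {B : ℝ}
    (hcov : MixtureCover b I B) :
    P {ω | ∃ t, numPulls (fun s => sampledArm φ δ tie X U s ω) i t ∈ I ∧
      b (numPulls (fun s => sampledArm φ δ tie X U s ω) i t)
        < deficit (fun s => sampledArm φ δ tie X U s ω) (fun i s => X i s ω) i (armMean ν i) t}
      ≤ ENNReal.ofReal B := by
  have := hB.isProbabilityMeasure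
  have := hB.isProbabilityMeasure_law i
  obtain ⟨F, h0, h1, h2⟩ := hcov
  have : IsFiniteMeasure F := ⟨h1.trans_lt ENNReal.ofReal_lt_top⟩
  have hsm := hB.isNonnegSupermartingale (φ := φ) (δ := δ) htie i
    (upd := fun (s : ℕ × ℝ) y => (s.1 + 1, s.2 + (armMean ν i - y))) (by fun_prop) (0, 0)
    (measurable_mixture F) (fun s => lintegral_mixture_le (hB.subGaussian i) F s.1 s.2)
  refine le_trans (measure_mono ?_) (hsm.measure_exists_one_le_le.trans ?_)
  · rintro ω ⟨t, htI, htb⟩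
    refine ⟨t, ?_⟩
    rw [armState_deficit (x := fun i s => X i s ω)]
    refine (h2 _ htI).trans (lintegral_mono_ae ?_)
    have : ∀ᵐ θ ∂F, θ ∉ Set.Iio (0 : ℝ) := measure_eq_zero_iff_ae_notMem.mp h0
    filter_upwards [this] with θ hθ
    have hθ : 0 ≤ θ := not_lt.mp hθ
    gcongr
  · simpa [armState] using h1

/-- A boundary crossing is split at the first sample: either the first term of the walk exceeds
`b 1`, or the walk restarted after the first sample crosses `b - b 1`. -/
theorem IsSubGaussianBandit.measure_crossing_le_of_first (hB : IsSubGaussianBandit P ν X U)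
    (htie : IsTieBreak tie) (i : Fin k) {b : ℕ → ℝ} {I : Set ℕ} {p Q : ℝ} (hp0 : 0 ≤ p)
    (hp : ν i {y | b 1 < armMean ν i - y} ≤ ENNReal.ofReal p) (hQ0 : 0 ≤ Q) (hQ1 : Q ≤ 1)
    (hcov : MixtureCover (fun n => b (n + 1) - b 1) I Q) :
    P {ω | ∃ t, (numPulls (fun s => sampledArm φ δ tie X U s ω) i t = 1 ∨
        ∃ n ∈ I, numPulls (fun s => sampledArm φ δ tie X U s ω) i t = n + 1) ∧
      b (numPulls (fun s => sampledArm φ δ tie X U s ω) i t)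
        < deficit (fun s => sampledArm φ δ tie X U s ω) (fun i s => X i s ω) i (armMean ν i) t}
      ≤ ENNReal.ofReal (p + (1 - p) * Q) := by
  have := hB.isProbabilityMeasure
  have := hB.isProbabilityMeasure_law i
  obtain ⟨F, h0, h1, h2⟩ := hcov
  have : IsFiniteMeasure F := ⟨h1.trans_lt ENNReal.ofReal_lt_top⟩
  set m := armMean ν i with hm
  set C := ENNReal.ofReal (p + (1 - p) * Q) with hC
  set ψ : ℕ × ℝ × ℝ → ℝ≥0∞ := fun s => if s.1 = 0 then C else if b 1 < s.2.1 then 1 else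
    ∫⁻ θ, ENNReal.ofReal (Real.exp (θ * s.2.2 - ((s.1 - 1 : ℕ) : ℝ) * θ ^ 2 / 2)) ∂F with hψ
  have hψm : Measurable ψ := by
    refine Measurable.ite (measurable_fst (measurableSet_singleton 0)) measurable_const
      (Measurable.ite (measurableSet_lt measurable_const measurable_snd.fst) measurable_const ?_)
    exact (measurable_mixture F).comp (f := fun s : ℕ × ℝ × ℝ => (s.1 - 1, s.2.2))
      (((measurable_from_nat (f := fun n => n - 1)).comp measurable_fst).prodMk
        measurable_snd.snd)
  have hstep : ∀ s, ∫⁻ y, ψ (splitUpd m s y) ∂(ν i) ≤ ψ s := by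
    rintro ⟨n, z, S⟩
    by_cases hn : n = 0
    · subst hn
      set D := {y | b 1 < m - y} with hD
      have hDm : MeasurableSet D := measurableSet_lt measurable_const (by fun_prop)
      have hψ1 : ∀ y, ψ (splitUpd m (0, z, S) y)
          = D.indicator (fun _ => (1 : ℝ≥0∞)) y + Dᶜ.indicator (fun _ => F Set.univ) y := by
        intro y
        by_cases hy : b 1 < m - y
        · have : y ∈ D := hy
          simp [hψ, splitUpd, hy, this]
        · have : y ∉ D := hy
          simp [hψ, splitUpd, hy, this]
      simp_rw [hψ1]
      rw [lintegral_add_left (measurable_const.indicator hDm),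
        lintegral_indicator_const hDm, lintegral_indicator_const hDm.compl, one_mul]
      have hψ0 : ψ (0, z, S) = C := by simp [hψ]
      rw [hψ0, hC]
      have hDr : (ν i) D = ENNReal.ofReal ((ν i).real D) := (ofReal_measureReal).symm
      have hDc : (ν i) Dᶜ = ENNReal.ofReal (1 - (ν i).real D) := by
        rw [← probReal_compl_eq_one_sub hDm]
        exact (ofReal_measureReal).symm
      have hle : (ν i).real D ≤ p := by
        rw [hDr] at hp
        exact (ENNReal.ofReal_le_ofReal_iff hp0).mp hp
      have hle1 : (ν i).real D ≤ 1 := measureReal_le_one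
      calc (ν i) D + F Set.univ * (ν i) Dᶜ
          ≤ (ν i) D + ENNReal.ofReal Q * (ν i) Dᶜ := by gcongr
        _ = ENNReal.ofReal ((ν i).real D + Q * (1 - (ν i).real D)) := by
          rw [hDr, hDc, ← ENNReal.ofReal_mul hQ0, ← ENNReal.ofReal_add measureReal_nonneg
            (mul_nonneg hQ0 (by linarith))]
        _ ≤ _ := by
          refine ENNReal.ofReal_le_ofReal ?_
          nlinarith
    · obtain ⟨n, rfl⟩ := Nat.exists_eq_succ_of_ne_zero hn
      by_cases hz : b 1 < z
      · simp [hψ, splitUpd, hz]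
      · simp only [hψ, splitUpd, Nat.succ_eq_add_one, Nat.add_eq_zero_iff, one_ne_zero, and_false,
          if_false, hz, Nat.add_sub_cancel]
        exact lintegral_mixture_le (hB.subGaussian i) F n S
  have hsm := hB.isNonnegSupermartingale (φ := φ) (δ := δ) htie i
    (measurable_splitUpd m) (0, 0, 0) hψm hstep
  refine le_trans (measure_mono ?_) (hsm.measure_exists_one_le_le.trans ?_)
  · rintro ω ⟨t, htI, htb⟩
    refine ⟨t, ?_⟩
    obtain ⟨e1, e2, e3⟩ := armState_splitUpd (A := fun s => sampledArm φ δ tie X U s ω)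
      (x := fun i s => X i s ω) (i := i) (m := m) t
    set g := armState (fun s => sampledArm φ δ tie X U s ω) (fun s => X i s ω) i (splitUpd m)
      (0, 0, 0) t with hg
    have hn0 : g.1 ≠ 0 := by
      rw [e1]
      rcases htI with h | ⟨n, -, h⟩ <;> omega
    simp only [hψ, if_neg hn0]
    split_ifs with hz
    · exact le_rfl
    · rcases htI with h | ⟨n, hn, h⟩
      · rw [h, ← e2, e3 h.le, add_zero] at htb
        exact absurd htb hz
      · have hn1 : g.1 - 1 = n := by omega
        rw [hn1]
        refine (h2 n hn).trans (lintegral_mono_ae ?_)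
        have : ∀ᵐ θ ∂F, θ ∉ Set.Iio (0 : ℝ) := measure_eq_zero_iff_ae_notMem.mp h0
        filter_upwards [this] with θ hθ
        have hθ : 0 ≤ θ := not_lt.mp hθ
        have : b (n + 1) - b 1 ≤ g.2.2 := by
          rw [h] at htb
          linarith
        gcongr
  · simp [armState, hψ]

end

/-! ### Covers by epochs of sample sizes -/

theorem one_sub_sq_mul_cosh_sq_le (q : ℝ) : (1 - q ^ 2) * Real.cosh q ^ 2 ≤ 1 := by
  have h1 : Real.cosh q ^ 2 ≤ Real.exp (q ^ 2) := by
    have h := Real.cosh_le_exp_half_sq q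
    have h0 := Real.cosh_pos q
    calc Real.cosh q ^ 2 ≤ Real.exp (q ^ 2 / 2) ^ 2 := by gcongr
      _ = Real.exp (q ^ 2) := by
        rw [← Real.exp_nat_mul]
        congr 1
        push_cast
        ring
  have h2 : 1 - q ^ 2 ≤ Real.exp (-q ^ 2) := by
    have := Real.add_one_le_exp (-q ^ 2)
    linarith
  calc (1 - q ^ 2) * Real.cosh q ^ 2 ≤ Real.exp (-q ^ 2) * Real.exp (q ^ 2) := by
        gcongr
    _ = 1 := by
      rw [← Real.exp_add]
      simp

namespace MixtureCover

variable {b : ℕ → ℝ} {I : Set ℕ}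

/-- The cover of an epoch `N ≤ n ≤ N e^{4q}` by one line, when the boundary is at least `z √n`:
the slope is optimal at the geometric mean of the end points, and the loss in the exponent is the
factor `1 / cosh q ^ 2 ≥ 1 - q ^ 2`. -/
theorem of_epoch {N q z : ℝ} (hN : 0 < N) (hz : 0 ≤ z)
    (hI : ∀ n ∈ I, N ≤ n ∧ (n : ℝ) ≤ N * Real.exp (4 * q))
    (hb : ∀ n ∈ I, z * Real.sqrt n ≤ b n) :
    MixtureCover b I (Real.exp (-((1 - q ^ 2) * (z ^ 2 / 2)))) := by
  set M := Real.sqrt N * Real.exp q with hM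
  have hsN : 0 < Real.sqrt N := Real.sqrt_pos.mpr hN
  have hM0 : 0 < M := mul_pos hsN (Real.exp_pos _)
  have hc : 0 < Real.cosh q := Real.cosh_pos q
  refine of_line (θ := z / (M * Real.cosh q)) (by positivity) fun n hn => ?_
  obtain ⟨h1, h2⟩ := hI n hn
  set r := Real.sqrt n / M with hr
  have hr1 : Real.exp (-q) ≤ r := by
    rw [hr, le_div_iff₀ hM0, hM, mul_comm, mul_assoc, ← Real.exp_add]
    simpa using Real.sqrt_le_sqrt h1
  have hr2 : r ≤ Real.exp q := by
    rw [hr, div_le_iff₀ hM0, hM]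
    have h3 : Real.sqrt n ≤ Real.sqrt (N * Real.exp (4 * q)) := Real.sqrt_le_sqrt h2
    refine h3.trans (le_of_eq ?_)
    rw [Real.sqrt_mul hN.le, show 4 * q = (2 * q) + 2 * q by ring, Real.exp_add,
      Real.sqrt_mul_self (Real.exp_pos _).le, two_mul, Real.exp_add]
    ring
  have hn0 : Real.sqrt n ^ 2 = n := Real.sq_sqrt (Nat.cast_nonneg n)
  have hbn := hb n hn
  set c := Real.cosh q with hcdef
  have hkey : (1 - q ^ 2) * c ^ 2 ≤ 2 * c * r - r ^ 2 := by
    have h3 : (r - Real.exp (-q)) * (Real.exp q - r) = 2 * c * r - r ^ 2 - 1 := by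
      have : Real.exp (-q) * Real.exp q = 1 := by rw [← Real.exp_add]; simp
      rw [hcdef, Real.cosh_eq]
      linear_combination -this
    have h4 := mul_nonneg (sub_nonneg.mpr hr1) (sub_nonneg.mpr hr2)
    have h5 := one_sub_sq_mul_cosh_sq_le q
    linarith
  have hs : Real.sqrt n = r * M := by rw [hr]; field_simp
  calc (1 - q ^ 2) * (z ^ 2 / 2) = ((1 - q ^ 2) * c ^ 2) * (z ^ 2 / (2 * c ^ 2)) := by
        field_simp
    _ ≤ (2 * c * r - r ^ 2) * (z ^ 2 / (2 * c ^ 2)) := by gcongr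
    _ = z / (M * c) * (z * Real.sqrt n) - n * (z / (M * c)) ^ 2 / 2 := by
        have e : (n : ℝ) = (r * M) ^ 2 := by rw [← hs, hn0]
        rw [hs, e]
        field_simp
    _ ≤ _ := by gcongr

end MixtureCover

/-- The power `y ^ (-(1 + a))` is at most a difference quotient of `y ^ (-a)`, so that sums of it
telescope; powers are written as exponentials of logarithms. -/
theorem exp_neg_mul_log_le {a d y : ℝ} (ha : 0 < a) (hd : 0 < d) (hy : d < y) :
    Real.exp (-(1 + a) * Real.log y)
      ≤ (Real.exp (-a * Real.log (y - d)) - Real.exp (-a * Real.log y)) / (d * a) := by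
  have hy0 : 0 < y := hd.trans hy
  rw [le_div_iff₀ (by positivity)]
  have h1 : Real.exp (-(1 + a) * Real.log y) = Real.exp (-a * Real.log y) / y := by
    rw [show -(1 + a) * Real.log y = -a * Real.log y - Real.log y by ring, Real.exp_sub,
      Real.exp_log hy0]
  have h2 : Real.log (y - d) ≤ Real.log y - d / y := by
    have h3 := Real.log_le_sub_one_of_pos (show 0 < (y - d) / y by
      have : 0 < y - d := by linarith
      positivity)
    rw [Real.log_div (by linarith) hy0.ne'] at h3
    have h4 : (y - d) / y = 1 - d / y := by field_simp
    linarith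
  have h5 : Real.exp (-a * Real.log y) * (1 + a * (d / y)) ≤ Real.exp (-a * Real.log (y - d)) := by
    calc _ ≤ Real.exp (-a * Real.log y) * Real.exp (a * (d / y)) := by
          gcongr
          have := Real.add_one_le_exp (a * (d / y))
          linarith
      _ = Real.exp (-a * Real.log y + a * (d / y)) := by rw [Real.exp_add]
      _ ≤ _ := by
          refine Real.exp_le_exp.mpr ?_
          have := mul_le_mul_of_nonneg_left h2 ha.le
          nlinarith
  rw [h1]
  have : Real.exp (-a * Real.log y) / y * (d * a) = Real.exp (-a * Real.log y) * (a * (d / y)) := by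
    field_simp
  rw [this]
  linarith

theorem sum_exp_neg_mul_log_le {a d x : ℝ} (ha : 0 < a) (hd : 0 < d) (hx : 0 < x) (n : ℕ) :
    ∑ j ∈ Finset.range n, Real.exp (-(1 + a) * Real.log (x + d * j))
      ≤ Real.exp (-(1 + a) * Real.log x) + Real.exp (-a * Real.log x) / (d * a) := by
  have key : ∀ n : ℕ, ∑ j ∈ Finset.range (n + 1), Real.exp (-(1 + a) * Real.log (x + d * j))
      ≤ Real.exp (-(1 + a) * Real.log x) + (Real.exp (-a * Real.log x)
        - Real.exp (-a * Real.log (x + d * n))) / (d * a) := by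
    intro n
    induction n with
    | zero => simp
    | succ n ih =>
      rw [Finset.sum_range_succ]
      have h1 := exp_neg_mul_log_le (y := x + d * ((n + 1 : ℕ) : ℝ)) ha hd (by
        push_cast
        nlinarith [mul_nonneg hd.le (Nat.cast_nonneg (α := ℝ) n)])
      have h2 : x + d * ((n + 1 : ℕ) : ℝ) - d = x + d * n := by push_cast; ring
      rw [h2] at h1
      refine (add_le_add ih h1).trans (le_of_eq ?_)
      ring
  rcases n with _ | n
  · simp
    positivity
  · refine (key n).trans ?_
    gcongr
    have := Real.exp_pos (-a * Real.log (x + d * n))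
    linarith

namespace MixtureCover

variable {b : ℕ → ℝ}

/-- The cover of all sample sizes from `N` on, for an iterated-logarithm boundary: the epochs
`N e^{4qj} ≤ n ≤ N e^{4q(j+1)}` have costs that decrease like `(x + d j) ^ (-(1 + a))`. -/
theorem of_tail {N q α p x d a : ℝ} (hN : 0 < N) (hq : 0 < q) (hα : 0 ≤ α) (hp : 0 ≤ p)
    (hx : 1 ≤ x) (hd : 0 < d) (ha : 0 < a) (hap : 1 + a ≤ (1 - q ^ 2) * p)
    (hb : ∀ n : ℕ, N ≤ n →
      Real.sqrt (2 * n * (α + p * Real.log (x + d / (4 * q) * Real.log (n / N)))) ≤ b n) :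
    MixtureCover b {n | N ≤ n} (Real.exp (-((1 - q ^ 2) * α)) *
      (Real.exp (-(1 + a) * Real.log x) + Real.exp (-a * Real.log x) / (d * a))) := by
  set I : ℕ → Set ℕ := fun j => {n | N * Real.exp (4 * q * j) ≤ n ∧
    (n : ℝ) ≤ N * Real.exp (4 * q * (j + 1))} with hI
  have hx0 : ∀ j : ℕ, 1 ≤ x + d * j := fun j => by
    nlinarith [mul_nonneg hd.le (Nat.cast_nonneg (α := ℝ) j)]
  have hlog : ∀ j : ℕ, 0 ≤ Real.log (x + d * j) := fun j => Real.log_nonneg (hx0 j)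
  have hcov : ∀ j, MixtureCover b (I j) (Real.exp (-((1 - q ^ 2) * α)) *
      Real.exp (-(1 + a) * Real.log (x + d * j))) := by
    intro j
    have hz2 : 0 ≤ 2 * (α + p * Real.log (x + d * j)) := by
      have := mul_nonneg hp (hlog j)
      linarith
    have h := of_epoch (b := b) (I := I j) (N := N * Real.exp (4 * q * j)) (q := q)
      (z := Real.sqrt (2 * (α + p * Real.log (x + d * j)))) (by positivity)
      (Real.sqrt_nonneg _) (fun n hn => ⟨hn.1, hn.2.trans (le_of_eq ?_)⟩) (fun n hn => ?_)
    · refine h.mono subset_rfl (fun _ _ => le_rfl) ?_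
      rw [← Real.exp_add, Real.sq_sqrt hz2]
      refine Real.exp_le_exp.mpr ?_
      have := mul_le_mul_of_nonneg_right hap (hlog j)
      linarith
    · rw [mul_assoc N, ← Real.exp_add]
      congr 2
      ring
    · have hNn : N ≤ n := le_trans (by
        have : 1 ≤ Real.exp (4 * q * j) := Real.one_le_exp (by positivity)
        nlinarith) hn.1
      refine le_trans ?_ (hb n hNn)
      rw [← Real.sqrt_mul hz2]
      refine Real.sqrt_le_sqrt ?_
      have h4 : 4 * q * j ≤ Real.log (n / N) := by
        rw [Real.le_log_iff_exp_le (div_pos (hN.trans_le hNn) hN), le_div_iff₀ hN, mul_comm]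
        exact hn.1
      have h5 : d * j ≤ d / (4 * q) * Real.log (n / N) := by
        calc d * j = d / (4 * q) * (4 * q * j) := by field_simp
          _ ≤ _ := by gcongr
      have h6 : Real.log (x + d * j) ≤ Real.log (x + d / (4 * q) * Real.log (n / N)) :=
        Real.log_le_log (by linarith [hx0 j]) (by linarith)
      have h7 := mul_le_mul_of_nonneg_left h6 hp
      have h8 : (0 : ℝ) ≤ n := Nat.cast_nonneg n
      nlinarith
  refine (iUnion hcov (fun j => by positivity) (C := _) fun n => ?_).mono ?_ (fun _ _ => le_rfl)
    le_rfl
  · rw [← Finset.mul_sum]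
    gcongr
    exact sum_exp_neg_mul_log_le ha hd (by linarith) n
  · intro n hn
    have hn : N ≤ n := hn
    rw [Set.mem_iUnion]
    have hlog0 : 0 ≤ Real.log (n / N) := Real.log_nonneg (by rwa [le_div_iff₀ hN, one_mul])
    refine ⟨⌊Real.log (n / N) / (4 * q)⌋₊, ?_, ?_⟩
    · have h1 := Nat.floor_le (div_nonneg hlog0 (by positivity : (0:ℝ) ≤ 4 * q))
      rw [le_div_iff₀ (by positivity), Real.le_log_iff_exp_le (div_pos (hN.trans_le hn) hN),
        le_div_iff₀ hN] at h1
      rw [mul_comm, mul_comm (4 * q)]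
      exact h1
    · have h1 := Nat.lt_floor_add_one (Real.log (n / N) / (4 * q))
      rw [div_lt_iff₀ (by positivity), Real.log_lt_iff_lt_exp (div_pos (hN.trans_le hn) hN),
        div_lt_iff₀ hN] at h1
      rw [mul_comm, mul_comm (4 * q)]
      exact h1.le

end MixtureCover

/-! ### Numerical bounds for the exponential function -/

/-- A numerical upper bound for `exp x`: the Taylor polynomial with remainder at `x / m`, raised to
the power `m`. -/
theorem exp_le_taylor_pow {x : ℝ} (m : ℕ) (hm : 0 < m) (hx : 0 ≤ x) (hxm : x ≤ m) :
    Real.exp x ≤ (∑ j ∈ Finset.range 8, (x / m) ^ j / (j.factorial : ℝ)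
      + (x / m) ^ 8 * 9 / 322560) ^ m := by
  have hm' : (0 : ℝ) < m := by exact_mod_cast hm
  have h := Real.exp_bound' (x := x / m) (by positivity) (by rwa [div_le_one hm'])
    (n := 8) (by norm_num)
  have h2 : Real.exp x = Real.exp (x / m) ^ m := by
    rw [← Real.exp_nat_mul]
    congr 1
    field_simp
  rw [h2]
  refine pow_le_pow_left₀ (Real.exp_pos _).le (h.trans (le_of_eq ?_)) m
  norm_num [Nat.factorial]

/-- A numerical lower bound for `exp x`: the Taylor polynomial at `x / m`, raised to the power
`m`. -/
theorem taylor_pow_le_exp {x : ℝ} (m : ℕ) (hm : 0 < m) (hx : 0 ≤ x) :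
    (∑ j ∈ Finset.range 8, (x / m) ^ j / (j.factorial : ℝ)) ^ m ≤ Real.exp x := by
  have hm' : (0 : ℝ) < m := by exact_mod_cast hm
  have h2 : Real.exp x = Real.exp (x / m) ^ m := by
    rw [← Real.exp_nat_mul]
    congr 1
    field_simp
  rw [h2]
  exact pow_le_pow_left₀ (Finset.sum_nonneg fun j _ => by positivity)
    (Real.sum_le_exp_of_nonneg (by positivity) 8) m

theorem exp_neg_le_of_taylor {x c : ℝ} (m : ℕ) (hm : 0 < m) (hx : 0 ≤ x)
    (h : 1 ≤ c * (∑ j ∈ Finset.range 8, (x / m) ^ j / (j.factorial : ℝ)) ^ m) (hc : 0 ≤ c) :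
    Real.exp (-x) ≤ c := by
  rw [Real.exp_neg, inv_le_iff_one_le_mul₀ (Real.exp_pos x)]
  exact h.trans (by gcongr; exact taylor_pow_le_exp m hm hx)

/-! ### The boundaries `φ^IS` and `φ^JJ` -/

/-- The boundary for the sum of `n` samples. -/
def Boundary.sumWidth (φ : Boundary) (δ : ℝ) (n : ℕ) : ℝ := n * φ.width n δ

theorem nat_mul_sqrt_div {n : ℕ} (hn : 1 ≤ n) (V : ℝ) :
    (n : ℝ) * Real.sqrt (V / n) = Real.sqrt (n * V) := by
  have h0 : (0 : ℝ) < n := by exact_mod_cast hn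
  rw [← Real.sqrt_sq h0.le, ← Real.sqrt_mul (sq_nonneg _), Real.sqrt_sq h0.le]
  congr 1
  field_simp

section IS

theorem is_sumWidth {δ : ℝ} (hδ : 0 < δ) {n : ℕ} (hn : 1 ≤ n) :
    Boundary.is.sumWidth δ n = Real.sqrt (n * (2.89 * Real.log (Real.log (2.041 * (n : ℝ)))
      + 2.065 * (Real.log (1 / δ) + Real.log 4.983))) := by
  rw [Boundary.sumWidth, Boundary.width, nat_mul_sqrt_div hn]
  congr 3
  rw [← Real.log_mul (by positivity) (by norm_num)]
  congr 2
  ring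

theorem log_4983 : 1.606 ≤ Real.log 4.983 := by
  rw [Real.le_log_iff_exp_le (by norm_num)]
  refine (exp_le_taylor_pow 2 (by norm_num) (by norm_num) (by norm_num)).trans ?_
  norm_num [Finset.sum_range_succ, Nat.factorial]

/-- `q = log 2 / 4` belongs to epochs of ratio `2`. -/
theorem sq_log_two_div_four : 0.9699 ≤ 1 - (Real.log 2 / 4) ^ 2 := by
  nlinarith [Real.log_two_lt_d9, Real.log_two_gt_d9]

/-- The epoch `N ≤ n ≤ 2 N` of the boundary `φ^IS`, where the iterated logarithm is at least
`r`. -/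
theorem is_epoch {δ : ℝ} (hδ : 0 < δ) (hδ1 : δ < 1) {N : ℕ} (hN : 1 ≤ N) {r : ℝ}
    (hr : r ≤ Real.log (Real.log (2.041 * (N : ℝ)))) (hr0 : 0 ≤ 1.445 * r + 1.658) :
    MixtureCover (Boundary.is.sumWidth δ) {n | N ≤ n ∧ n ≤ 2 * N}
      (δ * Real.exp (-(0.9699 * (1.445 * r + 1.658)))) := by
  have hN' : (1 : ℝ) ≤ N := by exact_mod_cast hN
  have hL : 0 < Real.log (1 / δ) := Real.log_pos (by rw [lt_div_iff₀ hδ]; linarith)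
  set L := Real.log (1 / δ) with hLdef
  have hz : 0 ≤ 2.89 * r + 2.065 * (L + 1.606) := by linarith
  have h := MixtureCover.of_epoch (b := Boundary.is.sumWidth δ)
    (I := {n | N ≤ n ∧ n ≤ 2 * N}) (N := N) (q := Real.log 2 / 4)
    (z := Real.sqrt (2.89 * r + 2.065 * (L + 1.606))) (by linarith) (Real.sqrt_nonneg _)
    (fun n hn => ⟨by exact_mod_cast hn.1, ?_⟩) (fun n hn => ?_)
  · refine h.mono subset_rfl (fun _ _ => le_rfl) ?_
    have hδe : δ = Real.exp (-L) := by
      rw [hLdef, one_div, Real.log_inv, neg_neg, Real.exp_log hδ]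
    rw [Real.sq_sqrt hz, hδe, ← Real.exp_add, Real.exp_le_exp]
    have h1 := sq_log_two_div_four
    have h2 : 0 ≤ (2.89 * r + 2.065 * (L + 1.606)) / 2 := by positivity
    have h3 := mul_le_mul_of_nonneg_right h1 h2
    nlinarith
  · rw [show 4 * (Real.log 2 / 4) = Real.log 2 by ring, Real.exp_log (by norm_num)]
    have : (n : ℝ) ≤ 2 * N := by exact_mod_cast hn.2
    linarith
  · have hn1 : 1 ≤ n := hN.trans hn.1
    rw [is_sumWidth hδ hn1, ← Real.sqrt_mul hz]
    refine Real.sqrt_le_sqrt ?_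
    rw [mul_comm]
    gcongr
    · refine hr.trans (Real.log_le_log (Real.log_pos (by linarith)) (Real.log_le_log
        (by linarith) ?_))
      have : (N : ℝ) ≤ n := by exact_mod_cast hn.1
      gcongr
    · exact log_4983

theorem le_log_log {r s y : ℝ} (h1 : Real.exp r ≤ s) (h2 : Real.exp s ≤ y) :
    r ≤ Real.log (Real.log y) := by
  have hy : 0 < y := (Real.exp_pos _).trans_le h2
  have hs : s ≤ Real.log y := (Real.le_log_iff_exp_le hy).mpr h2
  have hs0 : 0 < s := (Real.exp_pos _).trans_le h1
  rw [Real.le_log_iff_exp_le (hs0.trans_le hs)]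
  exact h1.trans hs

/-- The sample sizes `n ≥ 17` for the boundary `φ^IS`: epochs of ratio `2`. -/
theorem is_tail {δ : ℝ} (hδ : 0 < δ) (hδ1 : δ < 1) :
    MixtureCover (Boundary.is.sumWidth δ) {n | 17 ≤ n} (δ * 0.47) := by
  have hL : 0 < Real.log (1 / δ) := Real.log_pos (by rw [lt_div_iff₀ hδ]; linarith)
  set L := Real.log (1 / δ) with hLdef
  have hl2 := Real.log_two_gt_d9
  have hx : 3.546 ≤ Real.log (2.041 * 17) := by
    rw [Real.le_log_iff_exp_le (by norm_num)]
    refine (exp_le_taylor_pow 4 (by norm_num) (by norm_num) (by norm_num)).trans ?_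
    norm_num [Finset.sum_range_succ, Nat.factorial]
  have hlx : 1.265 ≤ Real.log 3.546 := by
    rw [Real.le_log_iff_exp_le (by norm_num)]
    refine (exp_le_taylor_pow 2 (by norm_num) (by norm_num) (by norm_num)).trans ?_
    norm_num [Finset.sum_range_succ, Nat.factorial]
  have h := MixtureCover.of_tail (b := Boundary.is.sumWidth δ) (N := 17) (q := Real.log 2 / 4)
    (α := 1.0325 * (L + 1.606)) (p := 1.445) (x := 3.546) (d := Real.log 2) (a := 0.4015)
    (by norm_num) (by positivity) (by positivity) (by norm_num) (by norm_num)
    (by positivity) (by norm_num) (by linarith [sq_log_two_div_four]) (fun n hn => ?_)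
  · refine h.mono (fun n hn => ?_) (fun _ _ => le_rfl) ?_
    · have hn : 17 ≤ n := hn
      change (17 : ℝ) ≤ n
      exact_mod_cast hn
    · have hδe : δ = Real.exp (-L) := by
        rw [hLdef, one_div, Real.log_inv, neg_neg, Real.exp_log hδ]
      have e1 : Real.exp (-((1 - (Real.log 2 / 4) ^ 2) * (1.0325 * (L + 1.606))))
          ≤ δ * 0.2003 := by
        have e : Real.exp (-1.6082) ≤ 0.2003 :=
          exp_neg_le_of_taylor 2 (by norm_num) (by norm_num)
            (by norm_num [Finset.sum_range_succ, Nat.factorial]) (by norm_num)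
        refine le_trans ?_ (mul_le_mul_of_nonneg_left e hδ.le)
        nth_rw 1 [hδe]
        rw [← Real.exp_add, Real.exp_le_exp]
        have h3 := mul_le_mul_of_nonneg_right sq_log_two_div_four
          (show 0 ≤ 1.0325 * (L + 1.606) by positivity)
        nlinarith
      have e2 : Real.exp (-(1 + 0.4015) * Real.log 3.546) ≤ 0.17 := by
        refine le_trans (Real.exp_le_exp.mpr (?_ : _ ≤ -(1.7728 : ℝ)))
          (exp_neg_le_of_taylor 2 (by norm_num) (by norm_num)
            (by norm_num [Finset.sum_range_succ, Nat.factorial]) (by norm_num))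
        linarith
      have e3 : Real.exp (-0.4015 * Real.log 3.546) ≤ 0.602 := by
        refine le_trans (Real.exp_le_exp.mpr (?_ : _ ≤ -(0.5078 : ℝ)))
          (exp_neg_le_of_taylor 2 (by norm_num) (by norm_num)
            (by norm_num [Finset.sum_range_succ, Nat.factorial]) (by norm_num))
        linarith
      have e4 : Real.exp (-0.4015 * Real.log 3.546) / (Real.log 2 * 0.4015) ≤ 2.164 := by
        rw [div_le_iff₀ (by positivity)]
        linarith
      calc _ ≤ (δ * 0.2003) * (0.17 + 2.164) := by gcongr
        _ ≤ δ * 0.47 := by linarith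
  · have hn1 : 1 ≤ n := by
      have : (1 : ℝ) ≤ n := by linarith
      exact_mod_cast this
    have hn0 : (0 : ℝ) < n := by linarith
    rw [is_sumWidth hδ hn1]
    refine Real.sqrt_le_sqrt ?_
    have e1 : Real.log (2.041 * (n : ℝ)) = Real.log (2.041 * 17) + Real.log (n / 17) := by
      rw [← Real.log_mul (by norm_num) (by positivity)]
      congr 1
      ring
    have e0 : 0 ≤ Real.log ((n : ℝ) / 17) := Real.log_nonneg (by rw [le_div_iff₀] <;> linarith)
    have e2 : Real.log (3.546 + Real.log 2 / (4 * (Real.log 2 / 4)) * Real.log (n / 17))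
        ≤ Real.log (Real.log (2.041 * (n : ℝ))) := by
      rw [show Real.log 2 / (4 * (Real.log 2 / 4)) = 1 by field_simp, one_mul, e1]
      exact Real.log_le_log (by linarith) (by linarith)
    have e3 := log_4983
    rw [mul_assoc, mul_comm 2, mul_assoc]
    gcongr
    linarith

/-- The boundary `φ^IS` is covered at cost `0.99 δ`. -/
theorem is_cover {δ : ℝ} (hδ : 0 < δ) (hδ1 : δ < 1) :
    MixtureCover (Boundary.is.sumWidth δ) {n | 1 ≤ n} (0.99 * δ) := by
  have h1 := is_epoch hδ hδ1 (N := 1) (r := -0.338) (by norm_num)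
    (le_log_log (s := 0.7132) (exp_neg_le_of_taylor 1 (by norm_num) (by norm_num)
      (by norm_num [Finset.sum_range_succ, Nat.factorial]) (by norm_num))
      ((exp_le_taylor_pow 1 (by norm_num) (by norm_num) (by norm_num)).trans
        (by norm_num [Finset.sum_range_succ, Nat.factorial]))) (by norm_num)
  have h2 := is_epoch hδ hδ1 (N := 3) (r := 0.594) (by norm_num)
    (le_log_log (s := 1.8115) ((exp_le_taylor_pow 1 (by norm_num) (by norm_num)
      (by norm_num)).trans (by norm_num [Finset.sum_range_succ, Nat.factorial]))
      ((exp_le_taylor_pow 2 (by norm_num) (by norm_num) (by norm_num)).trans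
        (by norm_num [Finset.sum_range_succ, Nat.factorial]))) (by norm_num)
  have h3 := is_epoch hδ hδ1 (N := 5) (r := 0.842) (by norm_num)
    (le_log_log (s := 2.322) ((exp_le_taylor_pow 1 (by norm_num) (by norm_num)
      (by norm_num)).trans (by norm_num [Finset.sum_range_succ, Nat.factorial]))
      ((exp_le_taylor_pow 3 (by norm_num) (by norm_num) (by norm_num)).trans
        (by norm_num [Finset.sum_range_succ, Nat.factorial]))) (by norm_num)
  have h4 := is_epoch hδ hδ1 (N := 9) (r := 1.068) (by norm_num)
    (le_log_log (s := 2.91) ((exp_le_taylor_pow 2 (by norm_num) (by norm_num)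
      (by norm_num)).trans (by norm_num [Finset.sum_range_succ, Nat.factorial]))
      ((exp_le_taylor_pow 3 (by norm_num) (by norm_num) (by norm_num)).trans
        (by norm_num [Finset.sum_range_succ, Nat.factorial]))) (by norm_num)
  have c1 : Real.exp (-(0.9699 * (1.445 * (-0.338) + 1.658))) ≤ 0.322 :=
    exp_neg_le_of_taylor 2 (by norm_num) (by norm_num)
      (by norm_num [Finset.sum_range_succ, Nat.factorial]) (by norm_num)
  have c2 : Real.exp (-(0.9699 * (1.445 * 0.594 + 1.658))) ≤ 0.0875 :=
    exp_neg_le_of_taylor 2 (by norm_num) (by norm_num)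
      (by norm_num [Finset.sum_range_succ, Nat.factorial]) (by norm_num)
  have c3 : Real.exp (-(0.9699 * (1.445 * 0.842 + 1.658))) ≤ 0.062 :=
    exp_neg_le_of_taylor 3 (by norm_num) (by norm_num)
      (by norm_num [Finset.sum_range_succ, Nat.factorial]) (by norm_num)
  have c4 : Real.exp (-(0.9699 * (1.445 * 1.068 + 1.658))) ≤ 0.045 :=
    exp_neg_le_of_taylor 3 (by norm_num) (by norm_num)
      (by norm_num [Finset.sum_range_succ, Nat.factorial]) (by norm_num)
  have h := (((h1.union h2 (by positivity) (by positivity)).union h3 (by positivity)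
    (by positivity)).union h4 (by positivity) (by positivity)).union (is_tail hδ hδ1)
    (by positivity) (by positivity)
  refine h.mono (fun n hn => ?_) (fun _ _ => le_rfl) ?_
  · have hn : 1 ≤ n := hn
    simp only [Set.mem_union, Set.mem_ofPred_eq]
    omega
  · have := mul_le_mul_of_nonneg_left c1 hδ.le
    have := mul_le_mul_of_nonneg_left c2 hδ.le
    have := mul_le_mul_of_nonneg_left c3 hδ.le
    have := mul_le_mul_of_nonneg_left c4 hδ.le
    linarith

end IS

section JJ

theorem jj_sumWidth {δ : ℝ} {n : ℕ} (hn : 1 ≤ n) :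
    Boundary.jj.sumWidth δ n = Real.sqrt (n * (2 * Real.log (1 / δ)
      + 6 * Real.log (Real.log (1 / δ))
      + 3 * Real.log (1 + Real.log ((n : ℝ) / 2)))) := by
  have h0 : (0 : ℝ) < n := by exact_mod_cast hn
  rw [Boundary.sumWidth, Boundary.width, nat_mul_sqrt_div hn]
  congr 5
  rw [mul_div_assoc, Real.log_mul (Real.exp_pos 1).ne' (by positivity), Real.log_exp]

/-- The boundary `φ^JJ` is covered at cost `0.95 δ`. -/
theorem jj_cover {δ : ℝ} (hδ : 0 < δ) (hδ1 : δ ≤ 0.1) :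
    MixtureCover (Boundary.jj.sumWidth δ) {n | 1 ≤ n} (0.95 * δ) := by
  have hL : 2.3 ≤ Real.log (1 / δ) := by
    rw [Real.le_log_iff_exp_le (by positivity)]
    have h1 : (10 : ℝ) ≤ 1 / δ := by
      rw [le_div_iff₀ hδ]
      linarith
    refine le_trans ((exp_le_taylor_pow 3 (by norm_num) (by norm_num) (by norm_num)).trans ?_) h1
    norm_num [Finset.sum_range_succ, Nat.factorial]
  set L := Real.log (1 / δ) with hLdef
  have hL0 : 0 < L := by linarith
  have hδe : Real.exp (-L) = δ := by
    rw [hLdef, one_div, Real.log_inv, neg_neg, Real.exp_log hδ]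
  have hLe : Real.exp (-(L + 3 * Real.log L)) = δ / L ^ 3 := by
    have h3 : 3 * Real.log L = Real.log (L ^ 3) := by
      rw [Real.log_pow]
      norm_num
    rw [neg_add, Real.exp_add, hδe, h3, Real.exp_neg, Real.exp_log (by positivity),
      div_eq_mul_inv]
  have hlogL : 0.8 ≤ Real.log L := by
    rw [Real.le_log_iff_exp_le hL0]
    refine le_trans ((exp_le_taylor_pow 1 (by norm_num) (by norm_num) (by norm_num)).trans ?_) hL
    norm_num [Finset.sum_range_succ, Nat.factorial]
  -- one sample
  have h1 : MixtureCover (Boundary.jj.sumWidth δ) {1} (δ / L ^ 3 * 5.9) := by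
    have hll : -1.183 ≤ Real.log (1 + Real.log ((1 : ℕ) / 2)) := by
      have h2 := Real.log_two_lt_d9
      have h3 : Real.log (((1 : ℕ) : ℝ) / 2) = - Real.log 2 := by
        rw [Nat.cast_one, one_div, Real.log_inv]
      rw [h3, Real.le_log_iff_exp_le (by linarith)]
      refine le_trans (exp_neg_le_of_taylor (c := 0.3068) 2 (by norm_num) (by norm_num)
        (by norm_num [Finset.sum_range_succ, Nat.factorial]) (by norm_num)) ?_
      linarith
    have hz : 0 ≤ 2 * L + 6 * Real.log L + 3 * (-1.183) := by linarith
    have h := MixtureCover.of_epoch (b := Boundary.jj.sumWidth δ) (I := {1}) (N := 1) (q := 0)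
      (z := Real.sqrt (2 * L + 6 * Real.log L + 3 * (-1.183))) (by norm_num)
      (Real.sqrt_nonneg _) (by simp) (fun n hn => ?_)
    · refine h.mono subset_rfl (fun _ _ => le_rfl) ?_
      rw [Real.sq_sqrt hz]
      have e : Real.exp 1.7745 ≤ 5.9 := (exp_le_taylor_pow 2 (by norm_num) (by norm_num)
        (by norm_num)).trans (by norm_num [Finset.sum_range_succ, Nat.factorial])
      refine le_trans (le_of_eq ?_) (mul_le_mul_of_nonneg_left e (by positivity))
      rw [← hLe, ← Real.exp_add]
      congr 1
      ring
    · obtain rfl : n = 1 := hn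
      rw [jj_sumWidth le_rfl, ← Real.sqrt_mul hz]
      refine Real.sqrt_le_sqrt ?_
      rw [← hLdef]
      push_cast at hll ⊢
      linarith
  -- epochs of ratio `exp (1 / √L)`, so that the loss `q ^ 2` is of the order of `1 / L`
  have h2 : MixtureCover (Boundary.jj.sumWidth δ) {n | 2 ≤ n}
      (δ / L ^ 3 * 1.1406 * (1 + Real.sqrt L / 0.459)) := by
    have hsL : 0 < Real.sqrt L := Real.sqrt_pos.mpr hL0
    have hsq : Real.sqrt L ^ 2 = L := Real.sq_sqrt hL0.le
    set q := 1 / (4 * Real.sqrt L) with hq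
    have hq2 : q ^ 2 = 1 / (16 * L) := by
      rw [hq, div_pow, mul_pow, hsq]
      norm_num
    have h := MixtureCover.of_tail (b := Boundary.jj.sumWidth δ) (N := 2) (q := q)
      (α := L + 3 * Real.log L) (p := 1.5) (x := 1) (d := 1 / Real.sqrt L) (a := 0.459)
      (by norm_num) (by positivity) (by linarith) (by norm_num) le_rfl
      (by positivity) (by norm_num) ?_ (fun n hn => ?_)
    · refine h.mono (fun n hn => ?_) (fun _ _ => le_rfl) ?_
      · have hn : 2 ≤ n := hn
        change (2 : ℝ) ≤ n
        exact_mod_cast hn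
      · have e : Real.exp (q ^ 2 * (L + 3 * Real.log L)) ≤ 1.1406 := by
          refine le_trans (Real.exp_le_exp.mpr (?_ : _ ≤ (0.1315 : ℝ)))
            ((exp_le_taylor_pow 1 (by norm_num) (by norm_num)
            (by norm_num)).trans (by norm_num [Finset.sum_range_succ, Nat.factorial]))
          have e1 : Real.log L ≤ 0.36789 * L := by
            have e2 := Real.log_le_sub_one_of_pos (show 0 < L / Real.exp 1 by positivity)
            rw [Real.log_div hL0.ne' (Real.exp_pos 1).ne', Real.log_exp] at e2
            have e3 : L / Real.exp 1 ≤ 0.36789 * L := by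
              rw [div_le_iff₀ (Real.exp_pos 1)]
              nlinarith [Real.exp_one_gt_d9]
            linarith
          rw [hq2, div_mul_eq_mul_div, div_le_iff₀ (by positivity)]
          linarith
        have e5 : Real.exp (-((1 - q ^ 2) * (L + 3 * Real.log L)))
            = δ / L ^ 3 * Real.exp (q ^ 2 * (L + 3 * Real.log L)) := by
          rw [← hLe, ← Real.exp_add]
          congr 1
          ring
        rw [e5, Real.log_one, mul_zero, mul_zero, Real.exp_zero]
        have e6 : 1 / (1 / Real.sqrt L * 0.459) = Real.sqrt L / 0.459 := by
          field_simp
        rw [e6]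
        gcongr
    · rw [hq2]
      have : 1 / (16 * L) ≤ 1 / 36.8 := by
        gcongr
        linarith
      linarith
    · have hn2 : 2 ≤ n := by exact_mod_cast hn
      rw [jj_sumWidth (by omega), ← hLdef]
      refine le_of_eq ?_
      congr 1
      have : 1 / Real.sqrt L / (4 * q) = 1 := by
        rw [hq]
        field_simp
      rw [this, one_mul]
      ring
  refine (h1.union h2 (by positivity) (by positivity)).mono (fun n hn => ?_)
    (fun _ _ => le_rfl) ?_
  · have hn : 1 ≤ n := hn
    simp only [Set.mem_union, Set.mem_ofPred_eq, Set.mem_singleton_iff]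
    omega
  · have e1 : Real.sqrt L ≤ (2 / 3 * L + 3 / 2) / 2 := by
      rw [Real.sqrt_le_left (by positivity)]
      nlinarith [sq_nonneg (2 / 3 * L - 3 / 2)]
    have e2 : 5.9 + 1.1406 * (1 + Real.sqrt L / 0.459) ≤ 0.95 * L ^ 3 := by
      have e3 : 5.9 + 1.1406 * (1 + (2 / 3 * L + 3 / 2) / 2 / 0.459) ≤ 0.95 * L ^ 3 := by
        have e4 := mul_nonneg (sq_nonneg (L - 2.3)) (show 0 ≤ L + 4.6 by linarith)
        norm_num at e4 hL ⊢
        nlinarith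
      refine le_trans ?_ e3
      gcongr
    calc _ = δ / L ^ 3 * (5.9 + 1.1406 * (1 + Real.sqrt L / 0.459)) := by ring
      _ ≤ δ / L ^ 3 * (0.95 * L ^ 3) := by gcongr
      _ = _ := by field_simp

end JJ

/-! ### The boundary `φ⁰` -/

/-- The iterated logarithm `log (log₂ (2 n))` of the boundary `φ⁰`. -/
def iterLog (n : ℕ) : ℝ := Real.log (Real.logb 2 (2 * (n : ℝ)))

/-- `log₂ (2 n) ≥ j + 1` for `n ≥ 2 ^ j`. -/
theorem log_add_one_le_iterLog {j n : ℕ} (h : 2 ^ j ≤ n) : Real.log (j + 1) ≤ iterLog n := by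
  have hn : (2 : ℝ) ^ j ≤ n := by exact_mod_cast h
  refine Real.log_le_log (by positivity) ?_
  rw [Real.le_logb_iff_rpow_le (by norm_num) (by linarith [pow_pos (two_pos (α := ℝ)) j]),
    Real.rpow_add (by norm_num), Real.rpow_natCast, Real.rpow_one]
  linarith

theorem iterLog_nonneg {n : ℕ} (h : 1 ≤ n) : 0 ≤ iterLog n := by
  have := log_add_one_le_iterLog (j := 0) (n := n) (by simpa using h)
  simpa using this

theorem iterLog_one : iterLog 1 = 0 := by
  simp [iterLog]

/-- The values `log (j + 1)` of the iterated logarithm at the first powers `2 ^ j`. -/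
theorem iterLog_stairs {n : ℕ} :
    (2 ≤ n → 0.6931 ≤ iterLog n) ∧ (4 ≤ n → 1.0986 ≤ iterLog n) ∧
    (8 ≤ n → 1.3862 ≤ iterLog n) ∧ (16 ≤ n → 1.6094 ≤ iterLog n) ∧
    (32 ≤ n → 1.7917 ≤ iterLog n) := by
  have l2 := Real.log_two_gt_d9
  have l3 := Real.log_three_gt_d9
  have l5 := Real.log_five_gt_d9
  have l4 : Real.log 4 = 2 * Real.log 2 := by
    rw [show (4 : ℝ) = 2 ^ 2 by norm_num, Real.log_pow]
    norm_num
  have l6 : Real.log 6 = Real.log 2 + Real.log 3 := by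
    rw [← Real.log_mul (by norm_num) (by norm_num)]
    norm_num
  refine ⟨fun h => ?_, fun h => ?_, fun h => ?_, fun h => ?_, fun h => ?_⟩
  · have := log_add_one_le_iterLog (j := 1) (n := n) (by simpa using h)
    norm_num at this
    linarith
  · have := log_add_one_le_iterLog (j := 2) (n := n) (by simpa using h)
    norm_num at this
    linarith
  · have := log_add_one_le_iterLog (j := 3) (n := n) (by simpa using h)
    norm_num at this
    linarith
  · have := log_add_one_le_iterLog (j := 4) (n := n) (by simpa using h)
    norm_num at this
    linarith
  · have := log_add_one_le_iterLog (j := 5) (n := n) (by simpa using h)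
    norm_num at this
    linarith

theorem two_mul_sqrt (V : ℝ) : 2 * Real.sqrt V = Real.sqrt (4 * V) := by
  rw [Real.sqrt_mul (by norm_num), show (4 : ℝ) = 2 ^ 2 by norm_num, Real.sqrt_sq (by norm_num)]

theorem zero_sumWidth {δ : ℝ} (hδ : 0 < δ) {n : ℕ} (hn : 1 ≤ n) :
    Boundary.zero.sumWidth δ n = 2 * Real.sqrt (n * (Real.log (1 / δ) + iterLog n)) := by
  have hn' : (1 : ℝ) ≤ n := by exact_mod_cast hn
  rw [Boundary.sumWidth, Boundary.width, nat_mul_sqrt_div hn,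
    div_eq_mul_one_div, Real.log_mul (Real.logb_pos (by norm_num) (by linarith)).ne'
      (by positivity), ← iterLog, two_mul_sqrt]
  congr 1
  ring

/-- The cover by one line of a boundary of the form `2 √V`, with the square root cleared: what
remains to be checked is polynomial in `n`. -/
theorem MixtureCover.of_line_sqrt {b V : ℕ → ℝ} {I : Set ℕ} {θ c : ℝ} (hθ : 0 ≤ θ)
    (hb : ∀ n ∈ I, 2 * Real.sqrt (V n) ≤ b n)
    (h : ∀ n ∈ I, (c + n * (θ ^ 2 / 2)) ^ 2 ≤ 4 * θ ^ 2 * V n) :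
    MixtureCover b I (Real.exp (-c)) := by
  refine of_line hθ fun n hn => ?_
  have h1 : c + n * (θ ^ 2 / 2) ≤ θ * (2 * Real.sqrt (V n)) := by
    have h2 := Real.abs_le_sqrt (h n hn)
    rw [show 4 * θ ^ 2 * V n = (2 * θ) ^ 2 * V n by ring, Real.sqrt_mul (by positivity),
      Real.sqrt_sq (by positivity)] at h2
    linarith [le_abs_self (c + n * (θ ^ 2 / 2))]
  have h3 := mul_le_mul_of_nonneg_left (hb n hn) hθ
  linarith

theorem log_seven : 1.9458 ≤ Real.log 7 := by
  rw [Real.le_log_iff_exp_le (by norm_num)]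
  refine (exp_le_taylor_pow 2 (by norm_num) (by norm_num) (by norm_num)).trans ?_
  norm_num [Finset.sum_range_succ, Nat.factorial]

theorem logb_two_mul {n N : ℕ} (hN : 1 ≤ N) (hn : 1 ≤ n) :
    Real.logb 2 (2 * (n : ℝ))
      = Real.logb 2 (2 * (N : ℝ)) + 1 / Real.log 2 * Real.log ((n : ℝ) / N) := by
  have h1 : (0 : ℝ) < n := by exact_mod_cast hn
  have h2 : (0 : ℝ) < N := by exact_mod_cast hN
  rw [Real.logb, Real.logb, ← mul_div_right_comm, one_mul, ← add_div,
    ← Real.log_mul (by positivity) (by positivity)]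
  congr 2
  field_simp

/-- Sample sizes from `64` on: epochs of ratio `2 ^ (3 / 2)`. -/
theorem zero_tail {b : ℕ → ℝ} {L : ℝ} (hL : 0 ≤ L)
    (hb : ∀ n : ℕ, 64 ≤ n → 2 * Real.sqrt (n * (L + iterLog n)) ≤ b n) :
    MixtureCover b {n | 64 ≤ n} (0.17 * Real.exp (-(0.9324 * (2 * L)))) := by
  have hl2 := Real.log_two_gt_d9
  have hl2' := Real.log_two_lt_d9
  have hq : 0.9324 ≤ 1 - (3 / 8 * Real.log 2) ^ 2 := by nlinarith
  have h := MixtureCover.of_tail (b := b) (N := 64) (q := 3 / 8 * Real.log 2)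
    (α := 2 * L) (p := 2) (x := 7) (d := 3 / 2) (a := 0.8648)
    (by norm_num) (by positivity) (by positivity) (by norm_num) (by norm_num)
    (by positivity) (by norm_num) (by linarith) (fun n hn => ?_)
  · refine h.mono (fun n hn => ?_) (fun _ _ => le_rfl) ?_
    · have hn : 64 ≤ n := hn
      change (64 : ℝ) ≤ n
      exact_mod_cast hn
    · have h7 := log_seven
      have e1 : Real.exp (-(1 + 0.8648) * Real.log 7) ≤ 0.0266 := by
        refine le_trans (Real.exp_le_exp.mpr (?_ : _ ≤ -(3.6285 : ℝ)))
          (exp_neg_le_of_taylor 4 (by norm_num) (by norm_num)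
            (by norm_num [Finset.sum_range_succ, Nat.factorial]) (by norm_num))
        linarith
      have e2 : Real.exp (-0.8648 * Real.log 7) ≤ 0.186 := by
        refine le_trans (Real.exp_le_exp.mpr (?_ : _ ≤ -(1.6827 : ℝ)))
          (exp_neg_le_of_taylor 2 (by norm_num) (by norm_num)
            (by norm_num [Finset.sum_range_succ, Nat.factorial]) (by norm_num))
        linarith
      have e3 : Real.exp (-0.8648 * Real.log 7) / (3 / 2 * 0.8648) ≤ 0.1434 := by
        rw [div_le_iff₀ (by norm_num)]
        norm_num at e2 ⊢
        linarith
      rw [mul_comm]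
      refine mul_le_mul (by linarith) (Real.exp_le_exp.mpr ?_) (Real.exp_pos _).le (by norm_num)
      have := mul_le_mul_of_nonneg_right hq (show 0 ≤ 2 * L by positivity)
      linarith
  · have hn64 : 64 ≤ n := by exact_mod_cast hn
    refine le_trans (le_of_eq ?_) (hb n hn64)
    rw [iterLog, logb_two_mul (N := 64) (by norm_num) (by omega),
      show (2 * ((64 : ℕ) : ℝ)) = 2 ^ 7 by norm_num, Real.logb_pow, Real.logb_self_eq_one
      (by norm_num), two_mul_sqrt]
    congr 1
    have : (3 : ℝ) / 2 / (4 * (3 / 8 * Real.log 2)) = 1 / Real.log 2 := by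
      field_simp
      norm_num
    rw [this]
    push_cast
    rw [mul_one]
    ring

/-- A convex quadratic inequality holds between two sample sizes if it holds at both. -/
theorem sq_le_of_endpoints {c d K a v : ℝ} {n : ℕ} (lo hi : ℕ) (hK : 0 ≤ K) (hlo : lo ≤ n)
    (hhi : n ≤ hi) (hlt : lo < hi) (e1 : (c + lo * d) ^ 2 ≤ K * (lo * a))
    (e2 : (c + hi * d) ^ 2 ≤ K * (hi * a)) (hv : a ≤ v) : (c + n * d) ^ 2 ≤ K * (n * v) := by
  have h1 : (lo : ℝ) ≤ n := by exact_mod_cast hlo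
  have h2 : (n : ℝ) ≤ hi := by exact_mod_cast hhi
  have h3 : (lo : ℝ) < hi := by exact_mod_cast hlt
  have h4 : (c + n * d) ^ 2 ≤ K * (n * a) := by
    have k1 := mul_le_mul_of_nonneg_left e1 (sub_nonneg.mpr h2)
    have k2 := mul_le_mul_of_nonneg_left e2 (sub_nonneg.mpr h1)
    have k3 := mul_nonneg (mul_nonneg (mul_nonneg (sub_nonneg.mpr h1) (sub_nonneg.mpr h2))
      (sub_nonneg.mpr h3.le)) (sq_nonneg d)
    refine le_of_mul_le_mul_left (?_ : ((hi : ℝ) - lo) * _ ≤ ((hi : ℝ) - lo) * _)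
      (sub_pos.mpr h3)
    linarith
  refine h4.trans ?_
  gcongr

/-- The walk that restarts after the first sample. -/
theorem zero_restart_cover {b : ℕ → ℝ}
    (hb : ∀ n : ℕ, 1 ≤ n → 2 * Real.sqrt (n * iterLog (n + 1)) ≤ b n) :
    MixtureCover b {n | 1 ≤ n} 0.515 := by
  have h1 : MixtureCover b {n | 1 ≤ n ∧ n ≤ 17} (Real.exp (-1.221)) := by
    refine MixtureCover.of_line_sqrt (θ := 1.1) (V := fun n => n * iterLog (n + 1)) (by norm_num)
      (fun n hn => hb n hn.1) fun n ⟨h1, h2⟩ => ?_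
    obtain ⟨s1, s2, s3, s4, -⟩ := iterLog_stairs (n := n + 1)
    rcases le_or_gt n 2 with h | h
    · exact sq_le_of_endpoints 1 2 (by norm_num) h1 h (by norm_num) (by norm_num) (by norm_num)
        (s1 (by omega))
    rcases le_or_gt n 6 with h' | h'
    · exact sq_le_of_endpoints 3 6 (by norm_num) h h' (by norm_num) (by norm_num) (by norm_num)
        (s2 (by omega))
    rcases le_or_gt n 14 with h'' | h''
    · exact sq_le_of_endpoints 7 14 (by norm_num) h' h'' (by norm_num) (by norm_num)
        (by norm_num) (s3 (by omega))
    · exact sq_le_of_endpoints 15 17 (by norm_num) h'' h2 (by norm_num) (by norm_num)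
        (by norm_num) (s4 (by omega))
  have h2 : MixtureCover b {n | 18 ≤ n ∧ n ≤ 63} (Real.exp (-3.015)) := by
    refine MixtureCover.of_line_sqrt (θ := 0.45) (V := fun n => n * iterLog (n + 1))
      (by norm_num) (fun n hn => hb n (le_trans (by norm_num) hn.1)) fun n ⟨h1, h2⟩ => ?_
    obtain ⟨-, -, -, s4, s5⟩ := iterLog_stairs (n := n + 1)
    rcases le_or_gt n 30 with h | h
    · exact sq_le_of_endpoints 18 30 (by norm_num) h1 h (by norm_num) (by norm_num) (by norm_num)
        (s4 (by omega))
    · exact sq_le_of_endpoints 31 63 (by norm_num) h h2 (by norm_num) (by norm_num) (by norm_num)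
        (s5 (by omega))
  have h3 := zero_tail (b := b) le_rfl fun n hn => by
    refine le_trans ?_ (hb n (by omega))
    have h0 : (0 : ℝ) < n := by
      have : 0 < n := by omega
      exact_mod_cast this
    rw [zero_add]
    gcongr
    refine Real.log_le_log (Real.logb_pos (by norm_num) ?_) ?_
    · have : (64 : ℝ) ≤ n := by exact_mod_cast hn
      linarith
    · push_cast
      gcongr
      · norm_num
      · linarith
  refine ((h1.union h2 (by positivity) (by positivity)).union h3 (by positivity)
    (by positivity)).mono (fun n hn => ?_) (fun _ _ => le_rfl) ?_
  · have hn : 1 ≤ n := hn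
    simp only [Set.mem_union, Set.mem_ofPred_eq]
    omega
  · have c1 : Real.exp (-1.221) ≤ 0.2951 := exp_neg_le_of_taylor 2 (by norm_num) (by norm_num)
      (by norm_num [Finset.sum_range_succ, Nat.factorial]) (by norm_num)
    have c2 : Real.exp (-3.015) ≤ 0.0492 := exp_neg_le_of_taylor 3 (by norm_num) (by norm_num)
      (by norm_num [Finset.sum_range_succ, Nat.factorial]) (by norm_num)
    simp only [mul_zero, neg_zero, Real.exp_zero]
    linarith

/-- The sample sizes `n ≥ 2` at levels with `log (1 / δ) ≥ 0.3`. -/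
theorem zero_cover_of_ge {b : ℕ → ℝ}
    (hb : ∀ n : ℕ, 1 ≤ n → 2 * Real.sqrt (n * (0.3 + iterLog n)) ≤ b n) :
    MixtureCover b {n | 2 ≤ n} 0.276 := by
  have h1 : MixtureCover b {n | 2 ≤ n ∧ n ≤ 17} (Real.exp (-1.889)) := by
    refine MixtureCover.of_line_sqrt (θ := 1.1) (V := fun n => n * (0.3 + iterLog n))
      (by norm_num) (fun n hn => hb n (le_trans (by norm_num) hn.1)) fun n ⟨h1, h2⟩ => ?_
    obtain ⟨s1, s2, s3, s4, -⟩ := iterLog_stairs (n := n)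
    rcases le_or_gt n 3 with h | h
    · exact sq_le_of_endpoints 2 3 (by norm_num) h1 h (by norm_num) (by norm_num) (by norm_num)
        (add_le_add_right (s1 (by omega)) _)
    rcases le_or_gt n 7 with h' | h'
    · exact sq_le_of_endpoints 4 7 (by norm_num) h h' (by norm_num) (by norm_num) (by norm_num)
        (add_le_add_right (s2 (by omega)) _)
    rcases le_or_gt n 15 with h'' | h''
    · exact sq_le_of_endpoints 8 15 (by norm_num) h' h'' (by norm_num) (by norm_num)
        (by norm_num) (add_le_add_right (s3 (by omega)) _)
    · exact sq_le_of_endpoints 16 17 (by norm_num) h'' h2 (by norm_num) (by norm_num)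
        (by norm_num) (add_le_add_right (s4 (by omega)) _)
  have h2 : MixtureCover b {n | 18 ≤ n ∧ n ≤ 63} (Real.exp (-3.6)) := by
    refine MixtureCover.of_line_sqrt (θ := 0.5) (V := fun n => n * (0.3 + iterLog n))
      (by norm_num) (fun n hn => hb n (le_trans (by norm_num) hn.1)) fun n ⟨h1, h2⟩ => ?_
    obtain ⟨-, -, -, s4, s5⟩ := iterLog_stairs (n := n)
    rcases le_or_gt n 31 with h | h
    · exact sq_le_of_endpoints 18 31 (by norm_num) h1 h (by norm_num) (by norm_num) (by norm_num)
        (add_le_add_right (s4 (by omega)) _)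
    · exact sq_le_of_endpoints 32 63 (by norm_num) h h2 (by norm_num) (by norm_num) (by norm_num)
        (add_le_add_right (s5 (by omega)) _)
  have h3 := zero_tail (b := b) (L := 0.3) (by norm_num) fun n hn => hb n (by omega)
  refine ((h1.union h2 (by positivity) (by positivity)).union h3 (by positivity)
    (by positivity)).mono (fun n hn => ?_) (fun _ _ => le_rfl) ?_
  · have hn : 2 ≤ n := hn
    simp only [Set.mem_union, Set.mem_ofPred_eq]
    omega
  · have c1 : Real.exp (-1.889) ≤ 0.1513 := exp_neg_le_of_taylor 2 (by norm_num) (by norm_num)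
      (by norm_num [Finset.sum_range_succ, Nat.factorial]) (by norm_num)
    have c2 : Real.exp (-3.6) ≤ 0.02735 := exp_neg_le_of_taylor 3 (by norm_num) (by norm_num)
      (by norm_num [Finset.sum_range_succ, Nat.factorial]) (by norm_num)
    have c3 : Real.exp (-(0.9324 * (2 * 0.3))) ≤ 0.5716 := exp_neg_le_of_taylor 1 (by norm_num)
      (by norm_num) (by norm_num [Finset.sum_range_succ, Nat.factorial]) (by norm_num)
    linarith

/-- The sample sizes `n ≥ 2` at small levels: epochs of ratio `4`. -/
theorem zero_cover_exp {b : ℕ → ℝ} {L : ℝ} (hL : 0 ≤ L)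
    (hb : ∀ n : ℕ, 1 ≤ n → 2 * Real.sqrt (n * (L + iterLog n)) ≤ b n) :
    MixtureCover b {n | 2 ≤ n} (0.6135 * Real.exp (-(1.7596 * L))) := by
  have hl2 := Real.log_two_gt_d9
  have hl2' := Real.log_two_lt_d9
  have hq : 0.8798 ≤ 1 - (Real.log 2 / 2) ^ 2 := by nlinarith
  have h1 : MixtureCover b {n | 2 ≤ n ∧ n ≤ 8} (0.2957 * Real.exp (-(1.7596 * L))) := by
    have hz : 0 ≤ 4 * (L + Real.log 2) := by positivity
    have h := MixtureCover.of_epoch (b := b) (I := {n | 2 ≤ n ∧ n ≤ 8}) (N := 2)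
      (q := Real.log 2 / 2) (z := Real.sqrt (4 * (L + Real.log 2))) (by norm_num)
      (Real.sqrt_nonneg _) (fun n hn => ⟨by exact_mod_cast hn.1, ?_⟩) (fun n hn => ?_)
    · refine h.mono subset_rfl (fun _ _ => le_rfl) ?_
      have e : Real.exp (-1.2196) ≤ 0.2957 := exp_neg_le_of_taylor 2 (by norm_num)
        (by norm_num) (by norm_num [Finset.sum_range_succ, Nat.factorial]) (by norm_num)
      refine le_trans ?_ (mul_le_mul_of_nonneg_right e (Real.exp_pos _).le)
      rw [Real.sq_sqrt hz, ← Real.exp_add, Real.exp_le_exp]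
      have := mul_le_mul_of_nonneg_right hq (show 0 ≤ 4 * (L + Real.log 2) / 2 by positivity)
      linarith
    · rw [show 4 * (Real.log 2 / 2) = Real.log 2 + Real.log 2 by ring, Real.exp_add,
        Real.exp_log (by norm_num)]
      have : (n : ℝ) ≤ 8 := by exact_mod_cast hn.2
      linarith
    · refine le_trans ?_ (hb n (le_trans (by norm_num) hn.1))
      rw [two_mul_sqrt, ← Real.sqrt_mul hz]
      refine Real.sqrt_le_sqrt ?_
      have h2 := log_add_one_le_iterLog (j := 1) (n := n) (by simpa using hn.1)
      norm_num at h2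
      have hn0 : (0 : ℝ) ≤ n := Nat.cast_nonneg n
      nlinarith
  have h2 : MixtureCover b {n | 8 ≤ n} (0.3178 * Real.exp (-(1.7596 * L))) := by
    have hl4 : Real.log 4 = 2 * Real.log 2 := by
      rw [show (4 : ℝ) = 2 ^ 2 by norm_num, Real.log_pow]
      norm_num
    have h := MixtureCover.of_tail (b := b) (N := 8) (q := Real.log 2 / 2)
      (α := 2 * L) (p := 2) (x := 4) (d := 2) (a := 0.7596)
      (by norm_num) (by positivity) (by positivity) (by norm_num) (by norm_num)
      (by positivity) (by norm_num) (by linarith) (fun n hn => ?_)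
    · refine h.mono (fun n hn => ?_) (fun _ _ => le_rfl) ?_
      · have hn : 8 ≤ n := hn
        change (8 : ℝ) ≤ n
        exact_mod_cast hn
      · have e1 : Real.exp (-(1 + 0.7596) * Real.log 4) ≤ 0.0876 := by
          refine le_trans (Real.exp_le_exp.mpr (?_ : _ ≤ -(2.439 : ℝ)))
            (exp_neg_le_of_taylor 3 (by norm_num) (by norm_num)
              (by norm_num [Finset.sum_range_succ, Nat.factorial]) (by norm_num))
          linarith
        have e2 : Real.exp (-0.7596 * Real.log 4) ≤ 0.3495 := by
          refine le_trans (Real.exp_le_exp.mpr (?_ : _ ≤ -(1.053 : ℝ)))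
            (exp_neg_le_of_taylor 1 (by norm_num) (by norm_num)
              (by norm_num [Finset.sum_range_succ, Nat.factorial]) (by norm_num))
          linarith
        have e3 : Real.exp (-0.7596 * Real.log 4) / (2 * 0.7596) ≤ 0.2301 := by
          rw [div_le_iff₀ (by norm_num)]
          norm_num at e2 ⊢
          linarith
        rw [mul_comm]
        refine mul_le_mul (by linarith) (Real.exp_le_exp.mpr ?_) (Real.exp_pos _).le
          (by norm_num)
        have := mul_le_mul_of_nonneg_right hq (show 0 ≤ 2 * L by positivity)
        linarith
    · have hn8 : 8 ≤ n := by exact_mod_cast hn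
      refine le_trans (le_of_eq ?_) (hb n (by omega))
      rw [iterLog, logb_two_mul (N := 8) (by norm_num) (by omega),
        show (2 * ((8 : ℕ) : ℝ)) = 2 ^ 4 by norm_num, Real.logb_pow, Real.logb_self_eq_one
        (by norm_num), two_mul_sqrt]
      congr 1
      have : (2 : ℝ) / (4 * (Real.log 2 / 2)) = 1 / Real.log 2 := by
        field_simp
        norm_num
      rw [this]
      push_cast
      rw [mul_one]
      ring
  refine (h1.union h2 (by positivity) (by positivity)).mono (fun n hn => ?_)
    (fun _ _ => le_rfl) (by linarith [Real.exp_pos (-(1.7596 * L))])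
  have hn : 2 ≤ n := hn
  simp only [Set.mem_union, Set.mem_ofPred_eq]
  omega

/-! ### Violation of the upper confidence bound -/

section

variable {k : ℕ} {Ω : Type*} [mΩ : MeasurableSpace Ω] {P : Measure Ω} {ν : Fin k → Measure ℝ}
  {X : Fin k → ℕ → Ω → ℝ} {U : Ω → ℝ} {φ : Boundary} {δ : ℝ}
  {tie : ℝ → ℕ → Finset (Fin k) → Fin k}

/-- The event that the upper confidence bound of arm `i` falls below its mean `m` at some time. -/
def violation (φ : Boundary) (δ : ℝ) (tie : ℝ → ℕ → Finset (Fin k) → Fin k)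
    (X : Fin k → ℕ → Ω → ℝ) (U : Ω → ℝ) (i : Fin k) (m : ℝ) : Set Ω :=
  {ω | ∃ t, 1 ≤ numPulls (fun s => sampledArm φ δ tie X U s ω) i t ∧
    φ.sumWidth δ (numPulls (fun s => sampledArm φ δ tie X U s ω) i t)
      < deficit (fun s => sampledArm φ δ tie X U s ω) (fun i s => X i s ω) i m t}

theorem IsSubGaussianBandit.measure_violation_le_of_cover (hB : IsSubGaussianBandit P ν X U)
    (htie : IsTieBreak tie) (i : Fin k) {B : ℝ}
    (hcov : MixtureCover (φ.sumWidth δ) {n | 1 ≤ n} B) :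
    P (violation φ δ tie X U i (armMean ν i)) ≤ ENNReal.ofReal B :=
  hB.measure_crossing_le htie i hcov

/-- The first sample is treated separately from the others. -/
theorem IsSubGaussianBandit.measure_violation_le_add (hB : IsSubGaussianBandit P ν X U)
    (htie : IsTieBreak tie) (i : Fin k) {p B : ℝ} (hp0 : 0 ≤ p) (hB0 : 0 ≤ B)
    (hp : ν i {y | φ.sumWidth δ 1 < armMean ν i - y} ≤ ENNReal.ofReal p)
    (hcov : MixtureCover (φ.sumWidth δ) {n | 2 ≤ n} B) :
    P (violation φ δ tie X U i (armMean ν i)) ≤ ENNReal.ofReal (p + B) := by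
  have h1 := hB.measure_crossing_le_of_first (φ := φ) (δ := δ) htie i hp0 hp le_rfl zero_le_one
    (I := ∅) (MixtureCover.empty)
  have h2 := hB.measure_crossing_le (φ := φ) (δ := δ) htie i hcov
  rw [mul_zero, add_zero] at h1
  rw [ENNReal.ofReal_add hp0 hB0]
  refine (measure_mono ?_).trans ((measure_union_le _ _).trans (add_le_add h1 h2))
  rintro ω ⟨t, h3, h4⟩
  rcases Nat.lt_or_ge 1 (numPulls (fun s => sampledArm φ δ tie X U s ω) i t) with h5 | h5
  · exact Or.inr ⟨t, h5, h4⟩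
  · exact Or.inl ⟨t, Or.inl (by omega), h4⟩

/-- The second moment of the noise is at most `1`, so Cantelli's inequality bounds the first
crossing of `φ⁰`. -/
theorem IsSubGaussianBandit.measure_first_le (hB : IsSubGaussianBandit P ν X U) (i : Fin k)
    (hδ : 0 < δ) (hδ1 : δ < 1) :
    ν i {y | Boundary.zero.sumWidth δ 1 < armMean ν i - y}
      ≤ ENNReal.ofReal (1 / (1 + 4 * Real.log (1 / δ))) := by
  have := hB.isProbabilityMeasure_law i
  have hL : 0 < Real.log (1 / δ) := Real.log_pos (by rw [lt_div_iff₀ hδ]; linarith)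
  have h1 : Boundary.zero.sumWidth δ 1 = 2 * Real.sqrt (Real.log (1 / δ)) := by
    rw [zero_sumWidth hδ le_rfl, iterLog_one]
    simp
  have h2 : 0 < Real.sqrt (Real.log (1 / δ)) := Real.sqrt_pos.mpr hL
  have h := measure_lt_le_of_hasSubgaussianMGF (hB.subGaussian i) rfl
    (x := 2 * Real.sqrt (Real.log (1 / δ))) (by positivity)
  rw [mul_pow, Real.sq_sqrt hL.le] at h
  rw [h1]
  norm_num at h ⊢
  exact h

/-- The boundary `φ⁰`, seen from the point that it allows after one sample, lies above the boundary
`φ⁰` at level one. -/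
theorem zero_restart_le {L : ℝ} (hL : 0 ≤ L) {n : ℕ} {v : ℝ} (hv : 0 ≤ v) :
    2 * Real.sqrt (n * v)
      ≤ 2 * Real.sqrt (((n + 1 : ℕ) : ℝ) * (L + v)) - 2 * Real.sqrt L := by
  have hn : (0 : ℝ) ≤ n := Nat.cast_nonneg n
  have key : Real.sqrt L + Real.sqrt (n * v) ≤ Real.sqrt (((n + 1 : ℕ) : ℝ) * (L + v)) := by
    refine Real.le_sqrt_of_sq_le ?_
    rw [Real.sqrt_mul hn]
    have h1 := Real.sq_sqrt hL
    have h2 := Real.sq_sqrt hv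
    have h3 := Real.sq_sqrt hn
    set a := Real.sqrt L
    set b := Real.sqrt v
    set c := Real.sqrt (n : ℝ)
    push_cast
    rw [← h1, ← h2, ← h3]
    nlinarith [sq_nonneg (c * a - b)]
  linarith

theorem exp_le_cubic {x : ℝ} (h0 : 0 ≤ x) (h1 : x ≤ 1) :
    Real.exp x ≤ 1 + x + x ^ 2 / 2 + 2 / 9 * x ^ 3 := by
  refine (Real.exp_bound' h0 h1 (n := 3) (by norm_num)).trans (le_of_eq ?_)
  norm_num [Finset.sum_range_succ, Nat.factorial]
  ring

/-- For the boundary `φ⁰` the level may be arbitrarily close to `1`, where the covers of all sample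
sizes by lines cost too much. With `L = log (1 / δ)`: for `L ≤ 0.3` the walk is restarted after the
first sample, whose crossing probability is at most `1 / (1 + 4 L)` by Cantelli's inequality; for
`L ≤ 1` that probability and the cost of a cover of the sample sizes `n ≥ 2` are added; for `L > 1`
a mixture covers all sample sizes. -/
theorem IsSubGaussianBandit.measure_violation_zero_le (hB : IsSubGaussianBandit P ν X U)
    (htie : IsTieBreak tie) (i : Fin k) (hδ : 0 < δ) (hδ1 : δ < 1) {ε : ℝ}
    (hε : ε ≤ 0.001) (hεL : ε ≤ Real.log (1 / δ) / 1000) :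
    P (violation .zero δ tie X U i (armMean ν i)) ≤ ENNReal.ofReal ((1 - ε) * δ) := by
  have hL : 0 < Real.log (1 / δ) := Real.log_pos (by rw [lt_div_iff₀ hδ]; linarith)
  have hfirst := hB.measure_first_le i hδ hδ1
  have hsw : ∀ n : ℕ, 1 ≤ n → Boundary.zero.sumWidth δ n
      = 2 * Real.sqrt (n * (Real.log (1 / δ) + iterLog n)) := fun n hn => zero_sumWidth hδ hn
  set L := Real.log (1 / δ) with hLdef
  have hδe : Real.exp (-L) = δ := by
    rw [hLdef, one_div, Real.log_inv, neg_neg, Real.exp_log hδ]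
  have hδe' : Real.exp L * δ = 1 := by
    rw [← hδe, ← Real.exp_add]
    simp
  have hp0 : 0 < 1 / (1 + 4 * L) := by positivity
  have hp1 : 1 / (1 + 4 * L) ≤ 1 := by
    rw [div_le_one (by positivity)]
    linarith
  -- it suffices to compare after multiplication by `exp L = 1 / δ`
  have hmul : ∀ {B c : ℝ}, B * Real.exp L ≤ c → c ≤ 1 - ε → B ≤ (1 - ε) * δ := by
    intro B c h1 h2
    calc B = B * Real.exp L * δ := by rw [mul_assoc, hδe', mul_one]
      _ ≤ (1 - ε) * δ := by gcongr; exact h1.trans h2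
  rcases le_or_gt L 0.3 with h03 | h03
  -- with `p = 1 / (1 + 4 L)` the bound is `p + 0.515 (1 - p)`, of slope `-1.94` in `L` at `0`,
  -- which is below the slope `-1` of `δ = exp (-L)`
  · have h := hB.measure_crossing_le_of_first (φ := .zero) (δ := δ) htie i
      (b := Boundary.zero.sumWidth δ) (I := {n | 1 ≤ n}) (Q := 0.515) hp0.le hfirst
      (by norm_num) (by norm_num) (zero_restart_cover fun n hn => by
        rw [hsw (n + 1) (by omega), hsw 1 le_rfl, iterLog_one]
        simpa using zero_restart_le hL.le (n := n) (iterLog_nonneg (n := n + 1) (by omega)))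
    refine le_trans (measure_mono ?_) (h.trans (ENNReal.ofReal_le_ofReal ?_))
    · rintro ω ⟨t, h3, h4⟩
      refine ⟨t, ?_, h4⟩
      rcases Nat.lt_or_ge 1 (numPulls (fun s => sampledArm .zero δ tie X U s ω) i t) with h5 | h5
      · exact Or.inr ⟨numPulls (fun s => sampledArm .zero δ tie X U s ω) i t - 1,
          show 1 ≤ _ by omega, by omega⟩
      · exact Or.inl (by omega)
    · have he := exp_le_cubic hL.le (by linarith : L ≤ 1)
      have e1 : 1 / (1 + 4 * L) + (1 - 1 / (1 + 4 * L)) * 0.515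
          = (1 + 2.06 * L) / (1 + 4 * L) := by
        field_simp
        ring
      rw [e1]
      refine hmul (c := 1 - L / 1000) ?_ (by linarith)
      rw [div_mul_eq_mul_div, div_le_iff₀ (by positivity)]
      refine (mul_le_mul_of_nonneg_left he (by positivity)).trans ?_
      have e2 : 2.564 * L + 1.2523 * L ^ 2 + 0.458 * L ^ 3 ≤ 0.939 := by
        have : L ^ 2 ≤ 0.3 ^ 2 := by gcongr
        have : L ^ 3 ≤ 0.3 ^ 3 := by gcongr
        norm_num at *
        linarith
      have e3 := mul_le_mul_of_nonneg_left e2 hL.le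
      norm_num at e3 ⊢
      nlinarith [pow_pos hL 3, pow_pos hL 4]
  rcases le_or_gt L 0.46 with h46 | h46
  · refine (hB.measure_violation_le_add htie i hp0.le (by norm_num) hfirst
      (zero_cover_of_ge fun n hn => ?_)).trans (ENNReal.ofReal_le_ofReal ?_)
    · rw [hsw n hn]
      gcongr
    · have he := exp_le_cubic hL.le (by linarith : L ≤ 1)
      have e1 : 1 / (1 + 4 * L) + 0.276 = (1 + 0.276 * (1 + 4 * L)) / (1 + 4 * L) := by
        field_simp
      rw [e1]
      refine hmul (c := 0.999) ?_ (by linarith)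
      rw [div_mul_eq_mul_div, div_le_iff₀ (by positivity)]
      refine (mul_le_mul_of_nonneg_left he (by positivity)).trans ?_
      have k1 := mul_nonneg (sub_nonneg.mpr h03.le) (sub_nonneg.mpr h46)
      have k2 := mul_nonneg k1 hL.le
      have k3 := mul_nonneg k2 hL.le
      norm_num at k1 k2 k3 h03 h46 ⊢
      nlinarith
  have hcov := zero_cover_exp (b := Boundary.zero.sumWidth δ) hL.le fun n hn => (hsw n hn).ge
  have hexp : Real.exp (-(1.7596 * L)) * Real.exp L = Real.exp (-(0.7596 * L)) := by
    rw [← Real.exp_add]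
    congr 1
    ring
  rcases le_or_gt L 1 with h1 | h1
  · refine (hB.measure_violation_le_add htie i hp0.le (by positivity) hfirst hcov).trans
      (ENNReal.ofReal_le_ofReal (hmul (c := 0.999) ?_ (by linarith)))
    have e1 : Real.exp (-(0.7596 * L)) ≤ 0.706 := by
      refine le_trans (Real.exp_le_exp.mpr (?_ : _ ≤ -(0.3494 : ℝ)))
        (exp_neg_le_of_taylor 1 (by norm_num) (by norm_num)
          (by norm_num [Finset.sum_range_succ, Nat.factorial]) (by norm_num))
      linarith
    have e2 : Real.exp L ≤ 0.558 * (1 + 4 * L) := by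
      have c1 : Real.exp 0.46 ≤ 1.58472 := (exp_le_taylor_pow 1 (by norm_num) (by norm_num)
        (by norm_num)).trans (by norm_num [Finset.sum_range_succ, Nat.factorial])
      have c2 := Real.exp_one_lt_d9
      have c3 := convexOn_exp.2 (Set.mem_univ (0.46 : ℝ)) (Set.mem_univ (1 : ℝ))
        (show 0 ≤ (1 - L) / 0.54 from div_nonneg (by linarith) (by norm_num))
        (show 0 ≤ (L - 0.46) / 0.54 from div_nonneg (by linarith) (by norm_num))
        (by rw [← add_div]; ring_nf)
      simp only [smul_eq_mul] at c3
      have c4 : (1 - L) / 0.54 * 0.46 + (L - 0.46) / 0.54 * 1 = L := by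
        field_simp
        ring
      rw [c4] at c3
      have c5 : (1 - L) / 0.54 * Real.exp 0.46 ≤ (1 - L) / 0.54 * 1.58472 :=
        mul_le_mul_of_nonneg_left c1 (div_nonneg (by linarith) (by norm_num))
      have c6 : (L - 0.46) / 0.54 * Real.exp 1 ≤ (L - 0.46) / 0.54 * 2.79 :=
        mul_le_mul_of_nonneg_left (by linarith) (div_nonneg (by linarith) (by norm_num))
      norm_num at c3 c5 c6 ⊢
      linarith
    have e3 : 1 / (1 + 4 * L) * Real.exp L ≤ 0.558 := by
      rw [div_mul_eq_mul_div, one_mul, div_le_iff₀ (by positivity)]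
      exact e2
    rw [add_mul, mul_assoc, hexp]
    linarith
  · have h2 : MixtureCover (Boundary.zero.sumWidth δ) {1} (Real.exp (-(2 * L))) := by
      have h := MixtureCover.of_epoch (b := Boundary.zero.sumWidth δ) (I := {1}) (N := 1) (q := 0)
        (z := 2 * Real.sqrt L) (by norm_num) (by positivity) (by simp) (fun n hn => ?_)
      · refine h.mono subset_rfl (fun _ _ => le_rfl) ?_
        rw [mul_pow, Real.sq_sqrt hL.le, Real.exp_le_exp]
        linarith
      · obtain rfl : n = 1 := hn
        rw [hsw 1 le_rfl, iterLog_one]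
        simp
    refine (hB.measure_violation_le_of_cover htie i ((h2.union hcov (by positivity)
      (by positivity)).mono (fun n hn => ?_) (fun _ _ => le_rfl) le_rfl)).trans
      (ENNReal.ofReal_le_ofReal (hmul (c := 0.999) ?_ (by linarith)))
    · have hn : 1 ≤ n := hn
      simp only [Set.mem_union, Set.mem_ofPred_eq, Set.mem_singleton_iff]
      omega
    · have e1 : Real.exp (-(2 * L)) * Real.exp L = Real.exp (-L) := by
        rw [← Real.exp_add]
        congr 1
        ring
      have e2 : Real.exp (-L) ≤ 0.37 := by
        refine le_trans (Real.exp_le_exp.mpr (?_ : _ ≤ -(1 : ℝ)))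
          (exp_neg_le_of_taylor 1 (by norm_num) (by norm_num)
            (by norm_num [Finset.sum_range_succ, Nat.factorial]) (by norm_num))
        linarith
      have e3 : Real.exp (-(0.7596 * L)) ≤ 1 := Real.exp_le_one_iff.mpr (by linarith)
      rw [add_mul, mul_assoc, hexp, e1]
      linarith

/-- The upper confidence bound of an arm ever falls below its mean with probability less than `δ`,
uniformly in the level as long as `δ` stays away from `1`. -/
theorem IsSubGaussianBandit.measure_violation_le (hB : IsSubGaussianBandit P ν X U)
    (htie : IsTieBreak tie) (i : Fin k) (hadm : φ.Admissible δ) {ε : ℝ}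
    (hε : ε ≤ 0.001) (hεL : ε ≤ Real.log (1 / δ) / 1000) :
    P (violation φ δ tie X U i (armMean ν i)) ≤ ENNReal.ofReal ((1 - ε) * δ) := by
  cases φ with
  | zero => exact hB.measure_violation_zero_le htie i hadm.1 hadm.2 hε hεL
  | jj =>
    refine (hB.measure_violation_le_of_cover htie i (jj_cover hadm.1 hadm.2)).trans
      (ENNReal.ofReal_le_ofReal ?_)
    have := hadm.1
    gcongr
    linarith
  | is =>
    refine (hB.measure_violation_le_of_cover htie i (is_cover hadm.1 hadm.2)).trans
      (ENNReal.ofReal_le_ofReal ?_)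
    have := hadm.1
    gcongr
    linarith

end

/-! ### Deterministic properties of a run -/

section Run

variable {k : ℕ} {φ : Boundary} {δ : ℝ} {A : ℕ → Option (Fin k)} {x : Fin k → ℕ → ℝ} {i j : Fin k}
  {t : ℕ}

/-- The arms `A` sampled in one run follow the UCB rule: a sampled arm is not rejected and has the
largest upper confidence bound among the arms not rejected, and sampling goes on as long as some arm
is not rejected. -/
structure IsUCBRun (φ : Boundary) (δ : ℝ) (A : ℕ → Option (Fin k)) (x : Fin k → ℕ → ℝ) : Prop where
  notMem : ∀ (t : ℕ) (j : Fin k), A (t + 1) = some j → j ∉ rejSet δ A x t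
  ucbIndex_le : ∀ (t : ℕ) (j : Fin k), A (t + 1) = some j → ∀ i ∉ rejSet δ A x t,
    ucbIndex φ δ A x i t ≤ ucbIndex φ δ A x j t
  exists_eq : ∀ (t : ℕ) (i : Fin k), i ∉ rejSet δ A x t → ∃ j, A (t + 1) = some j

/-- Every run of the algorithm follows the UCB rule; the initial value at time `0` plays no role. -/
theorem isUCBRun_ucbArm {tie : ℕ → Finset (Fin k) → Fin k}
    (htie : ∀ (t : ℕ) (S : Finset (Fin k)), S.Nonempty → tie t S ∈ S) :
    IsUCBRun φ δ (ucbArm φ δ tie x) x := by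
  classical
  set A := ucbArm φ δ tie x with hA
  have hmem : ∀ (t : ℕ) (j : Fin k), A (t + 1) = some j → j ∈ ucbMaximizers φ δ A x t := by
    intro t j hj
    rw [hA, ucbArm_succ] at hj
    split_ifs at hj with hne
    have := htie (t + 1) _ hne
    rwa [Option.some.inj hj] at this
  refine ⟨fun t j hj => ?_, fun t j hj i hi => ?_, fun t i hi => ?_⟩
  · have := hmem t j hj
    simp only [ucbMaximizers, Finset.mem_filter, Finset.mem_compl] at this
    exact this.1
  · have := hmem t j hj
    simp only [ucbMaximizers, Finset.mem_filter, Finset.mem_compl] at this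
    exact this.2 i hi
  · obtain ⟨m, hm, hmax⟩ := Finset.exists_max_image (rejSet δ A x t)ᶜ (ucbIndex φ δ A x · t)
      ⟨i, Finset.mem_compl.mpr hi⟩
    have hne : (ucbMaximizers φ δ A x t).Nonempty :=
      ⟨m, Finset.mem_filter.mpr ⟨hm, hmax⟩⟩
    exact ⟨_, by rw [hA, ucbArm_succ, if_pos hne]⟩

theorem pmh_succ_of_ne (h : A (t + 1) ≠ some i) : pmh A x i (t + 1) = pmh A x i t := by
  rw [pmh, pmh, pullTimes_succ_of_ne h]

theorem subset_rejSet {S : Finset (Fin k)}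
    (hS : ∀ i ∈ S, (k : ℝ) / (δ * (S.card : ℝ)) ≤ pmh A x i t) : S ⊆ rejSet δ A x t :=
  subset_eBH fun i hi => ENNReal.ofReal_le_ofReal (hS i hi)

theorem pmh_pos : 0 < pmh A x i t := by
  rw [← exp_logPmh]
  exact Real.exp_pos _

theorem le_pmh_of_mem_rejSet (hδ : 0 < δ) (hi : i ∈ rejSet δ A x t) :
    (k : ℝ) / (δ * ((rejSet δ A x t).card : ℝ)) ≤ pmh A x i t := by
  have h : ENNReal.ofReal _ ≤ ENNReal.ofReal (pmh A x i t) :=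
    eBH_isESelfConsistent hδ (fun i => eValue A x i t) i hi
  exact (ENNReal.ofReal_le_ofReal_iff pmh_pos.le).mp h

theorem rejSet_zero (hδ : 0 < δ) (hδ1 : δ < 1) : rejSet δ A x (0 : ℕ) = ∅ := by
  by_contra hne
  obtain ⟨i, hi⟩ := Finset.nonempty_iff_ne_empty.mpr hne
  have h1 := le_pmh_of_mem_rejSet hδ hi
  have h2 : pmh A x i 0 = 1 := by simp [pmh, pullTimes_zero]
  have hc : (0 : ℝ) < (rejSet δ A x (0 : ℕ)).card := by
    exact_mod_cast Finset.card_pos.mpr ⟨i, hi⟩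
  have hck : ((rejSet δ A x (0 : ℕ)).card : ℝ) ≤ k := by
    exact_mod_cast (Finset.card_le_univ _).trans (by simp)
  rw [h2, div_le_one (by positivity)] at h1
  nlinarith

namespace IsUCBRun

/-- A rejected arm is no longer sampled, so its e-value stays what it was: rejections are never
revoked. -/
theorem rejSet_subset_succ (hrun : IsUCBRun φ δ A x) (hδ : 0 < δ) (t : ℕ) :
    rejSet δ A x t ⊆ rejSet δ A x (t + 1 : ℕ) := by
  refine subset_rejSet fun i hi => ?_
  rw [pmh_succ_of_ne fun h => hrun.notMem t i h hi]
  exact le_pmh_of_mem_rejSet hδ hi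

theorem rejSet_mono (hrun : IsUCBRun φ δ A x) (hδ : 0 < δ) {s t : ℕ} (h : s ≤ t) :
    rejSet δ A x s ⊆ rejSet δ A x t := by
  induction t, h using Nat.le_induction with
  | base => exact subset_rfl
  | succ t _ ih => exact ih.trans (hrun.rejSet_subset_succ hδ t)

end IsUCBRun

theorem sum_numPulls_eq (h : ∀ s < t, ∃ j, A (s + 1) = some j) : ∑ j, numPulls A j t = t := by
  induction t with
  | zero => simp [numPulls, pullTimes_zero]
  | succ t ih =>
    obtain ⟨j, hj⟩ := h t (Nat.lt_succ_self t)
    have h1 : ∀ l, numPulls A l (t + 1) = numPulls A l t + if l = j then 1 else 0 := by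
      intro l
      split_ifs with hl
      · rw [hl, numPulls_succ_of_eq hj]
      · rw [numPulls_succ_of_ne, add_zero]
        rw [hj]
        exact fun h => hl (Option.some.inj h).symm
    simp only [h1, Finset.sum_add_distrib, ih fun s hs => h s (by omega)]
    simp

theorem exists_last_pull (h : 1 ≤ numPulls A j t) :
    ∃ s < t, A (s + 1) = some j ∧ numPulls A j t = numPulls A j s + 1 := by
  induction t with
  | zero => simp [numPulls, pullTimes_zero] at h
  | succ t ih =>
    by_cases hA : A (t + 1) = some j
    · exact ⟨t, Nat.lt_succ_self t, hA, numPulls_succ_of_eq hA⟩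
    · rw [numPulls_succ_of_ne hA] at h ⊢
      obtain ⟨s, hs, h1, h2⟩ := ih h
      exact ⟨s, by omega, h1, h2⟩

theorem numPulls_succ_le : numPulls A j (t + 1) ≤ numPulls A j t + 1 := by
  by_cases hA : A (t + 1) = some j
  · rw [numPulls_succ_of_eq hA]
  · rw [numPulls_succ_of_ne hA]
    omega

/-- The time `s ≤ t` is the last one at which arm `j` is not rejected. -/
def IsLastUnrejected (δ : ℝ) (A : ℕ → Option (Fin k)) (x : Fin k → ℕ → ℝ) (j : Fin k) (t s : ℕ) :
    Prop :=
  s ≤ t ∧ j ∉ rejSet δ A x s ∧ ∀ u, s < u → u ≤ t → j ∈ rejSet δ A x u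

theorem exists_isLastUnrejected (hδ : 0 < δ) (hδ1 : δ < 1) (j : Fin k) (t : ℕ) :
    ∃ s, IsLastUnrejected δ A x j t s := by
  classical
  refine ⟨Nat.findGreatest (fun s => j ∉ rejSet δ A x s) t, Nat.findGreatest_le t, ?_, ?_⟩
  · refine Nat.findGreatest_spec (P := fun s => j ∉ rejSet δ A x s) (Nat.zero_le t) ?_
    rw [rejSet_zero hδ hδ1]
    simp
  · intro u hu hut
    have := Nat.findGreatest_is_greatest hu hut
    simpa using this

theorem IsLastUnrejected.numPulls_le {s : ℕ} (h : IsLastUnrejected δ A x j t s)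
    (hrun : IsUCBRun φ δ A x) : numPulls A j t ≤ numPulls A j s + 1 := by
  obtain ⟨h1, h2, h3⟩ := h
  have key : ∀ u, s + 1 ≤ u → u ≤ t → numPulls A j u = numPulls A j (s + 1) := by
    intro u hu
    induction u, hu using Nat.le_induction with
    | base => exact fun _ => rfl
    | succ u hu ih =>
      intro hut
      rw [numPulls_succ_of_ne fun h => hrun.notMem u j h (h3 u (by omega) (by omega)),
        ih (by omega)]
  rcases h1.lt_or_eq with h4 | rfl
  · rw [key t h4 le_rfl]
    exact numPulls_succ_le
  · omega

/-- Among any arms, at least one has, at the last time it is not rejected, an e-value too small for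
the set of all of them to be self-consistent: consider the one that is rejected last. -/
theorem exists_pmh_lt {σ : Fin k → ℕ} (hδ : 0 < δ)
    (hσ : ∀ j, IsLastUnrejected δ A x j t (σ j)) {D : Finset (Fin k)} (hD : D.Nonempty) :
    ∃ j ∈ D, pmh A x j (σ j) < k / (δ * (D.card : ℝ)) := by
  classical
  by_contra! hcon
  obtain ⟨l, hl, hmax⟩ := Finset.exists_max_image D σ hD
  set R := rejSet δ A x (σ l) with hR
  have hDpos : (0 : ℝ) < D.card := by exact_mod_cast Finset.card_pos.mpr hD
  have hk : (0 : ℝ) ≤ k := Nat.cast_nonneg k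
  have hsub : R ∪ D ⊆ R := by
    refine subset_rejSet fun j hj => ?_
    by_cases hjR : j ∈ R
    · have hRpos : (0 : ℝ) < R.card := by exact_mod_cast Finset.card_pos.mpr ⟨j, hjR⟩
      refine le_trans ?_ (le_pmh_of_mem_rejSet hδ hjR)
      gcongr
      exact Finset.subset_union_left
    · have hjD : j ∈ D := by
        rcases Finset.mem_union.mp hj with h | h
        · exact absurd h hjR
        · exact h
      have hjl : σ j = σ l := by
        refine le_antisymm (hmax j hjD) (not_lt.mp fun h => hjR ?_)
        exact (hσ j).2.2 _ h (hσ l).1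
      rw [← hjl]
      refine le_trans ?_ (hcon j hjD)
      gcongr
      exact Finset.subset_union_right
  exact (hσ l).2.1 (hsub (Finset.mem_union_right R hl))

/-- If each nonempty subset has an element with value at most `a - log` of its cardinality, then
removing such elements one by one bounds the total by `n a - log n!`. -/
theorem sum_le_of_exists_le {ι : Type*} {ℓ : ι → ℝ} {a : ℝ} (n : ℕ) {D : Finset ι}
    (hn : D.card = n)
    (h : ∀ D' ⊆ D, D'.Nonempty → ∃ j ∈ D', ℓ j ≤ a - Real.log D'.card) :
    ∑ j ∈ D, ℓ j ≤ n * a - Real.log (n.factorial) := by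
  classical
  induction n generalizing D with
  | zero =>
    rw [Finset.card_eq_zero] at hn
    simp [hn]
  | succ n ih =>
    obtain ⟨j, hj, hle⟩ := h D subset_rfl (Finset.card_pos.mp (by omega))
    have h1 := ih (D := D.erase j) (by rw [Finset.card_erase_of_mem hj, hn]; rfl)
      fun D' hD' => h D' (hD'.trans (Finset.erase_subset j D))
    rw [← Finset.add_sum_erase D ℓ hj, Nat.factorial_succ]
    push_cast
    rw [Real.log_mul (by positivity) (by positivity)]
    rw [hn] at hle
    push_cast at hle
    linarith

/-- The total log-evidence that a set of `n` arms collects before rejection: the thresholds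
`k / (δ m)` for `m = 1, …, n` multiply up to `δ ^ (-n) k ^ n / n!`, and `k ^ n / n! ≤ exp k`. -/
theorem sum_logPmh_le {σ : Fin k → ℕ} (hδ : 0 < δ)
    (hσ : ∀ j, IsLastUnrejected δ A x j t (σ j)) (D : Finset (Fin k)) :
    ∑ j ∈ D, logPmh A x j (σ j) ≤ D.card * Real.log (1 / δ) + k := by
  rcases D.eq_empty_or_nonempty with rfl | ⟨i, -⟩
  · simp
  have hk : (0 : ℝ) < k := by exact_mod_cast Fin.pos i
  have h1 := sum_le_of_exists_le (ℓ := fun j => logPmh A x j (σ j)) (a := Real.log (k / δ)) D.card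
    (D := D) rfl fun D' _ hne => by
      obtain ⟨j, hj, hlt⟩ := exists_pmh_lt hδ hσ hne
      refine ⟨j, hj, ?_⟩
      have hpos : (0 : ℝ) < D'.card := by exact_mod_cast Finset.card_pos.mpr hne
      have h2 := Real.log_le_log pmh_pos hlt.le
      rw [← exp_logPmh, Real.log_exp] at h2
      rw [← Real.log_div (by positivity) (by positivity), div_div]
      exact h2
  refine h1.trans ?_
  have h3 : (D.card : ℝ) * Real.log (k / δ)
      = D.card * Real.log (1 / δ) + Real.log ((k : ℝ) ^ D.card) := by
    rw [Real.log_pow, ← mul_add, ← Real.log_mul (by positivity) (by positivity)]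
    congr 2
    ring
  have h4 : Real.log ((k : ℝ) ^ D.card) - Real.log (D.card.factorial) ≤ k := by
    rw [← Real.log_div (by positivity) (by positivity), Real.log_le_iff_le_exp (by positivity)]
    exact Real.pow_div_factorial_le_exp _ hk.le _
  linarith

/-- An arm that is not rejected has an e-value below `k / δ`, the threshold for a single
rejection. -/
theorem logPmh_le {s : ℕ} (hδ : 0 < δ) (hj : j ∉ rejSet δ A x s) :
    logPmh A x j s ≤ Real.log k + Real.log (1 / δ) := by
  have hk : (0 : ℝ) < k := by exact_mod_cast Fin.pos j
  have h1 : pmh A x j s < k / δ := by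
    by_contra! hcon
    have : ({j} : Finset (Fin k)) ⊆ rejSet δ A x s := subset_rejSet fun i hi => by
      rw [Finset.mem_singleton.mp hi]
      simpa using hcon
    exact hj (this (Finset.mem_singleton_self j))
  have h2 := Real.log_le_log pmh_pos h1.le
  rw [← exp_logPmh, Real.log_exp] at h2
  rw [← Real.log_mul (by positivity) (by positivity), mul_one_div]
  exact h2

end Run

/-! ### Inverting the iterated logarithms -/

/-- A common upper bound for the three boundaries. A negative radicand is harmless, as the width is
then `0`. -/
theorem Boundary.nat_mul_width_sq_le {φ : Boundary} {δ : ℝ} (hadm : φ.Admissible δ) {n : ℕ}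
    (hn : 1 ≤ n) :
    n * φ.width n δ ^ 2 ≤ 8 * Real.log (1 / δ) + 4 * Real.log (1 + Real.log n) + 4 := by
  have hn' : (1 : ℝ) ≤ n := by exact_mod_cast hn
  have hln : 0 ≤ Real.log n := Real.log_nonneg hn'
  have hlln : 0 ≤ Real.log (1 + Real.log n) := Real.log_nonneg (by linarith)
  have hδ01 : 0 < δ ∧ δ < 1 := by
    cases φ with
    | zero => exact hadm
    | is => exact hadm
    | jj => exact ⟨hadm.1, by linarith [hadm.2]⟩
  obtain ⟨hδ, hδ1⟩ := hδ01
  have hL : 0 < Real.log (1 / δ) := Real.log_pos (by rw [lt_div_iff₀ hδ]; linarith)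
  set L := Real.log (1 / δ) with hLdef
  have key : ∀ V : ℝ, V ≤ 8 * L + 4 * Real.log (1 + Real.log n) + 4 →
      n * Real.sqrt (V / n) ^ 2 ≤ 8 * L + 4 * Real.log (1 + Real.log n) + 4 := by
    intro V hV
    rcases le_or_gt 0 V with h0 | h0
    · rw [Real.sq_sqrt (by positivity), mul_div_cancel₀ _ (by positivity)]
      exact hV
    · rw [Real.sqrt_eq_zero_of_nonpos (div_nonpos_of_nonpos_of_nonneg h0.le (by positivity))]
      simp only [ne_eq, OfNat.ofNat_ne_zero, not_false_eq_true, zero_pow, mul_zero]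
      positivity
  have hl2 := Real.log_two_gt_d9
  cases φ with
  | zero =>
    refine key _ ?_
    have hlb : Real.logb 2 (2 * (n : ℝ)) ≤ Real.exp 1 * (1 + Real.log n) := by
      rw [Real.logb, Real.log_mul (by norm_num) (by positivity), div_le_iff₀ (by positivity)]
      have h1 : 1 ≤ Real.exp 1 * Real.log 2 := by nlinarith [Real.exp_one_gt_d9]
      nlinarith [Real.log_two_lt_d9]
    have hlb0 : 0 < Real.logb 2 (2 * (n : ℝ)) := Real.logb_pos (by norm_num) (by linarith)
    have h2 := Real.log_le_log hlb0 hlb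
    rw [Real.log_mul (Real.exp_pos 1).ne' (by positivity), Real.log_exp] at h2
    rw [div_eq_mul_one_div, Real.log_mul hlb0.ne' (by positivity), ← hLdef]
    linarith
  | jj =>
    refine key _ ?_
    have h1 : Real.log (Real.exp 1 * (n : ℝ) / 2) = 1 + Real.log n - Real.log 2 := by
      rw [Real.log_div (by positivity) (by norm_num),
        Real.log_mul (Real.exp_pos 1).ne' (by positivity), Real.log_exp]
    have h2 : Real.log (1 + Real.log n - Real.log 2) ≤ Real.log (1 + Real.log n) :=
      Real.log_le_log (by linarith [Real.log_two_lt_d9]) (by linarith)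
    have h3 := Real.log_le_sub_one_of_pos hL
    rw [h1]
    linarith
  | is =>
    refine key _ ?_
    have e1 : Real.log 2.041 ≤ 1 := by
      rw [Real.log_le_iff_le_exp (by norm_num)]
      linarith [Real.exp_one_gt_d9]
    have e2 : 0 < Real.log 2.041 := Real.log_pos (by norm_num)
    have h1 : Real.log (Real.log (2.041 * (n : ℝ))) ≤ Real.log (1 + Real.log n) := by
      rw [Real.log_mul (by norm_num) (by positivity)]
      exact Real.log_le_log (by positivity) (by linarith)
    have h2 : Real.log (4.983 / δ) = Real.log 4.983 + L := by
      rw [div_eq_mul_one_div, Real.log_mul (by norm_num) (by positivity)]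
    have h3 : Real.log 4.983 ≤ Real.log 5 := Real.log_le_log (by norm_num) (by norm_num)
    have h4 := Real.log_five_lt_d9
    rw [h2]
    linarith

theorem log_le_div_add {y c : ℝ} (hy : 0 < y) (hc : 0 < c) :
    Real.log y ≤ y / c + Real.log c - 1 := by
  have := Real.log_le_sub_one_of_pos (div_pos hy hc)
  rw [Real.log_div hy.ne' hc.ne'] at this
  linarith

theorem log_thirtysix_le : Real.log 36 ≤ 3.6 := by
  have h : Real.log 36 = 2 * Real.log 2 + 2 * Real.log 3 := by
    rw [show (36 : ℝ) = 2 ^ 2 * 3 ^ 2 by norm_num, Real.log_mul (by norm_num) (by norm_num),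
      Real.log_pow, Real.log_pow]
    norm_num
  linarith [Real.log_two_lt_d9, Real.log_three_lt_d9]

theorem log_thirtytwo_le : Real.log 32 ≤ 3.47 := by
  have h : Real.log 32 = 5 * Real.log 2 := by
    rw [show (32 : ℝ) = 2 ^ 5 by norm_num, Real.log_pow]
    norm_num
  linarith [Real.log_two_lt_d9]

/-- Solving `n ≲ h (L + log log n)` for `n`. -/
theorem le_of_le_loglog {n h L : ℝ} (hn : 1 ≤ n) (hh : Real.exp 1 ≤ h)
    (hle : n ≤ 4 * h * (8 * L + 4 * Real.log (1 + Real.log n) + 4)) :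
    n ≤ h * (64 * L + 32 * Real.log (Real.log h) + 136) := by
  have hh0 : 0 < h := (Real.exp_pos 1).trans_le hh
  have hlh : 1 ≤ Real.log h := by rwa [Real.le_log_iff_exp_le hh0]
  have hln : 0 ≤ Real.log n := Real.log_nonneg hn
  set r := n / h with hr
  have hr0 : 0 < r := by positivity
  set ρ := max (Real.log r) 0 with hρ
  have hρ0 : 0 ≤ ρ := le_max_right _ _
  have h1 : Real.log n ≤ Real.log h + ρ := by
    have : Real.log r = Real.log n - Real.log h := Real.log_div (by positivity) hh0.ne'
    linarith [le_max_left (Real.log r) 0]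
  have h2 : Real.log (1 + Real.log n) ≤ Real.log 2 + Real.log (Real.log h) + ρ := by
    calc Real.log (1 + Real.log n) ≤ Real.log (2 * Real.log h * (1 + ρ)) :=
          Real.log_le_log (by linarith) (by nlinarith)
      _ = Real.log 2 + Real.log (Real.log h) + Real.log (1 + ρ) := by
          rw [Real.log_mul (by positivity) (by positivity),
            Real.log_mul (by norm_num) (by positivity)]
      _ ≤ _ := by
          have := Real.log_le_sub_one_of_pos (show 0 < 1 + ρ by positivity)
          linarith
  have h3 : ρ ≤ r / 32 + 2.47 := by
    have h4 := log_le_div_add hr0 (show (0 : ℝ) < 32 by norm_num)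
    have h5 := log_thirtytwo_le
    exact max_le (by linarith) (by positivity)
  have h6 : r ≤ 4 * (8 * L + 4 * Real.log (1 + Real.log n) + 4) := by
    rw [hr, div_le_iff₀ hh0]
    linarith
  have h7 : r ≤ 64 * L + 32 * Real.log (Real.log h) + 136 := by
    have := Real.log_two_lt_d9
    linarith
  rw [hr, div_le_iff₀ hh0] at h7
  linarith

/-- Solving `n ≲ h (c + log n)` for `n`. -/
theorem le_of_le_log {n h c : ℝ} (hn : 0 ≤ n) (hh : Real.exp 1 ≤ h)
    (hle : n - 1 ≤ 8 * h * (c + 9 / 4 * Real.log (n + 1))) :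
    n ≤ h * (16 * c + 36 * Real.log h + 97) := by
  have hh0 : 0 < h := (Real.exp_pos 1).trans_le hh
  have hh1 : 1 ≤ h := by linarith [Real.exp_one_gt_d9]
  set r := n / h with hr
  have hr0 : 0 ≤ r := by positivity
  have hnr : n = r * h := by rw [hr]; field_simp
  have h1 : Real.log (n + 1) ≤ Real.log h + Real.log (r + 1) := by
    rw [← Real.log_mul hh0.ne' (by positivity)]
    refine Real.log_le_log (by positivity) ?_
    rw [hnr]
    linarith
  have h2 := log_le_div_add (show 0 < r + 1 by positivity) (show (0 : ℝ) < 36 by norm_num)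
  have h3 := log_thirtysix_le
  have h4 : r - 1 ≤ 8 * (c + 9 / 4 * Real.log (n + 1)) := by
    rw [hr, sub_le_iff_le_add, div_le_iff₀ hh0]
    linarith
  have h5 : r ≤ 16 * c + 36 * Real.log h + 97 := by linarith
  rw [hr, div_le_iff₀ hh0] at h5
  linarith

/-! ### Gaps and numbers of samples -/

section Gaps

variable {k : ℕ} {μ : Fin k → ℝ}

theorem mem_nulls {i : Fin k} : i ∈ nulls μ ↔ μ i ≤ 0 := by simp [nulls]

theorem mem_nonNulls {i : Fin k} : i ∈ nonNulls μ ↔ 0 < μ i := by simp [nonNulls]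

theorem sum_nulls_add_sum_nonNulls (f : Fin k → ℝ) :
    ∑ i ∈ nulls μ, f i + ∑ i ∈ nonNulls μ, f i = ∑ i, f i := by
  classical
  rw [← Finset.sum_filter_add_sum_filter_not Finset.univ (fun i => μ i ≤ 0)]
  simp only [not_le]
  congr

theorem card_nulls_add_card_nonNulls : (nulls μ).card + (nonNulls μ).card = k := by
  have h := sum_nulls_add_sum_nonNulls (μ := μ) fun _ => 1
  simp only [Finset.sum_const, nsmul_eq_mul, mul_one, Finset.card_univ, Fintype.card_fin] at h
  exact_mod_cast h

theorem minGap_le {i : Fin k} (hi : 0 < μ i) : minGap μ ≤ μ i :=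
  ciInf_le (Set.finite_range _).bddBelow (⟨i, hi⟩ : {i : Fin k // 0 < μ i})

theorem minGap_pos (hne : (nonNulls μ).Nonempty) : 0 < minGap μ := by
  obtain ⟨i, hi⟩ := hne
  have : Nonempty {i : Fin k // 0 < μ i} := ⟨⟨i, mem_nonNulls.mp hi⟩⟩
  obtain ⟨j, hj⟩ := exists_eq_ciInf_of_finite (f := fun i : {i : Fin k // 0 < μ i} => μ i)
  rw [minGap, ← hj]
  exact j.2

theorem minGap_le_gap (i : Fin k) : minGap μ ≤ gap μ i := by
  unfold gap
  split_ifs with h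
  · exact minGap_le h
  · linarith

theorem gap_pos (hne : (nonNulls μ).Nonempty) (i : Fin k) : 0 < gap μ i :=
  (minGap_pos hne).trans_le (minGap_le_gap i)

theorem exp_one_le_invSq (d : ℝ) : Real.exp 1 ≤ invSq d := le_max_right _ _

theorem one_le_invSq_mul_sq {d : ℝ} (hd : 0 < d) : 1 ≤ invSq d * d ^ 2 := by
  have h : (d ^ 2)⁻¹ ≤ invSq d := le_max_left _ _
  calc 1 = (d ^ 2)⁻¹ * d ^ 2 := by field_simp
    _ ≤ _ := by gcongr

end Gaps

section Run

variable {k : ℕ} {φ : Boundary} {δ : ℝ} {A : ℕ → Option (Fin k)} {x : Fin k → ℕ → ℝ} {i j : Fin k}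
  {t : ℕ} {μ : Fin k → ℝ}

theorem sampleMean_eq (m : ℝ) (hn : 1 ≤ numPulls A i t) :
    sampleMean A x i t = m - deficit A x i m t / numPulls A i t := by
  have h0 : (0 : ℝ) < numPulls A i t := by exact_mod_cast hn
  rw [sampleMean, deficit, Finset.sum_sub_distrib, Finset.sum_const, nsmul_eq_mul, ← numPulls]
  field_simp
  ring

theorem ucbIndex_eq (m : ℝ) (hn : 1 ≤ numPulls A i t) :
    ucbIndex φ δ A x i t = ((m - deficit A x i m t / numPulls A i t
      + φ.width (numPulls A i t) δ : ℝ) : EReal) := by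
  rw [ucbIndex, if_neg (by omega), sampleMean_eq m hn]

/-- If its upper confidence bound is valid, a non-null arm `i` that is not rejected forces a null
arm that is sampled to have a large upper confidence bound itself. -/
theorem IsUCBRun.gap_le (hrun : IsUCBRun φ δ A x) (hi : 0 < μ i)
    (hvalid : ∀ s, 1 ≤ numPulls A i s →
      deficit A x i (μ i) s ≤ φ.sumWidth δ (numPulls A i s))
    (hit : i ∉ rejSet δ A x t) (hj : μ j ≤ 0) (hA : A (t + 1) = some j)
    (hn : 1 ≤ numPulls A j t) :
    numPulls A j t * gap μ j ≤ numPulls A j t * φ.width (numPulls A j t) δ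
      - deficit A x j (μ j) t := by
  have h0 : (0 : ℝ) < numPulls A j t := by exact_mod_cast hn
  have h1 := hrun.ucbIndex_le t j hA i hit
  have h2 : ((μ i : ℝ) : EReal) ≤ ucbIndex φ δ A x i t := by
    by_cases hi0 : numPulls A i t = 0
    · rw [ucbIndex, if_pos hi0]
      exact le_top
    · have hi1 : 1 ≤ numPulls A i t := by omega
      have hi2 : (0 : ℝ) < numPulls A i t := by exact_mod_cast hi1
      rw [ucbIndex_eq (μ i) hi1, EReal.coe_le_coe_iff]
      have h3 := hvalid t hi1
      rw [Boundary.sumWidth] at h3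
      have h4 : deficit A x i (μ i) t / numPulls A i t ≤ φ.width (numPulls A i t) δ := by
        rw [div_le_iff₀ hi2]
        linarith
      linarith
  have h5 := h2.trans h1
  rw [ucbIndex_eq (μ j) hn, EReal.coe_le_coe_iff] at h5
  have h6 : gap μ j ≤ φ.width (numPulls A j t) δ - deficit A x j (μ j) t / numPulls A j t := by
    have := minGap_le hi
    rw [gap, if_neg (not_lt.mpr hj)]
    linarith
  calc (numPulls A j t : ℝ) * gap μ j
      ≤ numPulls A j t * (φ.width (numPulls A j t) δ
        - deficit A x j (μ j) t / numPulls A j t) := by gcongr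
    _ = _ := by field_simp

/-- The nonnegative supermartingale that controls the noise of an arm: for a null arm, the
Hoeffding supermartingale with half the gap as its parameter. -/
def armPotential (μ : Fin k → ℝ) (A : ℕ → Option (Fin k)) (x : Fin k → ℕ → ℝ) (j : Fin k)
    (t : ℕ) : ℝ :=
  if 0 < μ j then growthPotential (μ j) (growthState A x j (μ j) t)
  else Real.exp (-(gap μ j / 2) * deficit A x j (μ j) t - numPulls A j t * (gap μ j / 2) ^ 2 / 2)

theorem armPotential_pos (μ : Fin k → ℝ) (j : Fin k) (t : ℕ) : 0 < armPotential μ A x j t := by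
  unfold armPotential
  split_ifs
  · exact growthPotential_pos _ _
  · exact Real.exp_pos _

theorem armPotential_zero (μ : Fin k → ℝ) (j : Fin k) : armPotential μ A x j 0 = 1 := by
  unfold armPotential
  split_ifs
  · norm_num [growthPotential, growthState, armState]
  · simp [deficit, numPulls, pullTimes_zero]

/-- Number of samples of a null arm while a non-null arm with a valid upper confidence bound is not
rejected. -/
theorem IsUCBRun.numPulls_null_le (hrun : IsUCBRun φ δ A x) (hadm : φ.Admissible δ)
    (hL : 0 ≤ Real.log (1 / δ)) (hδ : 0 < δ) (hi : 0 < μ i)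
    (hvalid : ∀ s, 1 ≤ numPulls A i s →
      deficit A x i (μ i) s ≤ φ.sumWidth δ (numPulls A i s))
    (hit : i ∉ rejSet δ A x t) (hj : μ j ≤ 0) {h ξ : ℝ} (hh : Real.exp 1 ≤ h)
    (hgap0 : 0 < gap μ j) (hgap : 1 ≤ h * gap μ j ^ 2)
    (hξ0 : 0 ≤ ξ) (hξ : ∀ s ≤ t, Real.log (armPotential μ A x j s) ≤ ξ) :
    (numPulls A j t : ℝ)
      ≤ h * (8 * ξ + 64 * Real.log (1 / δ) + 32 * Real.log (Real.log h) + 137) := by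
  have hh0 : 0 < h := (Real.exp_pos 1).trans_le hh
  have hh1 : 1 ≤ h := by linarith [Real.exp_one_gt_d9]
  have hlh : 1 ≤ Real.log h := by rwa [Real.le_log_iff_exp_le hh0]
  have hllh : 0 ≤ Real.log (Real.log h) := Real.log_nonneg hlh
  set L := Real.log (1 / δ) with hLdef
  have hK : 0 ≤ 8 * ξ + 64 * L + 32 * Real.log (Real.log h) + 136 := by positivity
  rcases Nat.eq_zero_or_pos (numPulls A j t) with h0 | h0
  · rw [h0, Nat.cast_zero]
    positivity
  obtain ⟨s, hst, hA, hN⟩ := exists_last_pull h0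
  rw [hN]
  push_cast
  suffices hs : (numPulls A j s : ℝ)
      ≤ h * (8 * ξ + 64 * L + 32 * Real.log (Real.log h) + 136) by nlinarith
  rcases Nat.eq_zero_or_pos (numPulls A j s) with h1 | h1
  · rw [h1, Nat.cast_zero]
    positivity
  have his : i ∉ rejSet δ A x s := fun h => hit (hrun.rejSet_mono hδ hst.le h)
  have hg := hrun.gap_le hi hvalid his hj hA h1
  set n := numPulls A j s with hn
  have hn1 : (1 : ℝ) ≤ n := by exact_mod_cast h1
  set g := gap μ j with hgdef
  have hng : (n : ℝ) ≤ h * (n * g ^ 2) := by nlinarith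
  -- either the width or the noise makes up half of the gap
  rcases le_or_gt (g / 2) (φ.width n δ) with hw | hw
  · have h2 := Boundary.nat_mul_width_sq_le hadm h1
    have h3 : n * (g / 2) ^ 2 ≤ n * φ.width n δ ^ 2 := by gcongr
    have h4 : (n : ℝ) ≤ 4 * h * (8 * L + 4 * Real.log (1 + Real.log n) + 4) := by
      have := mul_le_mul_of_nonneg_left (h3.trans h2) hh0.le
      linarith
    refine (le_of_le_loglog hn1 hh h4).trans ?_
    gcongr
    linarith
  · have h2 := hξ s hst.le
    rw [armPotential, if_neg (not_lt.mpr hj), Real.log_exp, ← hn, ← hgdef] at h2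
    have h3 : n * (g / 2) ≤ -deficit A x j (μ j) s := by nlinarith
    have h4 : n * g ^ 2 ≤ 8 * ξ := by nlinarith
    calc (n : ℝ) ≤ h * (n * g ^ 2) := hng
      _ ≤ _ := by
        gcongr
        linarith

/-- Number of samples of a non-null arm, in terms of its log-e-value at the last time it is not
rejected. -/
theorem IsUCBRun.numPulls_nonNull_le (hrun : IsUCBRun φ δ A x) (hj : 0 < μ j) {s : ℕ}
    (hs : IsLastUnrejected δ A x j t s) {h ξ : ℝ} (hh : Real.exp 1 ≤ h)
    (hgap : 1 ≤ h * gap μ j ^ 2)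
    (hξ0 : 0 ≤ ξ) (hξ : ∀ s ≤ t, Real.log (armPotential μ A x j s) ≤ ξ) :
    (numPulls A j t : ℝ)
      ≤ h * (16 * logPmh A x j s + 104 * ξ + 36 * Real.log h + 171) := by
  have hh0 : 0 < h := (Real.exp_pos 1).trans_le hh
  have hh1 : 1 ≤ h := by linarith [Real.exp_one_gt_d9]
  have hlh : 1 ≤ Real.log h := by rwa [Real.le_log_iff_exp_le hh0]
  have hN : (numPulls A j t : ℝ) ≤ numPulls A j s + 1 := by exact_mod_cast hs.numPulls_le hrun
  have h1 := numPulls_mul_sq_le (A := A) (x := x) (i := j) hj.le s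
  have h2 := hξ s hs.1
  rw [armPotential, if_pos hj] at h2
  rw [Real.log_mul (by norm_num) (growthPotential_pos _ _).ne'] at h1
  rw [gap, if_pos hj] at hgap
  refine hN.trans ?_
  rcases Nat.eq_zero_or_pos (numPulls A j s) with h0 | h0
  · have hE : logPmh A x j s = 0 := by
      rw [logPmh, Finset.card_eq_zero.mp h0, Finset.sum_empty]
    rw [h0, hE]
    push_cast
    nlinarith [mul_nonneg hh0.le hξ0]
  set n := numPulls A j s with hn
  have hn1 : (1 : ℝ) ≤ n := by exact_mod_cast h0
  have hl2 := Real.log_two_lt_d9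
  have h3 : (n : ℝ) - 1 ≤ 8 * h * (logPmh A x j s + 4.51 + 6.5 * ξ
      + 9 / 4 * Real.log (n + 1)) := by
    have h4 : ((n : ℝ) - 1) * μ j ^ 2 / 8 ≤ logPmh A x j s + 4.51 + 6.5 * ξ
      + 9 / 4 * Real.log (n + 1) := by linarith
    have h5 := mul_le_mul_of_nonneg_left h4 hh0.le
    have h6 := mul_le_mul_of_nonneg_left hgap (sub_nonneg.mpr hn1)
    linarith
  have h7 := le_of_le_log (by positivity) hh h3
  have h8 : h * (16 * (logPmh A x j s + 4.51 + 6.5 * ξ) + 36 * Real.log h + 97) + 1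
      ≤ h * (16 * logPmh A x j s + 104 * ξ + 36 * Real.log h + 171) := by
    norm_num
    linarith
  linarith

/-- As long as some non-null arm with a valid upper confidence bound is not rejected, the time is
bounded by the evidence collected and by the noise of the arms. -/
theorem IsUCBRun.time_le (hrun : IsUCBRun φ δ A x) (hadm : φ.Admissible δ)
    (hδ : 0 < δ) (hδ1 : δ < 1) (hi : 0 < μ i)
    (hvalid : ∀ s, 1 ≤ numPulls A i s →
      deficit A x i (μ i) s ≤ φ.sumWidth δ (numPulls A i s))
    (hit : i ∉ rejSet δ A x t) {h ξ : Fin k → ℝ} (hh : ∀ j, Real.exp 1 ≤ h j)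
    (hgap : ∀ j, 1 ≤ h j * gap μ j ^ 2)
    (hξ0 : ∀ j, 0 ≤ ξ j) (hξ : ∀ j, ∀ s ≤ t, Real.log (armPotential μ A x j s) ≤ ξ j)
    {Λ : ℝ} (hΛ : ∀ σ : Fin k → ℕ, (∀ j, IsLastUnrejected δ A x j t (σ j)) →
      ∑ j ∈ nonNulls μ, h j * logPmh A x j (σ j) ≤ Λ) :
    (t : ℝ) ≤ ∑ j ∈ nulls μ, h j * (64 * Real.log (1 / δ) + 32 * Real.log (Real.log (h j)) + 137)
      + ∑ j ∈ nonNulls μ, h j * (36 * Real.log (h j) + 171) + 16 * Λ + 104 * ∑ j, h j * ξ j := by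
  choose σ hσ using fun j => exists_isLastUnrejected (A := A) (x := x) hδ hδ1 j t
  have hne : (nonNulls μ).Nonempty := ⟨i, mem_nonNulls.mpr hi⟩
  have hL : 0 ≤ Real.log (1 / δ) := Real.log_nonneg (by rw [le_div_iff₀ hδ]; linarith)
  have hsum : ∑ j, (numPulls A j t : ℝ) = t := by
    exact_mod_cast sum_numPulls_eq fun s hs =>
      hrun.exists_eq s i fun h => hit (hrun.rejSet_mono hδ hs.le h)
  have hh0 : ∀ j, 0 < h j := fun j => (Real.exp_pos 1).trans_le (hh j)
  rw [← hsum, ← sum_nulls_add_sum_nonNulls (μ := μ)]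
  have h0 : ∑ j ∈ nulls μ, (numPulls A j t : ℝ) ≤ ∑ j ∈ nulls μ,
      (h j * (64 * Real.log (1 / δ) + 32 * Real.log (Real.log (h j)) + 137)
        + 104 * (h j * ξ j)) := by
    refine Finset.sum_le_sum fun j hj => ?_
    refine (hrun.numPulls_null_le hadm hL hδ hi hvalid hit (mem_nulls.mp hj) (hh j)
      (gap_pos hne j) (hgap j) (hξ0 j) (hξ j)).trans ?_
    nlinarith [mul_nonneg (hh0 j).le (hξ0 j)]
  have h1 : ∑ j ∈ nonNulls μ, (numPulls A j t : ℝ) ≤ ∑ j ∈ nonNulls μ,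
      (h j * (36 * Real.log (h j) + 171) + 16 * (h j * logPmh A x j (σ j))
        + 104 * (h j * ξ j)) := by
    refine Finset.sum_le_sum fun j hj => ?_
    refine (hrun.numPulls_nonNull_le (mem_nonNulls.mp hj) (hσ j) (hh j) (hgap j) (hξ0 j)
      (hξ j)).trans (le_of_eq ?_)
    ring
  have h2 := hΛ σ hσ
  simp only [Finset.sum_add_distrib, ← Finset.mul_sum] at h0 h1
  rw [← sum_nulls_add_sum_nonNulls (μ := μ) fun j => h j * ξ j]
  linarith

end Run

/-! ### Probability of a late rejection -/

section

variable {k : ℕ} {Ω : Type*} {X : Fin k → ℕ → Ω → ℝ} {U : Ω → ℝ} {φ : Boundary} {δ : ℝ}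
  {tie : ℝ → ℕ → Finset (Fin k) → Fin k}

/-- The maximum of the potential of arm `j` up to time `t`. -/
def maxPotential (φ : Boundary) (δ : ℝ) (tie : ℝ → ℕ → Finset (Fin k) → Fin k)
    (X : Fin k → ℕ → Ω → ℝ) (U : Ω → ℝ) (μ : Fin k → ℝ) (t : ℕ) (j : Fin k) (ω : Ω) : ℝ :=
  (Finset.range (t + 1)).sup' Finset.nonempty_range_add_one fun s =>
    armPotential μ (fun s => sampledArm φ δ tie X U s ω) (fun i s => X i s ω) j s

theorem armPotential_le_maxPotential {μ : Fin k → ℝ} {s t : ℕ} (h : s ≤ t) (j : Fin k) (ω : Ω) :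
    armPotential μ (fun s => sampledArm φ δ tie X U s ω) (fun i s => X i s ω) j s
      ≤ maxPotential φ δ tie X U μ t j ω :=
  Finset.le_sup' (fun s => armPotential μ (fun s => sampledArm φ δ tie X U s ω)
    (fun i s => X i s ω) j s) (Finset.mem_range.mpr (by omega))

theorem one_le_maxPotential {μ : Fin k → ℝ} (t : ℕ) (j : Fin k) (ω : Ω) :
    1 ≤ maxPotential φ δ tie X U μ t j ω := by
  rw [← armPotential_zero (A := fun s => sampledArm φ δ tie X U s ω) (x := fun i s => X i s ω) μ j]
  exact armPotential_le_maxPotential (Nat.zero_le t) j ω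

/-- Jensen's inequality for the logarithm, with weights proportional to `h`. -/
theorem sum_mul_log_le {ι : Type*} (s : Finset ι) {h W : ι → ℝ} (hh : ∀ j ∈ s, 0 ≤ h j)
    (hH : 0 < ∑ j ∈ s, h j) (hW : ∀ j ∈ s, 0 < W j) {c : ℝ}
    (hc : ∑ j ∈ s, h j / (∑ j ∈ s, h j) * Real.sqrt (W j) ≤ c) :
    ∑ j ∈ s, h j * Real.log (W j) ≤ 2 * (∑ j ∈ s, h j) * Real.log c := by
  set H := ∑ j ∈ s, h j with hHdef
  have hconc := strictConcaveOn_log_Ioi.concaveOn.le_map_sum (t := s) (w := fun j => h j / H)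
    (p := fun j => Real.sqrt (W j)) (fun j hj => div_nonneg (hh j hj) hH.le)
    (by rw [← Finset.sum_div, div_self hH.ne']) (fun j hj => Real.sqrt_pos.mpr (hW j hj))
  simp only [smul_eq_mul] at hconc
  have hpos : 0 < ∑ j ∈ s, h j / H * Real.sqrt (W j) := by
    obtain ⟨l, hl, hpos⟩ := Finset.exists_lt_of_sum_lt (f := fun _ : ι => (0 : ℝ)) (g := h)
      (s := s) (by simpa using hH)
    refine Finset.sum_pos' (fun j hj => mul_nonneg (div_nonneg (hh j hj) hH.le)
      (Real.sqrt_nonneg _)) ⟨l, hl, mul_pos (div_pos hpos hH) (Real.sqrt_pos.mpr (hW l hl))⟩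
  have h1 := hconc.trans (Real.log_le_log hpos hc)
  have h2 : ∑ j ∈ s, h j * Real.log (W j)
      = 2 * H * ∑ j ∈ s, h j / H * Real.log (Real.sqrt (W j)) := by
    rw [Finset.mul_sum]
    refine Finset.sum_congr rfl fun j hj => ?_
    rw [Real.log_sqrt (hW j hj).le]
    field_simp
  rw [h2]
  gcongr

end

section

variable {k : ℕ} {Ω : Type*} [mΩ : MeasurableSpace Ω] {P : Measure Ω} {ν : Fin k → Measure ℝ}
  {X : Fin k → ℕ → Ω → ℝ} {U : Ω → ℝ} {φ : Boundary} {δ : ℝ}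
  {tie : ℝ → ℕ → Finset (Fin k) → Fin k}

/-- The noise potentials of all arms are supermartingales. -/
theorem IsSubGaussianBandit.isNonnegSupermartingale_armPotential
    (hB : IsSubGaussianBandit P ν X U) (htie : IsTieBreak tie) (j : Fin k) :
    IsNonnegSupermartingale P (fullFiltration hB.measurable_reward hB.measurable_private)
      (fun t ω => ENNReal.ofReal (armPotential (armMean ν) (fun s => sampledArm φ δ tie X U s ω)
        (fun i s => X i s ω) j t)) ∧
    ∀ t, Measurable fun ω => armPotential (armMean ν) (fun s => sampledArm φ δ tie X U s ω)
        (fun i s => X i s ω) j t := by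
  have := hB.isProbabilityMeasure_law j
  have hle := (fullFiltration hB.measurable_reward hB.measurable_private).le
  by_cases hj : 0 < armMean ν j
  · simp only [armPotential, if_pos hj]
    refine ⟨hB.isNonnegSupermartingale (φ := φ) (δ := δ) htie j
      (measurable_growthUpd (armMean ν j)) (0, 0, 0, 0, 0)
      (ψ := fun s => ENNReal.ofReal (growthPotential (armMean ν j) s))
      (measurable_growthPotential _).ennreal_ofReal
      (lintegral_growthPotential_le (hB.subGaussian j)), fun t => ?_⟩
    exact (measurable_growthPotential _).comp ((hB.measurable_armState (φ := φ) (δ := δ) htie j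
      (measurable_growthUpd (armMean ν j)) (0, 0, 0, 0, 0) t).mono (hle t) le_rfl)
  · simp only [armPotential, if_neg hj]
    set a : ℝ := gap (armMean ν) j / 2 with ha
    set ψ : ℕ × ℝ → ℝ := fun s => Real.exp (-a * s.2 - s.1 * a ^ 2 / 2) with hψ
    have hψm : Measurable ψ := by
      have hn : Measurable fun p : ℕ × ℝ => (p.1 : ℝ) := measurable_from_nat.comp measurable_fst
      fun_prop
    set upd : ℕ × ℝ → ℝ → ℕ × ℝ := fun s y => (s.1 + 1, s.2 + (armMean ν j - y)) with hupd
    have hum : Measurable (Function.uncurry upd) := by fun_prop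
    have hstep : ∀ s, ∫⁻ y, ENNReal.ofReal (ψ (upd s y)) ∂(ν j) ≤ ENNReal.ofReal (ψ s) := by
      rintro ⟨n, S⟩
      refine le_trans (le_of_eq (lintegral_congr fun y => ?_))
        ((lintegral_exp_affine_le (hB.subGaussian j) (-a * S - ((n + 1 : ℕ) : ℝ) * a ^ 2 / 2)
          a).trans (ENNReal.ofReal_le_ofReal (Real.exp_le_exp.mpr (le_of_eq ?_))))
      · simp only [hψ, hupd, armMean]
        congr 2
        ring
      · push_cast
        ring
    have heq : ∀ t ω, ψ (armState (fun s => sampledArm φ δ tie X U s ω) (fun s => X j s ω) j upd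
        (0, 0) t) = Real.exp (-a * deficit (fun s => sampledArm φ δ tie X U s ω)
          (fun i s => X i s ω) j (armMean ν j) t
          - numPulls (fun s => sampledArm φ δ tie X U s ω) j t * a ^ 2 / 2) := by
      intro t ω
      rw [hupd, armState_deficit (x := fun i s => X i s ω)]
    have h1 := hB.isNonnegSupermartingale (φ := φ) (δ := δ) htie j hum (0, 0)
      (ψ := fun s => ENNReal.ofReal (ψ s)) hψm.ennreal_ofReal hstep
    have h2 := fun t => hψm.comp ((hB.measurable_armState (φ := φ) (δ := δ) htie j hum (0, 0)
      t).mono (hle t) le_rfl)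
    simp only [heq] at h1
    simp only [Function.comp_def, heq] at h2
    exact ⟨h1, h2⟩

/-- A weighted mean of the noise potentials is large with small probability only. -/
theorem IsSubGaussianBandit.measure_potential_ge_le (hB : IsSubGaussianBandit P ν X U)
    (htie : IsTieBreak tie) {w : Fin k → ℝ} (hw : ∀ j, 0 ≤ w j) (hw1 : ∑ j, w j = 1) {η : ℝ}
    (hη : 0 < η) (t : ℕ) :
    P {ω | 2 / η ≤ ∑ j, w j * Real.sqrt (maxPotential φ δ tie X U (armMean ν) t j ω)}
      ≤ ENNReal.ofReal η := by
  have := hB.isProbabilityMeasure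
  set f : Fin k → Ω → ℝ≥0∞ := fun j ω =>
    ENNReal.ofReal (Real.sqrt (maxPotential φ δ tie X U (armMean ν) t j ω)) with hf
  have hfm : ∀ j, Measurable (f j) := by
    intro j
    have h1 := (hB.isNonnegSupermartingale_armPotential (φ := φ) (δ := δ) htie j).2
    have h2 := Finset.measurable_sup' (s := Finset.range (t + 1)) Finset.nonempty_range_add_one
      (f := fun s ω => armPotential (armMean ν) (fun s => sampledArm φ δ tie X U s ω)
        (fun i s => X i s ω) j s) fun s _ => h1 s
    have h3 : Measurable (maxPotential φ δ tie X U (armMean ν) t j) := by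
      convert h2 using 1
      ext ω
      simp [maxPotential, Finset.sup'_apply]
    exact h3.sqrt.ennreal_ofReal
  have hf2 : ∀ j, ∫⁻ ω, f j ω ∂P ≤ 2 := by
    intro j
    have h1 := hB.isNonnegSupermartingale_armPotential (φ := φ) (δ := δ) htie j
    exact h1.1.lintegral_sqrt_sup_le h1.2 (fun t ω => (armPotential_pos _ _ _).le)
      (fun ω => (armPotential_zero _ _).le) t
  have hint : ∫⁻ ω, ∑ j, ENNReal.ofReal (w j) * f j ω ∂P ≤ 2 := by
    rw [lintegral_finsetSum' _ fun j _ => ((hfm j).const_mul _).aemeasurable]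
    calc _ = ∑ j, ENNReal.ofReal (w j) * ∫⁻ ω, f j ω ∂P :=
          Finset.sum_congr rfl fun j _ => lintegral_const_mul _ (hfm j)
      _ ≤ ∑ j, ENNReal.ofReal (w j) * 2 := by
          gcongr with j
          exact hf2 j
      _ = 2 := by
          rw [← Finset.sum_mul, ← ENNReal.ofReal_sum_of_nonneg fun j _ => hw j, hw1]
          simp
  have hsub : {ω | 2 / η ≤ ∑ j, w j * Real.sqrt (maxPotential φ δ tie X U (armMean ν) t j ω)}
      ⊆ {ω | ENNReal.ofReal (2 / η) ≤ ∑ j, ENNReal.ofReal (w j) * f j ω} := by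
    intro ω hω
    have hω : 2 / η ≤ ∑ j, w j * Real.sqrt (maxPotential φ δ tie X U (armMean ν) t j ω) := hω
    change ENNReal.ofReal (2 / η) ≤ _
    refine (ENNReal.ofReal_le_ofReal hω).trans (le_of_eq ?_)
    rw [ENNReal.ofReal_sum_of_nonneg fun j _ => mul_nonneg (hw j) (Real.sqrt_nonneg _)]
    exact Finset.sum_congr rfl fun j _ => ENNReal.ofReal_mul (hw j)
  have hη2 : ENNReal.ofReal (2 / η) ≠ 0 := by
    rw [ne_eq, ENNReal.ofReal_eq_zero, not_le]
    positivity
  calc _ ≤ P {ω | ENNReal.ofReal (2 / η) ≤ ∑ j, ENNReal.ofReal (w j) * f j ω} := measure_mono hsub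
    _ ≤ (∫⁻ ω, ∑ j, ENNReal.ofReal (w j) * f j ω ∂P) / ENNReal.ofReal (2 / η) :=
        meas_ge_le_lintegral_div (Finset.measurable_sum _ fun j _ =>
          (hfm j).const_mul _).aemeasurable hη2 ENNReal.ofReal_ne_top
    _ ≤ 2 / ENNReal.ofReal (2 / η) := by gcongr
    _ = ENNReal.ofReal η := by
        rw [show (2 : ℝ≥0∞) = ENNReal.ofReal 2 by simp,
          ← ENNReal.ofReal_div_of_pos (by positivity)]
        congr 1
        field_simp

/-- A non-null arm is still not rejected at a late time with probability at most `δ`: either its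
upper confidence bound failed, with probability at most `(1 - ε) δ`, or the noise of the arms is
large, with probability at most `ε δ`. -/
theorem IsSubGaussianBandit.measure_notMem_rejected_le (hB : IsSubGaussianBandit P ν X U)
    (htie : IsTieBreak tie) (hadm : φ.Admissible δ) (hδ : 0 < δ) (hδ1 : δ < 1) {ε : ℝ}
    (hε0 : 0 < ε) (hε : ε ≤ 0.001) (hεL : ε ≤ Real.log (1 / δ) / 1000) {i : Fin k}
    (hi : 0 < armMean ν i) {h : Fin k → ℝ} (hh : ∀ j, Real.exp 1 ≤ h j)
    (hgap : ∀ j, 1 ≤ h j * gap (armMean ν) j ^ 2) {Λ : ℝ} {t : ℕ}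
    (hΛ : ∀ (A : ℕ → Option (Fin k)) (x : Fin k → ℕ → ℝ) (σ : Fin k → ℕ),
      (∀ j, IsLastUnrejected δ A x j t (σ j)) →
      ∑ j ∈ nonNulls (armMean ν), h j * logPmh A x j (σ j) ≤ Λ)
    (ht : ∑ j ∈ nulls (armMean ν),
        h j * (64 * Real.log (1 / δ) + 32 * Real.log (Real.log (h j)) + 137)
      + ∑ j ∈ nonNulls (armMean ν), h j * (36 * Real.log (h j) + 171) + 16 * Λ
      + 208 * (∑ j, h j) * (Real.log (2 / ε) + Real.log (1 / δ)) < t) :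
    P {ω | i ∉ rejected φ δ tie X U t ω} ≤ ENNReal.ofReal δ := by
  have hh0 : ∀ j, 0 < h j := fun j => (Real.exp_pos 1).trans_le (hh j)
  have hH : 0 < ∑ j, h j := Finset.sum_pos (fun j _ => hh0 j) ⟨i, Finset.mem_univ i⟩
  set H := ∑ j, h j with hHdef
  have h1 := hB.measure_violation_le htie i hadm hε hεL
  have h2 := hB.measure_potential_ge_le (φ := φ) (δ := δ) htie (w := fun j => h j / H)
    (fun j => div_nonneg (hh0 j).le hH.le) (by rw [← Finset.sum_div, div_self hH.ne'])
    (η := ε * δ) (by positivity) t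
  have h3 : ENNReal.ofReal ((1 - ε) * δ) + ENNReal.ofReal (ε * δ) = ENNReal.ofReal δ := by
    rw [← ENNReal.ofReal_add (mul_nonneg (by linarith) hδ.le) (by positivity)]
    congr 1
    ring
  rw [← h3]
  refine (measure_mono ?_).trans ((measure_union_le _ _).trans (add_le_add h1 h2))
  intro ω hω
  by_contra hcon
  rw [Set.mem_union, not_or] at hcon
  obtain ⟨hv, hb⟩ := hcon
  have hb : ∑ j, h j / H * Real.sqrt (maxPotential φ δ tie X U (armMean ν) t j ω)
      < 2 / (ε * δ) := not_le.mp hb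
  have hrun : IsUCBRun φ δ (fun s => sampledArm φ δ tie X U s ω) (fun i s => X i s ω) :=
    isUCBRun_ucbArm fun t S hS => htie.mem (U ω) t S hS
  have h4 := hrun.time_le hadm hδ hδ1 hi (fun s hs => not_lt.mp fun hlt => hv ⟨s, hs, hlt⟩) hω hh
    hgap (ξ := fun j => Real.log (maxPotential φ δ tie X U (armMean ν) t j ω))
    (fun j => Real.log_nonneg (one_le_maxPotential t j ω))
    (fun j s hs => Real.log_le_log (armPotential_pos _ _ _) (armPotential_le_maxPotential hs j ω))
    (hΛ _ _)
  have h5 := sum_mul_log_le Finset.univ (fun j _ => (hh0 j).le) hH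
    (fun j _ => one_pos.trans_le (one_le_maxPotential t j ω)) hb.le
  have h6 : Real.log (2 / (ε * δ)) = Real.log (2 / ε) + Real.log (1 / δ) := by
    rw [← Real.log_mul (by positivity) (by positivity)]
    congr 1
    field_simp
  rw [h6] at h5
  linarith

/-- The true positive rate is the mean over the non-null arms of their rejection probabilities, so
it suffices to treat each arm separately. -/
theorem IsSubGaussianBandit.one_sub_le_TPR (hB : IsSubGaussianBandit P ν X U)
    (htie : IsTieBreak tie) (hδ : 0 ≤ δ) (hne : (nonNulls (armMean ν)).Nonempty) {t : ℕ}
    (h : ∀ i ∈ nonNulls (armMean ν),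
      P {ω | i ∉ rejected φ δ tie X U t ω} ≤ ENNReal.ofReal δ) :
    1 - δ ≤ TPR P (armMean ν) (fun ω => rejected φ δ tie X U t ω) := by
  classical
  have := hB.isProbabilityMeasure
  set H := nonNulls (armMean ν) with hH
  have hm : ∀ i, MeasurableSet {ω | i ∈ rejected φ δ tie X U t ω} := fun i =>
    measurableSet_mem_rejSet δ (A := fun s => sampledArm φ δ tie X U s) (fun s hs o =>
      measurableSet_sampledArm_eq φ δ htie hB.measurable_private t
        (fun i s _ => hB.measurable_reward i s) s (by omega) o)
      (fun i s _ => hB.measurable_reward i s) i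
  have hcard : ∀ ω, ((H ∩ rejected φ δ tie X U t ω).card : ℝ)
      = ∑ i ∈ H, {ω | i ∈ rejected φ δ tie X U t ω}.indicator (fun _ => (1 : ℝ)) ω := by
    intro ω
    rw [Finset.card_eq_sum_ones, ← Finset.filter_mem_eq_inter, Finset.sum_filter]
    push_cast
    refine Finset.sum_congr rfl fun i _ => ?_
    simp [Set.indicator_apply]
  have hpos : (0 : ℝ) < H.card := by exact_mod_cast Finset.card_pos.mpr hne
  unfold TPR
  simp only [← hH, hcard]
  rw [integral_div, integral_finsetSum _ fun i _ => (integrable_const 1).indicator (hm i),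
    le_div_iff₀ hpos]
  calc (1 - δ) * H.card = ∑ _i ∈ H, (1 - δ) := by
        rw [Finset.sum_const, nsmul_eq_mul]
        ring
    _ ≤ _ := Finset.sum_le_sum fun i hi => ?_
  rw [integral_indicator_const _ (hm i), smul_eq_mul, mul_one]
  have h1 : P.real {ω | i ∉ rejected φ δ tie X U t ω} ≤ δ :=
    ENNReal.toReal_le_of_le_ofReal hδ (h i hi)
  have h2 := probReal_compl_eq_one_sub (μ := P) (hm i)
  have h3 : {ω | i ∈ rejected φ δ tie X U t ω}ᶜ = {ω | i ∉ rejected φ δ tie X U t ω} := rfl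
  rw [h3] at h2
  linarith

end

/-! ### Constants -/

/-- The proportion of the level `δ` that is spent on the noise of the arms. It depends on `δ₀` only
and stays below what the confidence bounds leave unused for all `δ ≤ δ₀`. -/
def slack (δ₀ : ℝ) : ℝ := min (Real.log (1 / δ₀)) 1 / 1000

/-- The constant of the sample complexity bound, before rounding to an integer. -/
def rate (δ₀ : ℝ) : ℝ :=
  272 + (208 * Real.log (2 / slack δ₀) + 300) / Real.log (1 / δ₀)

section

variable {δ₀ : ℝ}

theorem log_one_div_pos {δ : ℝ} (h : 0 < δ) (h1 : δ < 1) : 0 < Real.log (1 / δ) :=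
  Real.log_pos (by rw [lt_div_iff₀ h]; linarith)

theorem slack_pos (h : 0 < δ₀) (h1 : δ₀ < 1) : 0 < slack δ₀ :=
  div_pos (lt_min (log_one_div_pos h h1) one_pos) (by norm_num)

theorem slack_le : slack δ₀ ≤ 0.001 := by
  have := min_le_right (Real.log (1 / δ₀)) 1
  rw [slack, div_le_iff₀ (by norm_num)]
  norm_num

theorem slack_le_log {δ : ℝ} (hδ : 0 < δ) (hle : δ ≤ δ₀) :
    slack δ₀ ≤ Real.log (1 / δ) / 1000 := by
  have h1 : Real.log (1 / δ₀) ≤ Real.log (1 / δ) :=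
    Real.log_le_log (one_div_pos.mpr (hδ.trans_le hle)) (one_div_le_one_div_of_le hδ hle)
  have := min_le_left (Real.log (1 / δ₀)) 1
  rw [slack]
  gcongr
  linarith

theorem log_two_div_slack_nonneg (h : 0 < δ₀) (h1 : δ₀ < 1) : 0 ≤ Real.log (2 / slack δ₀) := by
  refine Real.log_nonneg ?_
  have := slack_le (δ₀ := δ₀)
  rw [le_div_iff₀ (slack_pos h h1)]
  norm_num at this
  linarith

/-- Constants are absorbed in the rate, as `log (1 / δ)` is bounded away from zero. -/
theorem add_le_rate_mul (h : 0 < δ₀) (h1 : δ₀ < 1) {δ : ℝ} (hδ : 0 < δ) (hle : δ ≤ δ₀) :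
    272 * Real.log (1 / δ) + 208 * Real.log (2 / slack δ₀) + 300 ≤ rate δ₀ * Real.log (1 / δ) := by
  have hL0 := log_one_div_pos h h1
  have hL : Real.log (1 / δ₀) ≤ Real.log (1 / δ) :=
    Real.log_le_log (one_div_pos.mpr h) (one_div_le_one_div_of_le hδ hle)
  have hK := log_two_div_slack_nonneg h h1
  have h2 : 208 * Real.log (2 / slack δ₀) + 300
      ≤ (208 * Real.log (2 / slack δ₀) + 300) / Real.log (1 / δ₀) * Real.log (1 / δ) := by
    rw [div_mul_eq_mul_div, le_div_iff₀ hL0]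
    gcongr
  rw [rate]
  linarith

theorem rate_ge (h : 0 < δ₀) (h1 : δ₀ < 1) : 272 ≤ rate δ₀ := by
  have hK := log_two_div_slack_nonneg h h1
  have := div_nonneg (by linarith : 0 ≤ 208 * Real.log (2 / slack δ₀) + 300)
    (log_one_div_pos h h1).le
  rw [rate]
  linarith

/-- The contribution of a null arm, per unit of `h`, to the time bound. -/
theorem null_term_le (h : 0 < δ₀) (h1 : δ₀ < 1) {δ : ℝ} (hδ : 0 < δ) (hle : δ ≤ δ₀) {b : ℝ}
    (hb : Real.exp 1 ≤ b) :
    64 * Real.log (1 / δ) + 32 * Real.log (Real.log b) + 153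
        + 208 * (Real.log (2 / slack δ₀) + Real.log (1 / δ))
      ≤ rate δ₀ * Real.log (Real.log b / δ) := by
  have hlb : 1 ≤ Real.log b := by rwa [Real.le_log_iff_exp_le ((Real.exp_pos 1).trans_le hb)]
  have hllb : 0 ≤ Real.log (Real.log b) := Real.log_nonneg hlb
  have h2 := add_le_rate_mul h h1 hδ hle
  have h3 := rate_ge h h1
  have h4 : Real.log (Real.log b / δ) = Real.log (Real.log b) + Real.log (1 / δ) := by
    rw [← Real.log_mul (by positivity) (by positivity), mul_one_div]
  rw [h4, mul_add]
  nlinarith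

/-- The contribution of a non-null arm, per unit of `h`, to the time bound. -/
theorem nonNull_term_le (h : 0 < δ₀) (h1 : δ₀ < 1) {δ : ℝ} (hδ : 0 < δ) (hle : δ ≤ δ₀) {b : ℝ}
    (hb : Real.exp 1 ≤ b) :
    36 * Real.log b + 187 + 16 * Real.log (1 / δ)
        + 208 * (Real.log (2 / slack δ₀) + Real.log (1 / δ))
      ≤ rate δ₀ * (Real.log b * Real.log (1 / δ)) := by
  have hlb : 1 ≤ Real.log b := by rwa [Real.le_log_iff_exp_le ((Real.exp_pos 1).trans_le hb)]
  have hL := log_one_div_pos hδ (hle.trans_lt h1)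
  have hK := log_two_div_slack_nonneg h h1
  have h2 := mul_le_mul_of_nonneg_right (add_le_rate_mul h h1 hδ hle)
    (zero_le_one.trans hlb)
  nlinarith [mul_nonneg (sub_nonneg.mpr hlb) hL.le, mul_nonneg (sub_nonneg.mpr hlb) hK]

end

/-! ### The two sample complexity bounds -/

section

variable {k : ℕ} {Ω : Type*} [mΩ : MeasurableSpace Ω] {P : Measure Ω} {ν : Fin k → Measure ℝ}
  {X : Fin k → ℕ → Ω → ℝ} {U : Ω → ℝ} {φ : Boundary} {δ δ₀ : ℝ}
  {tie : ℝ → ℕ → Finset (Fin k) → Fin k}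

theorem Boundary.Admissible.pos (h : φ.Admissible δ) : 0 < δ := by
  cases φ <;> exact h.1

/-- Individual gaps: the evidence of each non-null arm before its rejection is at most
`log (k / δ)`. -/
theorem IsSubGaussianBandit.measure_notMem_le_of_armwiseBound (hB : IsSubGaussianBandit P ν X U)
    (htie : IsTieBreak tie) (hadm : φ.Admissible δ) (h0 : 0 < δ₀) (h1 : δ₀ < 1) (hle : δ ≤ δ₀)
    (hne : (nonNulls (armMean ν)).Nonempty) {t : ℕ}
    (ht : rate δ₀ * armwiseBound (armMean ν) δ < t) {i : Fin k}
    (hi : i ∈ nonNulls (armMean ν)) :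
    P {ω | i ∉ rejected φ δ tie X U t ω} ≤ ENNReal.ofReal δ := by
  have hδ := hadm.pos
  have hk : (1 : ℝ) ≤ k := by exact_mod_cast Fin.pos i
  have hlk : 0 ≤ Real.log k := Real.log_nonneg hk
  have hb0 : ∀ j, 0 < invSq (gap (armMean ν) j) := fun j =>
    (Real.exp_pos 1).trans_le (exp_one_le_invSq _)
  refine hB.measure_notMem_rejected_le htie hadm hδ (hle.trans_lt h1) (slack_pos h0 h1) slack_le
    (slack_le_log hδ hle) (mem_nonNulls.mp hi) (h := fun j => invSq (gap (armMean ν) j))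
    (fun j => exp_one_le_invSq _) (fun j => one_le_invSq_mul_sq (gap_pos hne j))
    (Λ := ∑ j ∈ nonNulls (armMean ν), invSq (gap (armMean ν) j)
      * (Real.log k + Real.log (1 / δ))) (fun A x σ hσ => ?_) (lt_of_le_of_lt ?_ ht)
  · refine Finset.sum_le_sum fun j _ => mul_le_mul_of_nonneg_left ?_ (hb0 j).le
    exact logPmh_le hδ (hσ j).2.1
  · rw [armwiseBound, ← sum_nulls_add_sum_nonNulls (μ := armMean ν)
      fun j => invSq (gap (armMean ν) j), mul_add, mul_add, add_mul]
    have e0 : ∑ j ∈ nulls (armMean ν), invSq (gap (armMean ν) j) * (64 * Real.log (1 / δ)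
          + 32 * Real.log (Real.log (invSq (gap (armMean ν) j))) + 137)
        + 208 * (∑ j ∈ nulls (armMean ν), invSq (gap (armMean ν) j))
          * (Real.log (2 / slack δ₀) + Real.log (1 / δ))
        ≤ rate δ₀ * ∑ j ∈ nulls (armMean ν), invSq (gap (armMean ν) j)
          * Real.log (Real.log (invSq (gap (armMean ν) j)) / δ) := by
      rw [Finset.mul_sum, Finset.mul_sum, Finset.sum_mul, ← Finset.sum_add_distrib]
      refine Finset.sum_le_sum fun j _ => ?_
      have := mul_le_mul_of_nonneg_left
        (null_term_le h0 h1 hδ hle (exp_one_le_invSq (gap (armMean ν) j))) (hb0 j).le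
      nlinarith [hb0 j]
    have e1 : ∑ j ∈ nonNulls (armMean ν), invSq (gap (armMean ν) j)
          * (36 * Real.log (invSq (gap (armMean ν) j)) + 171)
        + 16 * ∑ j ∈ nonNulls (armMean ν), invSq (gap (armMean ν) j)
          * (Real.log k + Real.log (1 / δ))
        + 208 * (∑ j ∈ nonNulls (armMean ν), invSq (gap (armMean ν) j))
          * (Real.log (2 / slack δ₀) + Real.log (1 / δ))
        ≤ rate δ₀ * ∑ j ∈ nonNulls (armMean ν), invSq (gap (armMean ν) j)
          * (Real.log (invSq (gap (armMean ν) j)) * Real.log (1 / δ) + Real.log k) := by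
      rw [Finset.mul_sum, Finset.mul_sum, Finset.mul_sum, Finset.sum_mul,
        ← Finset.sum_add_distrib, ← Finset.sum_add_distrib]
      refine Finset.sum_le_sum fun j _ => ?_
      have h2 := mul_le_mul_of_nonneg_left
        (nonNull_term_le h0 h1 hδ hle (exp_one_le_invSq (gap (armMean ν) j))) (hb0 j).le
      have h3 := mul_le_mul_of_nonneg_right (rate_ge h0 h1) (mul_nonneg (hb0 j).le hlk)
      nlinarith [hb0 j, mul_nonneg (hb0 j).le hlk]
    linarith

/-- Equal weights `h`: only the total evidence of the non-null arms matters, and for it `log k` per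
arm is replaced by `k / |H₁|`. -/
theorem IsSubGaussianBandit.measure_notMem_le_of_uniformBound (hB : IsSubGaussianBandit P ν X U)
    (htie : IsTieBreak tie) (hadm : φ.Admissible δ) (h0 : 0 < δ₀) (h1 : δ₀ < 1) (hle : δ ≤ δ₀)
    (hne : (nonNulls (armMean ν)).Nonempty) {t : ℕ}
    (ht : rate δ₀ * uniformBound (armMean ν) δ < t) {i : Fin k}
    (hi : i ∈ nonNulls (armMean ν)) :
    P {ω | i ∉ rejected φ δ tie X U t ω} ≤ ENNReal.ofReal δ := by
  have hδ := hadm.pos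
  set b := invSq (minGap (armMean ν)) with hb
  have hbe : Real.exp 1 ≤ b := exp_one_le_invSq _
  have hb0 : 0 < b := (Real.exp_pos 1).trans_le hbe
  have hgap : ∀ j, 1 ≤ b * gap (armMean ν) j ^ 2 := fun j => by
    refine (one_le_invSq_mul_sq (minGap_pos hne)).trans ?_
    have := (minGap_pos hne).le
    gcongr
    exact minGap_le_gap j
  set n₀ : ℝ := ((nulls (armMean ν)).card : ℝ) with hn0
  set n₁ : ℝ := ((nonNulls (armMean ν)).card : ℝ) with hn1
  have hk : (k : ℝ) = n₀ + n₁ := by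
    rw [hn0, hn1]
    exact_mod_cast (card_nulls_add_card_nonNulls (μ := armMean ν)).symm
  refine hB.measure_notMem_rejected_le htie hadm hδ (hle.trans_lt h1) (slack_pos h0 h1) slack_le
    (slack_le_log hδ hle) (mem_nonNulls.mp hi) (h := fun _ => b) (fun _ => hbe) hgap
    (Λ := b * (n₁ * Real.log (1 / δ) + k)) (fun A x σ hσ => ?_) (lt_of_le_of_lt ?_ ht)
  · rw [← Finset.mul_sum]
    exact mul_le_mul_of_nonneg_left (sum_logPmh_le hδ hσ _) hb0.le
  · rw [uniformBound, ← hb, ← hn0, ← hn1]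
    simp only [Finset.sum_const, nsmul_eq_mul, Finset.card_univ, Fintype.card_fin, ← hn0, ← hn1]
    rw [hk]
    have e0 := mul_le_mul_of_nonneg_left (null_term_le h0 h1 hδ hle hbe)
      (mul_nonneg (Nat.cast_nonneg _ : 0 ≤ n₀) hb0.le)
    have e1 := mul_le_mul_of_nonneg_left (nonNull_term_le h0 h1 hδ hle hbe)
      (mul_nonneg (Nat.cast_nonneg _ : 0 ≤ n₁) hb0.le)
    linarith

theorem le_armwiseBound (hδ : 0 < δ) (hδ1 : δ < 1) {μ : Fin k → ℝ} (hne : (nonNulls μ).Nonempty) :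
    Real.log (1 / δ) ≤ armwiseBound μ δ := by
  have hL := log_one_div_pos hδ hδ1
  have hpos : ∀ d, 1 ≤ invSq d ∧ 1 ≤ Real.log (invSq d) := fun d => by
    have h := exp_one_le_invSq d
    exact ⟨by linarith [Real.exp_one_gt_d9], by
      rwa [Real.le_log_iff_exp_le ((Real.exp_pos 1).trans_le h)]⟩
  obtain ⟨i, hi⟩ := hne
  have hk : (1 : ℝ) ≤ k := by exact_mod_cast Fin.pos i
  have hlk : 0 ≤ Real.log k := Real.log_nonneg hk
  have h0 : 0 ≤ ∑ j ∈ nulls μ, invSq (gap μ j) * Real.log (Real.log (invSq (gap μ j)) / δ) := by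
    refine Finset.sum_nonneg fun j _ => ?_
    obtain ⟨h1, h2⟩ := hpos (gap μ j)
    refine mul_nonneg (by linarith) (Real.log_nonneg ?_)
    rw [le_div_iff₀ hδ]
    linarith
  have hterm : ∀ j, Real.log (1 / δ) ≤ invSq (gap μ j)
      * (Real.log (invSq (gap μ j)) * Real.log (1 / δ) + Real.log k) := fun j => by
    obtain ⟨h1, h2⟩ := hpos (gap μ j)
    have h3 : Real.log (1 / δ) ≤ Real.log (invSq (gap μ j)) * Real.log (1 / δ) + Real.log k := by
      nlinarith
    nlinarith
  have h1 := Finset.single_le_sum (f := fun j => invSq (gap μ j)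
      * (Real.log (invSq (gap μ j)) * Real.log (1 / δ) + Real.log k))
    (fun j _ => hL.le.trans (hterm j)) hi
  have h2 := hterm i
  rw [armwiseBound]
  linarith

theorem le_uniformBound (hδ : 0 < δ) (hδ1 : δ < 1) {μ : Fin k → ℝ} (hne : (nonNulls μ).Nonempty) :
    Real.log (1 / δ) ≤ uniformBound μ δ := by
  have hL := log_one_div_pos hδ hδ1
  have hbe := exp_one_le_invSq (minGap μ)
  have hb1 : 1 ≤ invSq (minGap μ) := by linarith [Real.exp_one_gt_d9]
  have hlb : 1 ≤ Real.log (invSq (minGap μ)) := by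
    rwa [Real.le_log_iff_exp_le ((Real.exp_pos 1).trans_le hbe)]
  have hn : (1 : ℝ) ≤ (nonNulls μ).card := by exact_mod_cast Finset.card_pos.mpr hne
  have h0 : 0 ≤ ((nulls μ).card : ℝ) * invSq (minGap μ)
      * Real.log (Real.log (invSq (minGap μ)) / δ) := by
    refine mul_nonneg (by positivity) (Real.log_nonneg ?_)
    rw [le_div_iff₀ hδ]
    linarith
  have h1 : 1 * 1 * 1 * Real.log (1 / δ) ≤ ((nonNulls μ).card : ℝ) * invSq (minGap μ)
      * Real.log (invSq (minGap μ)) * Real.log (1 / δ) := by gcongr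
  rw [uniformBound]
  linarith

end

end BanditFDR

end

theorem mainTheorem7 :
    (∀ (k : ℕ) (Ω : Type*) [MeasurableSpace Ω] (P : MeasureTheory.Measure Ω)
      (ν : Fin k → MeasureTheory.Measure ℝ) (X : Fin k → ℕ → Ω → ℝ) (U : Ω → ℝ)
      (φ : BanditFDR.Boundary) (tie : ℝ → ℕ → Finset (Fin k) → Fin k) (δ : ℝ),
      BanditFDR.IsSubGaussianBandit P ν X U → BanditFDR.IsTieBreak tie → 0 < δ → δ < 1 →
      ∀ τ : Ω → WithTop ℕ, BanditFDR.IsStopping φ δ tie X U τ →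
        BanditFDR.FDR P (BanditFDR.armMean ν)
          (fun ω => BanditFDR.rejected φ δ tie X U (τ ω) ω) ≤ δ) ∧
    (∀ δ₀ : ℝ, 0 < δ₀ → δ₀ < 1 → ∃ c : ℝ, 0 < c ∧
      ∀ (k : ℕ) (Ω : Type*) [MeasurableSpace Ω] (P : MeasureTheory.Measure Ω)
      (ν : Fin k → MeasureTheory.Measure ℝ) (X : Fin k → ℕ → Ω → ℝ) (U : Ω → ℝ)
      (φ : BanditFDR.Boundary) (tie : ℝ → ℕ → Finset (Fin k) → Fin k) (δ : ℝ),
      BanditFDR.IsSubGaussianBandit P ν X U → BanditFDR.IsTieBreak tie → φ.Admissible δ →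
      δ ≤ δ₀ → (BanditFDR.nonNulls (BanditFDR.armMean ν)).Nonempty →
      ∃ T : ℕ,
        (T : ℝ) ≤ c * min (BanditFDR.armwiseBound (BanditFDR.armMean ν) δ)
          (BanditFDR.uniformBound (BanditFDR.armMean ν) δ) ∧
        ∀ t : ℕ, T ≤ t →
          1 - δ ≤ BanditFDR.TPR P (BanditFDR.armMean ν)
            (fun ω => BanditFDR.rejected φ δ tie X U t ω)) := by
  refine ⟨fun k Ω _ P ν X U φ tie δ hB htie hδ _ τ hτ => hB.FDR_le htie hδ hτ,
    fun δ₀ h0 h1 => ⟨BanditFDR.rate δ₀ + 1 / Real.log (1 / δ₀), ?_, ?_⟩⟩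
  · have := BanditFDR.rate_ge h0 h1
    have := BanditFDR.log_one_div_pos h0 h1
    positivity
  intro k Ω _ P ν X U φ tie δ hB htie hadm hle hne
  have hδ := hadm.pos
  have hL0 := BanditFDR.log_one_div_pos h0 h1
  have hL : Real.log (1 / δ₀) ≤ Real.log (1 / δ) :=
    Real.log_le_log (one_div_pos.mpr h0) (one_div_le_one_div_of_le hδ hle)
  set b := min (BanditFDR.armwiseBound (BanditFDR.armMean ν) δ)
    (BanditFDR.uniformBound (BanditFDR.armMean ν) δ) with hb
  have hbL : Real.log (1 / δ₀) ≤ b := hL.trans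
    (le_min (BanditFDR.le_armwiseBound hδ (hle.trans_lt h1) hne)
      (BanditFDR.le_uniformBound hδ (hle.trans_lt h1) hne))
  have hrb : 0 ≤ BanditFDR.rate δ₀ * b :=
    mul_nonneg (by linarith [BanditFDR.rate_ge h0 h1]) (hL0.le.trans hbL)
  -- the bound `b` is at least `log (1 / δ₀)`, which pays for rounding up to an integer
  refine ⟨⌊BanditFDR.rate δ₀ * b⌋₊ + 1, ?_, fun t ht => ?_⟩
  · push_cast
    have h2 := Nat.floor_le hrb
    have h3 : 1 ≤ 1 / Real.log (1 / δ₀) * b := by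
      rw [div_mul_eq_mul_div, one_mul, le_div_iff₀ hL0, one_mul]
      exact hbL
    rw [add_mul]
    linarith
  · have ht' : BanditFDR.rate δ₀ * b < t :=
      (Nat.lt_floor_add_one _).trans_le (by exact_mod_cast ht)
    refine hB.one_sub_le_TPR htie hδ.le hne fun i hi => ?_
    rcases min_choice (BanditFDR.armwiseBound (BanditFDR.armMean ν) δ)
      (BanditFDR.uniformBound (BanditFDR.armMean ν) δ) with hm | hm
    · rw [hb, hm] at ht'
      exact hB.measure_notMem_le_of_armwiseBound htie hadm h0 h1 hle hne ht' hi
    · rw [hb, hm] at ht'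
      exact hB.measure_notMem_le_of_uniformBound htie hadm h0 h1 hle hne ht' hi
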